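/- Let $Q$ be a finite quiver with vertex set $Q_0$, let $R$ be a set of relations in $Q$ (linear combinations of parallel paths of length at least two) generating an admissible ideal $J$ of $\mathbb{C}Q$, and assume that the finite-dimensional algebra $A=\mathbb{C}Q/J$ has finite global dimension. Let $D^b(A)$ be the bounded derived category of finite-dimensional $A$-modules. *Varieties of complexes.* A dimension vector sequence is a family $\mathbf d=(\mathbf d_i)_{i\in\mathbb Z}$ of vectors in $\mathbb N^{Q_0}$, almost all zero. Let $\mathcal C^b(A,\mathbf d)$ be the affine variety of all complexes of $A$-modules whose term in degree $i$ is an $A$-module structure (a representation of $(Q,R)$) on the graded space $\mathbb C^{\mathbf d_i}=\bigoplus_{v\in Q_0}\mathbb C^{\mathbf d_i(v)}$. Let $P_v$ $(v\in Q_0)$ be the indecomposable projective $A$-modules. For a projective dimension sequence $\mathbf e=(\mathbf e_i)_{i\in\mathbb Z}$ (also an almost everywhere zero family in $\mathbb N^{Q_0}$) let $\mathbf d(\mathbf e)$ be the sequence of the dimension vectors of $\bigoplus_v P_v^{\mathbf e_i(v)}$, and let $\mathcal P^b(A,\mathbf e)\subseteq \mathcal C^b(A,\mathbf d(\mathbf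 e))$ be the subvariety of the complexes whose term in degree $i$ is isomorphic to $\bigoplus_v P_v^{\mathbf e_i(v)}$ for every $i$. *Limits.* Let $\underline{\dim}$ send $\mathbf d$ to the common class in $K_0(D^b(A))$ of the complexes in $\mathcal C^b(A,\mathbf d)$, and fix $d\in K_0(D^b(A))$. On $\underline{\dim}^{-1}(d)$ put $\mathbf d_1\le \mathbf d_2$ if $\mathcal C^b(A,\mathbf d_2-\mathbf d_1)$ contains a direct sum of shifted copies of complexes $\cdots\to 0\to S\xrightarrow{1}S\to 0\to\cdots$ with $S$ simple. Choose such complexes $M(\mathbf d_1,\mathbf d_2)$, and identifications $\mathbb C^{\mathbf d_1}\oplus\mathbb C^{\mathbf d_2-\mathbf d_1}=\mathbb C^{\mathbf d_2}$ of the standard bases, such that the morphisms $T_{\mathbf d_1\mathbf d_2}\colon X\mapsto X\oplus M(\mathbf d_1,\mathbf d_2)$ form a direct system, and let $\mathcal C^b(A,d)$ be its direct limit. Similarly, on the set of the $\mathbf e$ with $\mathbf d(\mathbf e)\in\underline{\dim}^{-1}(d)$ put $\mathbf e_1\le\mathbf e_2$ if $\mathcal P^b(A,\mathbf e_2-\mathbf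 e_1)$ contains an acyclic complex, choose such complexes $P(\mathbf e_1,\mathbf e_2)$ and identifications $\mathbb C^{\mathbf d(\mathbf e_1)}\oplus\mathbb C^{\mathbf d(\mathbf e_2-\mathbf e_1)}=\mathbb C^{\mathbf d(\mathbf e_2)}$ of the standard bases such that the morphisms $X\mapsto X\oplus P(\mathbf e_1,\mathbf e_2)$ form a direct system, and let $\mathcal P^b(A,d)$ be its direct limit. Let $\mathcal Q^b(A,d)$ and $\mathcal{QP}^b(A,d)$ be the quotients of $\mathcal C^b(A,d)$ and $\mathcal P^b(A,d)$ by the relation that the corresponding complexes are isomorphic in $D^b(A)$. *Theorem A.* For every $d\in K_0(D^b(A))$ and all such choices there is a map $\phi'_A\colon\mathcal C^b(A,d)\to\mathcal P^b(A,d)$ such that: 1. for every $\mathbf d\in\underline{\dim}^{-1}(d)$ the restriction of $\phi'_A$ to $\mathcal C^b(A,\mathbf d)$ is a constructible map: there are an $\mathbf e$ with $\mathbf d(\mathbf e)\in\underline{\dim}^{-1}(d)$ and a map $f\colon \mathcal C^b(A,\mathbf d)\to\mathcal P^b(A,\mathbf e)$ which induces this restriction, and a finite partition of $\mathcal C^b(A,\mathbf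 d)$ into constructible subsets on each of which $f$ is a morphism of varieties; 2. the inclusions $\mathcal P^b(A,\mathbf e)\subseteq\mathcal C^b(A,\mathbf d(\mathbf e))$ induce a well-defined map $\mathcal{QP}^b(A,d)\to\mathcal Q^b(A,d)$, the map $\phi'_A$ induces a well-defined map $\mathcal Q^b(A,d)\to\mathcal{QP}^b(A,d)$, and these two maps are inverse to each other. -/

import Mathlib

open CategoryTheory Limits Pretriangulated

noncomputable section

namespace QuiverComplexes

/-! ### Bound quivers and their algebras -/

section Algebra

variable (V : Type) [Fintype V] [Quiver.{0} V]

/-- The generators of the path algebra: one for each vertex and one for each arrow. -/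
abbrev Gen : Type := V ⊕ (Σ s t : V, (s ⟶ t))

/-- The defining relations of the path algebra `ℂQ`: the vertices are orthogonal idempotents
with sum `1`, and an arrow `a : s ⟶ t` satisfies `e_t a = a = a e_s`.  Products are read as
compositions of maps, so modules are left modules and representations are covariant. -/
inductive PathRel : FreeAlgebra ℂ (Gen V) → FreeAlgebra ℂ (Gen V) → Prop
  | idem (v : V) :
      PathRel (FreeAlgebra.ι ℂ (Sum.inl v) * FreeAlgebra.ι ℂ (Sum.inl v))
        (FreeAlgebra.ι ℂ (Sum.inl v))
  | orth (v w : V) (h : v ≠ w) :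
      PathRel (FreeAlgebra.ι ℂ (Sum.inl v) * FreeAlgebra.ι ℂ (Sum.inl w)) 0
  | one : PathRel (∑ v : V, FreeAlgebra.ι ℂ (Sum.inl v)) 1
  | target {s t : V} (a : s ⟶ t) :
      PathRel (FreeAlgebra.ι ℂ (Sum.inl t) * FreeAlgebra.ι ℂ (Sum.inr ⟨s, t, a⟩))
        (FreeAlgebra.ι ℂ (Sum.inr ⟨s, t, a⟩))
  | source {s t : V} (a : s ⟶ t) :
      PathRel (FreeAlgebra.ι ℂ (Sum.inr ⟨s, t, a⟩) * FreeAlgebra.ι ℂ (Sum.inl s))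
        (FreeAlgebra.ι ℂ (Sum.inr ⟨s, t, a⟩))

/-- The path algebra `ℂQ`. -/
abbrev PathAlgebra : Type := RingQuot (PathRel V)

variable {V}

/-- The element of `ℂQ` given by a path. -/
def pathElem {s : V} : {t : V} → Quiver.Path s t → PathAlgebra V
  | _, .nil => RingQuot.mkAlgHom ℂ (PathRel V) (FreeAlgebra.ι ℂ (Sum.inl s))
  | _, .cons p a =>
      RingQuot.mkAlgHom ℂ (PathRel V) (FreeAlgebra.ι ℂ (Sum.inr ⟨_, _, a⟩)) * pathElem p

/-- The element of `ℂQ` given by a linear combination of parallel paths. -/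
def combElem {s t : V} (r : Quiver.Path s t →₀ ℂ) : PathAlgebra V :=
  r.sum fun p c => c • pathElem p

/-- `x ~ 0` for each `x` in a given set of linear combinations of parallel paths. -/
def IdealRel (rel : ∀ s t : V, Set (Quiver.Path s t →₀ ℂ)) (x y : PathAlgebra V) : Prop :=
  ∃ (s t : V) (r : Quiver.Path s t →₀ ℂ), r ∈ rel s t ∧ x = combElem r ∧ y = 0

variable (V) in
/-- A set of relations in the quiver (linear combinations of parallel paths of length at least
two) that generates an admissible ideal `J` of `ℂQ`, i.e. `J` contains all sufficiently long
paths. -/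
structure AdmissibleRelations where
  rel : ∀ s t : V, Set (Quiver.Path s t →₀ ℂ)
  two_le_length : ∀ (s t : V), ∀ r ∈ rel s t, ∀ p ∈ r.support, 2 ≤ p.length
  long_paths : ∃ N : ℕ, ∀ (s t : V) (p : Quiver.Path s t), p.length = N →
    RingQuot.mkAlgHom ℂ (IdealRel rel) (pathElem p) = 0

/-- The algebra `A = ℂQ/J`, where `J` is the two-sided ideal generated by the relations. -/
abbrev Alg (R : AdmissibleRelations V) : Type := RingQuot (IdealRel R.rel)

/-- The quotient map from the free algebra on vertices and arrows onto `A`. -/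
def toAlg (R : AdmissibleRelations V) : FreeAlgebra ℂ (Gen V) →ₐ[ℂ] Alg R :=
  (RingQuot.mkAlgHom ℂ (IdealRel R.rel)).comp (RingQuot.mkAlgHom ℂ (PathRel V))

/-- The primitive idempotent `e_v` of `A`. -/
def idem (R : AdmissibleRelations V) (v : V) : Alg R :=
  toAlg R (FreeAlgebra.ι ℂ (Sum.inl v))

/-- The global dimension of `A` is finite. -/
def HasFiniteGlobalDimension (R : AdmissibleRelations V) : Prop :=
  ∃ n : ℕ, ∀ M : ModuleCat.{0} (Alg R), HasProjectiveDimensionLT M n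

/-- The indecomposable projective `A`-module `P_v = A e_v`. -/
abbrev indecProj (R : AdmissibleRelations V) (v : V) : Type :=
  (Ideal.span {idem R v} : Ideal (Alg R))

/-- The dimension vector of `P_v`: its entry at `w` is `dim e_w A e_v`. -/
def dimIndecProj (R : AdmissibleRelations V) (v w : V) : ℕ :=
  Module.finrank ℂ (LinearMap.range (LinearMap.mulLeftRight ℂ (idem R w, idem R v)))

lemma toAlg_surjective (R : AdmissibleRelations V) : Function.Surjective (toAlg R) :=
  (RingQuot.mkAlgHom_surjective ℂ _).comp (RingQuot.mkAlgHom_surjective ℂ _)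

end Algebra

/-! ### Module varieties -/

section Blocks

variable {V : Type} [DecidableEq V]

/-- The underlying graded space `ℂ^d = ⊕_v ℂ^{d v}`. -/
abbrev GradedSpace (d : V → ℕ) : Type := ∀ v : V, Fin (d v) → ℂ

/-- The endomorphism of `ℂ^d` given by a matrix from the summand at `s` to the one at `t`. -/
def block {d : V → ℕ} (s t : V) (M : Matrix (Fin (d t)) (Fin (d s)) ℂ) :
    Module.End ℂ (GradedSpace d) :=
  LinearMap.single ℂ (fun v => Fin (d v) → ℂ) t ∘ₗ M.mulVecLin ∘ₗ LinearMap.proj s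

lemma block_mul {d : V → ℕ} (s t u : V) (N : Matrix (Fin (d u)) (Fin (d t)) ℂ)
    (M : Matrix (Fin (d t)) (Fin (d s)) ℂ) : block t u N * block s t M = block s u (N * M) := by
  refine LinearMap.ext fun f => ?_
  simp [block]

lemma block_mul_ne {d : V → ℕ} (v w : V) (h : v ≠ w) :
    (block v v 1 * block w w 1 : Module.End ℂ (GradedSpace d)) = 0 := by
  refine LinearMap.ext fun f => ?_
  simp [block, Pi.single_eq_of_ne h]

lemma block_apply {d : V → ℕ} (s t : V) (M : Matrix (Fin (d t)) (Fin (d s)) ℂ)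
    (f : GradedSpace d) : block s t M f = Pi.single t (M.mulVec (f s)) := rfl

lemma sum_block [Fintype V] {d : V → ℕ} :
    (∑ v : V, block v v 1 : Module.End ℂ (GradedSpace d)) = 1 := by
  refine LinearMap.ext fun f => ?_
  simp [LinearMap.sum_apply, block_apply, Finset.univ_sum_single]

lemma block_zero {d : V → ℕ} (s t : V) : block (d := d) s t 0 = 0 := by
  simp [block]

end Blocks

section Arrows

variable {V : Type} [Quiver.{0} V]

/-- The affine space `𝔼_d(Q)`. -/
abbrev ArrowMaps (d : V → ℕ) : Type :=
  ∀ ⦃s t : V⦄, (s ⟶ t) → Matrix (Fin (d t)) (Fin (d s)) ℂ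

/-- The matrix `x_p` of a path `p`. -/
def pathMat {d : V → ℕ} (x : ArrowMaps d) {s : V} :
    {t : V} → Quiver.Path s t → Matrix (Fin (d t)) (Fin (d s)) ℂ
  | _, .nil => 1
  | _, .cons p a => x a * pathMat x p

lemma pathMat_zero {m : V → ℕ} {s t : V} (p : Quiver.Path s t) (hp : 1 ≤ p.length) :
    pathMat (fun _ _ _ => 0 : ArrowMaps (V := V) m) p = 0 := by
  cases p with
  | nil => simp at hp
  | cons p a => simp [pathMat]

variable [DecidableEq V]

/-- The action of the generators. -/
def genAct {d : V → ℕ} (x : ArrowMaps d) : Gen V → Module.End ℂ (GradedSpace d)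
  | .inl v => block v v 1
  | .inr ⟨s, t, a⟩ => block s t (x a)

/-- The graded linear map `ℂ^d ⟶ ℂ^d'` given by matrices. -/
def gradedMap {d d' : V → ℕ} (N : ∀ v, Matrix (Fin (d' v)) (Fin (d v)) ℂ) :
    GradedSpace d →ₗ[ℂ] GradedSpace d' :=
  LinearMap.pi fun v => (N v).mulVecLin ∘ₗ LinearMap.proj v

lemma gradedMap_genAct {d d' : V → ℕ} (x : ArrowMaps d) (y : ArrowMaps d')
    (N : ∀ v, Matrix (Fin (d' v)) (Fin (d v)) ℂ)
    (h : ∀ {s t : V} (a : s ⟶ t), N t * x a = y a * N s) (g : Gen V) (m : GradedSpace d) :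
    gradedMap N (genAct x g m) = genAct y g (gradedMap N m) := by
  rcases g with (v | ⟨s, t, a⟩) <;> refine funext fun w => ?_
  · by_cases hw : w = v
    · subst hw; simp [genAct, block_apply, gradedMap]
    · simp [genAct, block_apply, gradedMap, Pi.single_eq_of_ne hw]
  · by_cases hw : w = t
    · subst hw; simp [genAct, block_apply, gradedMap, h]
    · simp [genAct, block_apply, gradedMap, Pi.single_eq_of_ne hw]

end Arrows

section Representations

variable {V : Type} [Fintype V] [DecidableEq V] [Quiver.{0} V]

/-- `x` satisfies all the relations. -/
def Satisfies (R : AdmissibleRelations V) {d : V → ℕ} (x : ArrowMaps d) : Prop :=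
  ∀ (s t : V), ∀ r ∈ R.rel s t, (r.sum fun p c => c • pathMat x p) = 0

/-- The module variety `𝔼_d(Q,R)`. -/
abbrev Rep (R : AdmissibleRelations V) (d : V → ℕ) : Type :=
  {x : ArrowMaps (V := V) d // Satisfies R x}

/-- The action of the path algebra on `ℂ^d`. -/
def pathAct {d : V → ℕ} (x : ArrowMaps d) : PathAlgebra V →ₐ[ℂ] Module.End ℂ (GradedSpace d) :=
  RingQuot.liftAlgHom ℂ ⟨FreeAlgebra.lift ℂ (genAct x), by
    intro y z h
    induction h with
    | idem v => simp [genAct, block_mul]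
    | orth v w h => simp [genAct, block_mul_ne v w h]
    | one => simp [genAct, sum_block]
    | target a => simp [genAct, block_mul]
    | source a => simp [genAct, block_mul]⟩

lemma pathAct_pathElem {d : V → ℕ} (x : ArrowMaps d) {s t : V} (p : Quiver.Path s t) :
    pathAct x (pathElem p) = block s t (pathMat x p) := by
  induction p with
  | nil => simp [pathElem, pathAct, pathMat, genAct]
  | cons p a ih =>
    rw [pathElem, map_mul, ih, pathMat, ← block_mul]
    simp [pathAct, genAct]

lemma pathAct_combElem {d : V → ℕ} (x : ArrowMaps d) {s t : V} (r : Quiver.Path s t →₀ ℂ) :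
    pathAct x (combElem r) = block s t (r.sum fun p c => c • pathMat x p) := by
  have hb : ∀ (c : ℂ) (M : Matrix (Fin (d t)) (Fin (d s)) ℂ),
      c • block s t M = block s t (c • M) := by
    intro c M; refine LinearMap.ext fun f => ?_
    simp [block_apply, Matrix.smul_mulVec, Pi.single_smul]
  have ha : ∀ (M N : Matrix (Fin (d t)) (Fin (d s)) ℂ),
      block s t (M + N) = block s t M + block s t N := by
    intro M N; refine LinearMap.ext fun f => ?_
    simp [block_apply, Matrix.add_mulVec, Pi.single_add]
  have hs := map_sum (AddMonoidHom.mk' (fun M => block (d := d) s t M) ha)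
    (fun p => r p • pathMat x p) r.support
  simp only [AddMonoidHom.mk'_apply] at hs
  simp only [combElem, Finsupp.sum, map_sum, map_smul, pathAct_pathElem, hb]
  exact hs.symm

/-- The action of `A` on `ℂ^d` given by a point of the module variety. -/
def act {R : AdmissibleRelations V} {d : V → ℕ} (x : Rep R d) :
    Alg R →ₐ[ℂ] Module.End ℂ (GradedSpace d) :=
  RingQuot.liftAlgHom ℂ ⟨pathAct x.1, by
    rintro y z ⟨s, t, r, hr, rfl, rfl⟩
    rw [pathAct_combElem, x.2 s t r hr, block_zero, map_zero]⟩

lemma act_toAlg {R : AdmissibleRelations V} {d : V → ℕ} (x : Rep R d)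
    (y : FreeAlgebra ℂ (Gen V)) : act x (toAlg R y) = FreeAlgebra.lift ℂ (genAct x.1) y := by
  simp [act, toAlg, pathAct]

/-- The underlying space of the `A`-module `M(x) = (ℂ^d, x)`. -/
def Rep.Mod {R : AdmissibleRelations V} {d : V → ℕ} (_ : Rep R d) : Type := GradedSpace d

instance {R : AdmissibleRelations V} {d : V → ℕ} (x : Rep R d) : AddCommGroup x.Mod :=
  inferInstanceAs (AddCommGroup (GradedSpace d))

instance {R : AdmissibleRelations V} {d : V → ℕ} (x : Rep R d) : Module ℂ x.Mod :=
  inferInstanceAs (Module ℂ (GradedSpace d))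

instance {R : AdmissibleRelations V} {d : V → ℕ} (x : Rep R d) : Module.Finite ℂ x.Mod :=
  inferInstanceAs (Module.Finite ℂ (GradedSpace d))

instance {R : AdmissibleRelations V} {d : V → ℕ} (x : Rep R d) : Module (Alg R) x.Mod :=
  Module.compHom (GradedSpace d) (act x).toRingHom

lemma smul_def {R : AdmissibleRelations V} {d : V → ℕ} (x : Rep R d) (a : Alg R) (m : x.Mod) :
    a • m = (act x a : GradedSpace d →ₗ[ℂ] GradedSpace d) m := rfl

instance {R : AdmissibleRelations V} {d : V → ℕ} (x : Rep R d) :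
    IsScalarTower ℂ (Alg R) x.Mod :=
  ⟨fun c a m => by rw [smul_def, smul_def, map_smul]; rfl⟩

instance {R : AdmissibleRelations V} {d : V → ℕ} (x : Rep R d) : Module.Finite (Alg R) x.Mod :=
  Module.Finite.of_restrictScalars_finite ℂ (Alg R) x.Mod

lemma gradedMap_act {R : AdmissibleRelations V} {d d' : V → ℕ} (x : Rep R d) (y : Rep R d')
    (N : ∀ v, Matrix (Fin (d' v)) (Fin (d v)) ℂ)
    (h : ∀ {s t : V} (a : s ⟶ t), N t * x.1 a = y.1 a * N s) (a : Alg R) (m : GradedSpace d) :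
    gradedMap N (act x a m) = act y a (gradedMap N m) := by
  obtain ⟨b, rfl⟩ := toAlg_surjective R a
  rw [act_toAlg, act_toAlg]
  induction b using FreeAlgebra.induction generalizing m with
  | grade0 c =>
    rw [AlgHom.commutes, AlgHom.commutes]
    exact (gradedMap N).map_smul c m
  | grade1 g =>
    rw [FreeAlgebra.lift_ι_apply, FreeAlgebra.lift_ι_apply]
    exact gradedMap_genAct x.1 y.1 N h g m
  | mul a b ha hb =>
    rw [map_mul, map_mul, Module.End.mul_apply, Module.End.mul_apply, ← hb, ← ha]
  | add a b ha hb =>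
    rw [map_add, map_add, LinearMap.add_apply, LinearMap.add_apply, ← hb, ← ha, map_add]

/-- The homomorphism of `A`-modules `M(x) ⟶ M(y)` given by matrices which are compatible with all
the arrows. -/
def Rep.hom {R : AdmissibleRelations V} {d d' : V → ℕ} (x : Rep R d) (y : Rep R d')
    (N : ∀ v, Matrix (Fin (d' v)) (Fin (d v)) ℂ)
    (h : ∀ {s t : V} (a : s ⟶ t), N t * x.1 a = y.1 a * N s) : x.Mod →ₗ[Alg R] y.Mod where
  toFun := gradedMap N
  map_add' := (gradedMap N).map_add
  map_smul' := gradedMap_act x y N h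

end Representations

/-! ### Varieties of complexes -/

section Complexes

variable {V : Type} [Fintype V] [DecidableEq V] [Quiver.{0} V]

/-- Dimension vector sequences, and also projective dimension sequences: sequences of vectors in
`ℕ^V` indexed by `ℤ`, with finitely many nonzero entries. -/
abbrev DimSeq (V : Type) : Type := ℤ →₀ (V → ℕ)

/-- The variety `C^b(A, d)`: families of points `x i` of the module varieties and of graded linear
maps `δ i` which are module homomorphisms `M(x i) ⟶ M(x (i + 1))` and satisfy `δ² = 0`. -/
@[ext]
structure CPoint (R : AdmissibleRelations V) (d : DimSeq V) where
  x : ∀ i : ℤ, Rep R (d i)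
  δ : ∀ (i : ℤ) (v : V), Matrix (Fin (d (i + 1) v)) (Fin (d i v)) ℂ
  comm : ∀ (i : ℤ) {s t : V} (a : s ⟶ t), δ i t * (x i).1 a = (x (i + 1)).1 a * δ i s
  sq : ∀ (i : ℤ) (v : V), δ (i + 1) v * δ i v = 0

variable {R : AdmissibleRelations V} {d : DimSeq V}

/-- The homomorphism of `A`-modules `M(x i) ⟶ M(x (i + 1))`. -/
def CPoint.diff (X : CPoint R d) (i : ℤ) : (X.x i).Mod →ₗ[Alg R] (X.x (i + 1)).Mod :=
  (X.x i).hom (X.x (i + 1)) (X.δ i) (X.comm i)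

/-- The complex of `A`-modules corresponding to a point of `C^b(A, d)`. -/
def CPoint.cplx (X : CPoint R d) : CochainComplex (ModuleCat.{0} (Alg R)) ℤ :=
  CochainComplex.of (fun i => ModuleCat.of (Alg R) (X.x i).Mod)
    (fun i => ModuleCat.ofHom (X.diff i))
    (fun i => by
      ext m
      refine funext fun v => ?_
      change (X.δ (i + 1) v).mulVec ((X.δ i v).mulVec (m v)) = 0
      rw [Matrix.mulVec_mulVec, X.sq, Matrix.zero_mulVec])

/-- The dimension vector sequence of projective modules with multiplicities `e`: in degree `i`,
the dimension vector of `⊕_v P_v^{e i v}`. -/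
def projDim (R : AdmissibleRelations V) (e : DimSeq V) : DimSeq V :=
  e.mapRange (fun m w => ∑ v, m v * dimIndecProj R v w) (by ext; simp)

/-- `P^b(A, e)`: the points of `C^b(A, d(e))` whose term in each degree `i` is isomorphic to
`⊕_v P_v^{e i v}`. -/
def PPoint (R : AdmissibleRelations V) (e : DimSeq V) : Type :=
  {X : CPoint R (projDim R e) // ∀ i : ℤ,
    Nonempty ((X.x i).Mod ≃ₗ[Alg R] (∀ v : V, Fin (e i v) → indecProj R v))}

/-- The inclusion `P^b(A, e) ⊆ C^b(A, d(e))`. -/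
def PPoint.toCPoint {e : DimSeq V} (X : PPoint R e) : CPoint R (projDim R e) := X.1

end Complexes

/-! ### Constructible maps -/

section Constructible

variable {V : Type} [Fintype V] [DecidableEq V] [Quiver.{0} V] {R : AdmissibleRelations V}

/-- The matrix entries which are the coordinates of the affine space containing `C^b(A, d)`. -/
abbrev Coord (d : DimSeq V) : Type :=
  (Σ (i : ℤ) (s t : V) (_ : s ⟶ t), Fin (d i t) × Fin (d i s)) ⊕
    (Σ (i : ℤ) (v : V), Fin (d (i + 1) v) × Fin (d i v))

/-- The coordinates of a point of `C^b(A, d)`. -/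
def CPoint.coord {d : DimSeq V} (X : CPoint R d) : Coord d → ℂ
  | .inl ⟨i, _, _, a, k⟩ => (X.x i).1 a k.1 k.2
  | .inr ⟨i, v, k⟩ => X.δ i v k.1 k.2

/-- The Zariski topology on `C^b(A, d)`. -/
instance {d : DimSeq V} : TopologicalSpace (CPoint R d) :=
  TopologicalSpace.generateFrom
    {U | ∃ h : MvPolynomial (Coord d) ℂ, U = {X | MvPolynomial.eval X.coord h ≠ 0}}

/-- A finite union of locally closed subsets. -/
def IsConstructibleSet {T : Type} [TopologicalSpace T] (S : Set T) : Prop :=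
  ∃ F : Set (Set T), F.Finite ∧ (∀ Z ∈ F, IsLocallyClosed Z) ∧ S = ⋃₀ F

/-- The restriction of `f` to `O` is a morphism of varieties: locally in the Zariski topology of
`O`, every coordinate of `f` is a quotient of polynomials. -/
def IsMorphismOn {d d' : DimSeq V} (O : Set (CPoint R d)) (f : CPoint R d → CPoint R d') : Prop :=
  ∀ X ∈ O, ∀ c : Coord d', ∃ g h : MvPolynomial (Coord d) ℂ, MvPolynomial.eval X.coord h ≠ 0 ∧
    ∀ Y ∈ O, MvPolynomial.eval Y.coord h ≠ 0 →
      (f Y).coord c = MvPolynomial.eval Y.coord g / MvPolynomial.eval Y.coord h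

/-- `f` is a constructible map: there is a finite partition of the source into constructible
subsets such that the restriction of `f` to each of them is a morphism of varieties. -/
def IsConstructibleMap {d d' : DimSeq V} (f : CPoint R d → CPoint R d') : Prop :=
  ∃ (n : ℕ) (O : Fin n → Set (CPoint R d)), (∀ k, IsConstructibleSet (O k)) ∧
    Pairwise (fun k l => Disjoint (O k) (O l)) ∧ (⋃ k, O k) = Set.univ ∧
    ∀ k, IsMorphismOn (O k) f

end Constructible

/-! ### The bounded derived category and its Grothendieck group -/

section Derived

variable {V : Type} [Fintype V] [DecidableEq V] [Quiver.{0} V]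

instance (R : AdmissibleRelations V) : HasDerivedCategory (ModuleCat.{0} (Alg R)) :=
  HasDerivedCategory.standard _

/-- The derived category of `A`-modules. -/
abbrev D (R : AdmissibleRelations V) : Type 1 := DerivedCategory (ModuleCat.{0} (Alg R))

/-- `D^b(A)`, as the full subcategory of the derived category of all `A`-modules whose objects are
those isomorphic to bounded complexes of finitely generated (equivalently, finite dimensional)
modules. -/
def IsBounded (R : AdmissibleRelations V) (X : D R) : Prop :=
  ∃ K : CochainComplex (ModuleCat.{0} (Alg R)) ℤ,
    (∀ i, Module.Finite (Alg R) (K.X i)) ∧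
    (∃ a b : ℤ, ∀ i, i < a ∨ b < i → Subsingleton (K.X i)) ∧
    Nonempty (X ≅ DerivedCategory.Q.obj K)

/-- The relations `[Y] = [X] + [Z]` given by the distinguished triangles `X ⟶ Y ⟶ Z ⟶ X[1]` of
`D^b(A)`. -/
def triangleRelations (R : AdmissibleRelations V) :
    AddSubgroup (FreeAbelianGroup {X : D R // IsBounded R X}) :=
  AddSubgroup.closure {g | ∃ (T : Triangle (D R)) (_ : T ∈ distTriang (D R))
    (h₁ : IsBounded R T.obj₁) (h₂ : IsBounded R T.obj₂) (h₃ : IsBounded R T.obj₃),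
    g = FreeAbelianGroup.of ⟨T.obj₂, h₂⟩ - FreeAbelianGroup.of ⟨T.obj₁, h₁⟩ -
      FreeAbelianGroup.of ⟨T.obj₃, h₃⟩}

/-- The Grothendieck group `K₀(D^b(A))`. -/
abbrev K₀ (R : AdmissibleRelations V) : Type 1 :=
  FreeAbelianGroup {X : D R // IsBounded R X} ⧸ triangleRelations R

variable {R : AdmissibleRelations V} {d : DimSeq V}

lemma CPoint.isBounded (X : CPoint R d) : IsBounded R (DerivedCategory.Q.obj X.cplx) := by
  refine ⟨X.cplx, fun i => inferInstanceAs (Module.Finite (Alg R) (X.x i).Mod), ?_,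
    ⟨Iso.refl _⟩⟩
  obtain ⟨b, hb⟩ := d.support.bddAbove
  obtain ⟨a, ha⟩ := d.support.bddBelow
  refine ⟨a, b, fun i hi => ?_⟩
  have h0 : d i = 0 := by
    by_contra h
    have hm : i ∈ (d.support : Set ℤ) := by simpa using h
    have h1 := hb hm
    have h2 := ha hm
    omega
  have : ∀ v, IsEmpty (Fin (d i v)) := fun v => by rw [h0]; exact Fin.isEmpty
  exact inferInstanceAs (Subsingleton (∀ v : V, Fin (d i v) → ℂ))

/-- The class in `K₀(D^b(A))` of the complex given by a point of `C^b(A, d)`. -/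
def CPoint.cls (X : CPoint R d) : K₀ R :=
  QuotientAddGroup.mk (FreeAbelianGroup.of ⟨DerivedCategory.Q.obj X.cplx, X.isBounded⟩)

/-- Two points are equivalent if the complexes are isomorphic in the derived category. -/
def DIso {d' : DimSeq V} (X : CPoint R d) (Y : CPoint R d') : Prop :=
  Nonempty (DerivedCategory.Q.obj X.cplx ≅ DerivedCategory.Q.obj Y.cplx)

/-- The point of `C^b(A, d)` with all matrices zero: the complex of semisimple modules with zero
differential. -/
def CPoint.zero (R : AdmissibleRelations V) (d : DimSeq V) : CPoint R d where
  x i := ⟨fun _ _ _ => 0, fun s t r hr => Finset.sum_eq_zero fun p hp => by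
    have := R.two_le_length s t r hr p hp
    simp only [pathMat_zero p (by omega), smul_zero]⟩
  δ i v := 0
  comm := by simp
  sq := by simp

/-- The map from dimension vector sequences to `K₀(D^b(A))` induced by `X ↦ [X]`.  The class of
a point of `C^b(A, d)` depends only on `d`; it is computed here on the zero point. -/
def dimCls (R : AdmissibleRelations V) (d : DimSeq V) : K₀ R := (CPoint.zero R d).cls

end Derived

/-! ### Direct sums -/

section DirectSum

/-- The block diagonal matrix `diag(A, B)`, with rows and columns reindexed. -/
def blockDiag {a b c a' b' c' : ℕ} (σ : Fin a ⊕ Fin b ≃ Fin c) (τ : Fin a' ⊕ Fin b' ≃ Fin c')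
    (A : Matrix (Fin a) (Fin a') ℂ) (B : Matrix (Fin b) (Fin b') ℂ) :
    Matrix (Fin c) (Fin c') ℂ :=
  Matrix.reindex σ τ (Matrix.fromBlocks A 0 0 B)

lemma blockDiag_mul {a b c a' b' c' a'' b'' c'' : ℕ} (σ : Fin a ⊕ Fin b ≃ Fin c)
    (τ : Fin a' ⊕ Fin b' ≃ Fin c') (υ : Fin a'' ⊕ Fin b'' ≃ Fin c'')
    (A : Matrix (Fin a) (Fin a') ℂ) (B : Matrix (Fin b) (Fin b') ℂ)
    (A' : Matrix (Fin a') (Fin a'') ℂ) (B' : Matrix (Fin b') (Fin b'') ℂ) :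
    blockDiag σ τ A B * blockDiag τ υ A' B' = blockDiag σ υ (A * A') (B * B') := by
  simp [blockDiag, Matrix.submatrix_mul_equiv, Matrix.fromBlocks_multiply]

lemma blockDiag_one {a b c : ℕ} (σ : Fin a ⊕ Fin b ≃ Fin c) : blockDiag σ σ 1 1 = 1 := by
  simp [blockDiag]

lemma blockDiag_zero {a b c a' b' c' : ℕ} (σ : Fin a ⊕ Fin b ≃ Fin c)
    (τ : Fin a' ⊕ Fin b' ≃ Fin c') : blockDiag σ τ 0 0 = 0 := by
  simp [blockDiag]

lemma blockDiag_sum {a b c a' b' c' : ℕ} (σ : Fin a ⊕ Fin b ≃ Fin c)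
    (τ : Fin a' ⊕ Fin b' ≃ Fin c') {ι : Type} (s : Finset ι)
    (k : ι → ℂ) (A : ι → Matrix (Fin a) (Fin a') ℂ) (B : ι → Matrix (Fin b) (Fin b') ℂ) :
    (∑ p ∈ s, k p • blockDiag σ τ (A p) (B p)) =
      blockDiag σ τ (∑ p ∈ s, k p • A p) (∑ p ∈ s, k p • B p) := by
  ext i j
  obtain ⟨i, rfl⟩ := σ.surjective i
  obtain ⟨j, rfl⟩ := τ.surjective j
  rcases i with i | i <;> rcases j with j | j <;> simp [blockDiag, Matrix.sum_apply]

lemma pathMat_blockDiag {V : Type} [Quiver.{0} V] {d d' d'' : V → ℕ}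
    (σ : ∀ v, Fin (d v) ⊕ Fin (d' v) ≃ Fin (d'' v)) (x : ArrowMaps d) (y : ArrowMaps d')
    {s t : V} (p : Quiver.Path s t) :
    pathMat (fun s t a => blockDiag (σ t) (σ s) (x a) (y a) : ArrowMaps d'') p =
      blockDiag (σ t) (σ s) (pathMat x p) (pathMat y p) := by
  induction p with
  | nil => simp only [pathMat, blockDiag_one]
  | cons p a ih => simp only [pathMat, ih, blockDiag_mul]

/-- The projection of `ℂ^c = ℂ^a ⊕ ℂ^b` onto the first summand. -/
def projFst {a b c : ℕ} (σ : Fin a ⊕ Fin b ≃ Fin c) : Matrix (Fin a) (Fin c) ℂ :=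
  Matrix.reindex (Equiv.refl _) σ (Matrix.fromCols 1 0)

/-- The projection of `ℂ^c = ℂ^a ⊕ ℂ^b` onto the second summand. -/
def projSnd {a b c : ℕ} (σ : Fin a ⊕ Fin b ≃ Fin c) : Matrix (Fin b) (Fin c) ℂ :=
  Matrix.reindex (Equiv.refl _) σ (Matrix.fromCols 0 1)

lemma projFst_mulVec {a b c : ℕ} (σ : Fin a ⊕ Fin b ≃ Fin c) (m : Fin c → ℂ) (i : Fin a) :
    (projFst σ).mulVec m i = m (σ (.inl i)) := by
  have h : m = (m ∘ σ) ∘ σ.symm := by ext; simp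
  conv_lhs => rw [h]
  rw [projFst, Matrix.reindex_apply, Matrix.submatrix_mulVec_equiv]
  simp [Matrix.fromCols_mulVec, Function.comp_assoc]

lemma projSnd_mulVec {a b c : ℕ} (σ : Fin a ⊕ Fin b ≃ Fin c) (m : Fin c → ℂ) (i : Fin b) :
    (projSnd σ).mulVec m i = m (σ (.inr i)) := by
  have h : m = (m ∘ σ) ∘ σ.symm := by ext; simp
  conv_lhs => rw [h]
  rw [projSnd, Matrix.reindex_apply, Matrix.submatrix_mulVec_equiv]
  simp [Matrix.fromCols_mulVec, Function.comp_assoc]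

lemma projFst_mul {a b c a' b' c' : ℕ} (σ : Fin a ⊕ Fin b ≃ Fin c)
    (τ : Fin a' ⊕ Fin b' ≃ Fin c') (A : Matrix (Fin a) (Fin a') ℂ)
    (B : Matrix (Fin b) (Fin b') ℂ) : projFst σ * blockDiag σ τ A B = A * projFst τ := by
  simp only [projFst, blockDiag, Matrix.reindex_apply]
  rw [Matrix.submatrix_mul_equiv, Matrix.fromCols_mul_fromBlocks]
  ext i j
  simp only [Matrix.mul_apply, Matrix.submatrix_apply]
  rcases τ.symm j with j | j <;> simp [Matrix.one_apply]

lemma projSnd_mul {a b c a' b' c' : ℕ} (σ : Fin a ⊕ Fin b ≃ Fin c)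
    (τ : Fin a' ⊕ Fin b' ≃ Fin c') (A : Matrix (Fin a) (Fin a') ℂ)
    (B : Matrix (Fin b) (Fin b') ℂ) : projSnd σ * blockDiag σ τ A B = B * projSnd τ := by
  simp only [projSnd, blockDiag, Matrix.reindex_apply]
  rw [Matrix.submatrix_mul_equiv, Matrix.fromCols_mul_fromBlocks]
  ext i j
  simp only [Matrix.mul_apply, Matrix.submatrix_apply]
  rcases τ.symm j with j | j <;> simp [Matrix.one_apply]

variable {V : Type} [Fintype V] [DecidableEq V] [Quiver.{0} V] {R : AdmissibleRelations V}

/-- The block diagonal sum of two points of module varieties. -/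
def Rep.directSum {d d' d'' : V → ℕ} (σ : ∀ v, Fin (d v) ⊕ Fin (d' v) ≃ Fin (d'' v))
    (x : Rep R d) (y : Rep R d') : Rep R d'' :=
  ⟨fun s t a => blockDiag (σ t) (σ s) (x.1 a) (y.1 a), fun s t r hr => by
    have hx := x.2 s t r hr
    have hy := y.2 s t r hr
    simp only [Finsupp.sum] at hx hy ⊢
    simp only [pathMat_blockDiag]
    rw [blockDiag_sum, hx, hy, blockDiag_zero]⟩

/-- An identification `ℂ^d ⊕ ℂ^d' = ℂ^d''` of the standard bases, in all degrees and at all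
vertices. -/
abbrev Splitting (d d' d'' : DimSeq V) : Type :=
  ∀ (i : ℤ) (v : V), Fin (d i v) ⊕ Fin (d' i v) ≃ Fin (d'' i v)

/-- The direct sum of two complexes, with underlying space identified with `ℂ^d''`. -/
def CPoint.directSum {d d' d'' : DimSeq V} (σ : Splitting d d' d'') (X : CPoint R d)
    (Y : CPoint R d') : CPoint R d'' where
  x i := (X.x i).directSum (σ i) (Y.x i)
  δ i v := blockDiag (σ (i + 1) v) (σ i v) (X.δ i v) (Y.δ i v)
  comm i s t a := by simp only [Rep.directSum, blockDiag_mul, X.comm, Y.comm]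
  sq i v := by rw [blockDiag_mul, X.sq, Y.sq, blockDiag_zero]

/-- `M(x ⊕ y) ≅ M(x) × M(y)`. -/
def Rep.directSumEquiv {d d' d'' : V → ℕ} (σ : ∀ v, Fin (d v) ⊕ Fin (d' v) ≃ Fin (d'' v))
    (x : Rep R d) (y : Rep R d') : (x.directSum σ y).Mod ≃ₗ[Alg R] x.Mod × y.Mod :=
  LinearEquiv.ofBijective
    (((x.directSum σ y).hom x (fun v => projFst (σ v)) fun _ => projFst_mul _ _ _ _).prod
      ((x.directSum σ y).hom y (fun v => projSnd (σ v)) fun _ => projSnd_mul _ _ _ _)) <| by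
    have h₁ : ∀ (m : GradedSpace d'') (v : V) (i : Fin (d v)),
        gradedMap (fun v => projFst (σ v)) m v i = m v (σ v (.inl i)) :=
      fun m v i => projFst_mulVec _ _ _
    have h₂ : ∀ (m : GradedSpace d'') (v : V) (i : Fin (d' v)),
        gradedMap (fun v => projSnd (σ v)) m v i = m v (σ v (.inr i)) :=
      fun m v i => projSnd_mulVec _ _ _
    constructor
    · intro m m' h
      have e₁ : gradedMap (fun v => projFst (σ v)) m = gradedMap (fun v => projFst (σ v)) m' :=
        congrArg Prod.fst h
      have e₂ : gradedMap (fun v => projSnd (σ v)) m = gradedMap (fun v => projSnd (σ v)) m' :=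
        congrArg Prod.snd h
      refine funext fun v => funext fun k => ?_
      obtain ⟨k, rfl⟩ := (σ v).surjective k
      rcases k with k | k
      · exact (h₁ m v k).symm.trans ((congrFun (congrFun e₁ v) k).trans (h₁ m' v k))
      · exact (h₂ m v k).symm.trans ((congrFun (congrFun e₂ v) k).trans (h₂ m' v k))
    · rintro ⟨m, m'⟩
      let n : GradedSpace d'' := fun v k => Sum.elim (m v) (m' v) ((σ v).symm k)
      refine ⟨n, Prod.ext ?_ ?_⟩
      · refine funext fun v => funext fun k => (h₁ n v k).trans ?_
        simp [n]
      · refine funext fun v => funext fun k => (h₂ n v k).trans ?_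
        simp [n]

/-- `⊕_v P_v^{e v} ≅ (⊕_v P_v^{e₁ v}) × (⊕_v P_v^{e₂ v})` if `e = e₁ + e₂`. -/
def powEquiv (S : Type) [Semiring S] (P : V → Type) [∀ v, AddCommMonoid (P v)] [∀ v, Module S (P v)]
    {e₁ e₂ e : V → ℕ} (σ : ∀ v, Fin (e₁ v) ⊕ Fin (e₂ v) ≃ Fin (e v)) :
    (∀ v, Fin (e v) → P v) ≃ₗ[S] (∀ v, Fin (e₁ v) → P v) × (∀ v, Fin (e₂ v) → P v) where
  toFun g := (fun v k => g v (σ v (.inl k)), fun v k => g v (σ v (.inr k)))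
  map_add' _ _ := rfl
  map_smul' _ _ := rfl
  invFun g v k := Sum.elim (g.1 v) (g.2 v) ((σ v).symm k)
  left_inv g := by
    refine funext fun v => funext fun k => ?_
    obtain ⟨k, rfl⟩ := (σ v).surjective k
    rcases k with k | k <;> simp
  right_inv g := by ext <;> simp

/-- The direct sum of two projective complexes. -/
def PPoint.directSum {e e' e'' : DimSeq V} (he : e + e' = e'')
    (σ : Splitting (projDim R e) (projDim R e') (projDim R e'')) (X : PPoint R e)
    (Y : PPoint R e') : PPoint R e'' :=
  ⟨X.1.directSum σ Y.1, fun i => by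
    obtain ⟨f⟩ := X.2 i
    obtain ⟨g⟩ := Y.2 i
    have τ : ∀ v, Fin (e i v) ⊕ Fin (e' i v) ≃ Fin (e'' i v) := fun v =>
      finSumFinEquiv.trans (finCongr (by rw [← he]; rfl))
    exact ⟨((X.1.x i).directSumEquiv (σ i) (Y.1.x i)).trans ((f.prodCongr g).trans
      (powEquiv (Alg R) (fun v => indecProj R v) τ).symm)⟩⟩

end DirectSum

/-! ### The direct limits and the quotient spaces -/

section Limits

variable {V : Type} [Fintype V] [DecidableEq V] [Quiver.{0} V] {R : AdmissibleRelations V}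

instance : HasFiniteBiproducts (CochainComplex (ModuleCat.{0} (Alg R)) ℤ) :=
  Abelian.hasFiniteBiproducts

/-- The complex is a direct sum of shifted copies of complexes `⋯ ⟶ 0 ⟶ S ⟶ S ⟶ 0 ⟶ ⋯` with `S`
simple and the identity as differential. -/
def IsSumOfSimpleDisks (K : CochainComplex (ModuleCat.{0} (Alg R)) ℤ) : Prop :=
  ∃ (n : ℕ) (deg : Fin n → ℤ) (S : Fin n → ModuleCat.{0} (Alg R)),
    (∀ k, IsSimpleModule (Alg R) (S k)) ∧
    Nonempty (K ≅ ⨁ fun k => HomologicalComplex.double (𝟙 (S k))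
      (show (ComplexShape.up ℤ).Rel (deg k) (deg k + 1) from rfl))

/-- `dim⁻¹(κ)`, as a set of dimension vector sequences. -/
abbrev DimFiber (κ : K₀ R) : Type := {d : DimSeq V // dimCls R d = κ}

/-- The projective dimension sequences `e` with `d(e) ∈ dim⁻¹(κ)`. -/
abbrev ProjFiber (κ : K₀ R) : Type := {e : DimSeq V // dimCls R (projDim R e) = κ}

/-- The partial order on `dim⁻¹(κ)`: there is a point of `C^b(A, d₂ - d₁)` which is a direct sum of
shifted copies of complexes `S = S` with `S` simple. -/
def DimFiber.LE {κ : K₀ R} (d₁ d₂ : DimFiber κ) : Prop :=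
  d₁.1 ≤ d₂.1 ∧ ∃ M : CPoint R (d₂.1 - d₁.1), IsSumOfSimpleDisks M.cplx

/-- The order on projective dimension sequences: there is a contractible (that is, acyclic)
projective complex in `P^b(A, e₂ - e₁)`. -/
def ProjFiber.LE {κ : K₀ R} (e₁ e₂ : ProjFiber κ) : Prop :=
  e₁.1 ≤ e₂.1 ∧ ∃ P : PPoint R (e₂.1 - e₁.1), P.toCPoint.cplx.Acyclic

/-- The choices which make the varieties `C^b(A, d)`, `d ∈ dim⁻¹(κ)`, into a direct system: for
`d₁ ≤ d₂` a complex `M(d₁, d₂)` as in the definition of the order and an identification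
`ℂ^{d₁} ⊕ ℂ^{d₂ - d₁} = ℂ^{d₂}`, such that the maps `T_{d₁ d₂} : X ↦ X ⊕ M(d₁, d₂)` satisfy
`T_{d d} = id` and `T_{d₂ d₃} T_{d₁ d₂} = T_{d₁ d₃}`. -/
structure ComplexSystem (κ : K₀ R) where
  summand : ∀ {d₁ d₂ : DimFiber κ}, d₁.LE d₂ → CPoint R (d₂.1 - d₁.1)
  split : ∀ {d₁ d₂ : DimFiber κ}, d₁.LE d₂ → Splitting d₁.1 (d₂.1 - d₁.1) d₂.1
  summand_disks : ∀ {d₁ d₂ : DimFiber κ} (h : d₁.LE d₂), IsSumOfSimpleDisks (summand h).cplx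
  map_self : ∀ {d : DimFiber κ} (h : d.LE d) (X : CPoint R d.1),
    X.directSum (split h) (summand h) = X
  map_map : ∀ {d₁ d₂ d₃ : DimFiber κ} (h₁₂ : d₁.LE d₂) (h₂₃ : d₂.LE d₃) (h₁₃ : d₁.LE d₃)
    (X : CPoint R d₁.1),
    (X.directSum (split h₁₂) (summand h₁₂)).directSum (split h₂₃) (summand h₂₃) =
      X.directSum (split h₁₃) (summand h₁₃)

/-- The choices which make the varieties `P^b(A, e)`, `d(e) ∈ dim⁻¹(κ)`, into a direct system: for
`e₁ ≤ e₂` a contractible complex `P(e₁, e₂)` in `P^b(A, e₂ - e₁)` and an identification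
`ℂ^{d(e₁)} ⊕ ℂ^{d(e₂ - e₁)} = ℂ^{d(e₂)}`, such that the maps `t_{e₁ e₂} : X ↦ X ⊕ P(e₁, e₂)` satisfy
`t_{e e} = id` and `t_{e₂ e₃} t_{e₁ e₂} = t_{e₁ e₃}`. -/
structure ProjectiveSystem (κ : K₀ R) where
  summand : ∀ {e₁ e₂ : ProjFiber κ}, e₁.LE e₂ → PPoint R (e₂.1 - e₁.1)
  split : ∀ {e₁ e₂ : ProjFiber κ}, e₁.LE e₂ →
    Splitting (projDim R e₁.1) (projDim R (e₂.1 - e₁.1)) (projDim R e₂.1)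
  summand_acyclic : ∀ {e₁ e₂ : ProjFiber κ} (h : e₁.LE e₂), (summand h).toCPoint.cplx.Acyclic
  map_self : ∀ {e : ProjFiber κ} (h : e.LE e) (X : PPoint R e.1),
    X.directSum (add_tsub_cancel_of_le h.1) (split h) (summand h) = X
  map_map : ∀ {e₁ e₂ e₃ : ProjFiber κ} (h₁₂ : e₁.LE e₂) (h₂₃ : e₂.LE e₃) (h₁₃ : e₁.LE e₃)
    (X : PPoint R e₁.1),
    (X.directSum (add_tsub_cancel_of_le h₁₂.1) (split h₁₂) (summand h₁₂)).directSum
        (add_tsub_cancel_of_le h₂₃.1) (split h₂₃) (summand h₂₃) =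
      X.directSum (add_tsub_cancel_of_le h₁₃.1) (split h₁₃) (summand h₁₃)

variable {κ : K₀ R}

/-- The transition map `T_{d₁ d₂}`. -/
def ComplexSystem.map (S : ComplexSystem κ) {d₁ d₂ : DimFiber κ} (h : d₁.LE d₂)
    (X : CPoint R d₁.1) : CPoint R d₂.1 :=
  X.directSum (S.split h) (S.summand h)

/-- The transition map `t_{e₁ e₂}`. -/
def ProjectiveSystem.map (S : ProjectiveSystem κ) {e₁ e₂ : ProjFiber κ} (h : e₁.LE e₂)
    (X : PPoint R e₁.1) : PPoint R e₂.1 :=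
  X.directSum (add_tsub_cancel_of_le h.1) (S.split h) (S.summand h)

/-- The direct limit `C^b(A, κ)` of the `C^b(A, d)`. -/
def ComplexSystem.Lim (S : ComplexSystem κ) : Type :=
  Quot fun p q : Σ d : DimFiber κ, CPoint R d.1 => ∃ h : p.1.LE q.1, S.map h p.2 = q.2

/-- The direct limit `P^b(A, κ)` of the `P^b(A, e)`. -/
def ProjectiveSystem.Lim (S : ProjectiveSystem κ) : Type :=
  Quot fun p q : Σ e : ProjFiber κ, PPoint R e.1 => ∃ h : p.1.LE q.1, S.map h p.2 = q.2

/-- The canonical map `T_d : C^b(A, d) ⟶ C^b(A, κ)`. -/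
def ComplexSystem.incl (S : ComplexSystem κ) (d : DimFiber κ) (X : CPoint R d.1) : S.Lim :=
  Quot.mk _ ⟨d, X⟩

/-- The canonical map `t_e : P^b(A, e) ⟶ P^b(A, κ)`. -/
def ProjectiveSystem.incl (S : ProjectiveSystem κ) (e : ProjFiber κ) (X : PPoint R e.1) : S.Lim :=
  Quot.mk _ ⟨e, X⟩

/-- Two points of `C^b(A, κ)` are equivalent if the corresponding complexes are isomorphic in the
derived category. -/
def ComplexSystem.Equivalent (S : ComplexSystem κ) (p q : S.Lim) : Prop :=
  ∃ (d₁ d₂ : DimFiber κ) (X : CPoint R d₁.1) (Y : CPoint R d₂.1),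
    S.incl d₁ X = p ∧ S.incl d₂ Y = q ∧ DIso X Y

/-- Two points of `P^b(A, κ)` are equivalent if the corresponding complexes are isomorphic in the
derived category. -/
def ProjectiveSystem.Equivalent (S : ProjectiveSystem κ) (p q : S.Lim) : Prop :=
  ∃ (e₁ e₂ : ProjFiber κ) (X : PPoint R e₁.1) (Y : PPoint R e₂.1),
    S.incl e₁ X = p ∧ S.incl e₂ Y = q ∧ DIso X.toCPoint Y.toCPoint

/-- The quotient `Q^b(A, κ)` of `C^b(A, κ)`. -/
def ComplexSystem.Quotient (S : ComplexSystem κ) : Type := Quot S.Equivalent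

/-- The quotient `QP^b(A, κ)` of `P^b(A, κ)`. -/
def ProjectiveSystem.Quotient (S : ProjectiveSystem κ) : Type := Quot S.Equivalent

/-- The canonical surjection `C^b(A, κ) ⟶ Q^b(A, κ)`. -/
def ComplexSystem.toQuotient (S : ComplexSystem κ) (p : S.Lim) : S.Quotient := Quot.mk _ p

/-- The canonical surjection `P^b(A, κ) ⟶ QP^b(A, κ)`. -/
def ProjectiveSystem.toQuotient (S : ProjectiveSystem κ) (p : S.Lim) : S.Quotient := Quot.mk _ p

/-- The dimension vector sequence `d(e)` of a projective dimension sequence. -/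
def ProjFiber.toDimFiber (e : ProjFiber κ) : DimFiber κ := ⟨projDim R e.1, e.2⟩

end Limits

end QuiverComplexes

open QuiverComplexes

/-!
The map `φ'` replaces a complex by a projective resolution which depends polynomially on it.

*Resolutions.* For a complex `X` of representations let `F X → X` be the surjection from the complex
of projective modules `⊕_v P_v^{d i v}` given by the standard bases, and `Ω X` its kernel. Then
`cone(Ω X → F X)` is quasi-isomorphic to `X` (`DIso.resolve`), and the projective dimensions of its
terms are smaller, unless they are already projective. The generators of `F X` span a complement of
`Ω X`, so projecting along them identifies `Ω X` with the radical of `F X` as a graded vector space,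
which does not depend on `X`; in these coordinates the cone is a polynomial function of `X`
(`isPolyMorphism_resolve`). Iterating as often as the global dimension requires gives a complex of
projective modules. A finite dimensional projective module is a sum of copies of the `P_v`
(`exists_equiv_freeOn`), and the Cartan matrix is invertible because simple modules have finite
projective resolutions (`cartan_injective`), so the dimension vectors of the terms determine their
multiplicities. Hence one obtains a polynomial map `C^b(A, d) → P^b(A, e)` over the identity in the
derived category (`exists_projective_resolution`), where `d(e)` and `d` have the same class.

*Index sets.* The Euler characteristic of the cohomology is a homomorphism on `K₀(D^b(A))`, by which
the class of `d` determines the alternating sum of the vectors `d i` (`eulerHom_dimCls`). Two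
sequences with equal alternating sums become equal after adding sequences of disks `B = B`
(`stablyEq_of_altSum_eq`). Such a sequence belongs to a direct sum of simple disks, and as a
projective dimension sequence it belongs to an acyclic complex. Therefore both index sets are
directed; for the projective ones this uses the injectivity of the Cartan matrix once more.

*Gluing.* Since the index set is directed and the transition maps are closed immersions onto the
block diagonal matrices with fixed second block, every `C^b(A, d)` embeds into the limit, the
intersection with another `C^b(A, d')` is closed in `C^b(A, d)`
(`ComplexSystem.isClosed_mem_range_incl`), and on this intersection the coordinates in `C^b(A, d')`
are polynomials in those of `C^b(A, d)`. Number the countably many sequences of the fibre, and let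
`φ'` resolve each point of the limit in the first variety in which it occurs. For a point of
`C^b(A, d)` this variety is one of finitely many, each of them being used on a locally closed subset, so
that the restriction of `φ'` is constructible (`exists_constructible_resolution`). All maps involved
preserve the isomorphism class in the derived category: the transition maps add acyclic complexes
(`DIso.directSum`), and `φ'` takes resolutions. So the induced maps between the quotients are
inverse to each other.
-/

open CategoryTheory Limits Pretriangulated

noncomputable section

namespace QuiverComplexes

set_option linter.unusedSectionVars false

/-! ### The bound quiver algebra and its nilpotent radical -/

section AlgebraStructure

variable {V : Type} [Fintype V] [Quiver.{0} V] (R : AdmissibleRelations V)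

/-- The ring structure of `A`.  It is the one found by unification for the iterated quotient, which
instance search does not always find. -/
instance instRingAlg : Ring (Alg R) := RingQuot.instRing (IdealRel R.rel)

/-- The element of `A` given by an arrow. -/
def arrowElem {s t : V} (a : s ⟶ t) : Alg R := toAlg R (FreeAlgebra.ι ℂ (Sum.inr ⟨s, t, a⟩))

/-- The element of `A` given by a path. -/
def pathClass {s t : V} (p : Quiver.Path s t) : Alg R :=
  RingQuot.mkAlgHom ℂ (IdealRel R.rel) (pathElem p)

lemma toAlg_eq_of_pathRel {x y : FreeAlgebra ℂ (Gen V)} (h : PathRel V x y) :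
    toAlg R x = toAlg R y :=
  congrArg (RingQuot.mkAlgHom ℂ (IdealRel R.rel)) (RingQuot.mkAlgHom_rel ℂ h)

lemma idem_mul_self (v : V) : idem R v * idem R v = idem R v := by
  simpa [idem] using toAlg_eq_of_pathRel R (.idem v)

lemma idem_mul_of_ne {v w : V} (h : v ≠ w) : idem R v * idem R w = 0 := by
  simpa [idem] using toAlg_eq_of_pathRel R (.orth v w h)

lemma sum_idem : ∑ v, idem R v = 1 := by
  simpa [idem] using toAlg_eq_of_pathRel R .one

lemma idem_mul_arrowElem {s t : V} (a : s ⟶ t) : idem R t * arrowElem R a = arrowElem R a := by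
  simpa [idem, arrowElem] using toAlg_eq_of_pathRel R (.target a)

lemma arrowElem_mul_idem {s t : V} (a : s ⟶ t) : arrowElem R a * idem R s = arrowElem R a := by
  simpa [idem, arrowElem] using toAlg_eq_of_pathRel R (.source a)

@[simp] lemma pathClass_nil (s : V) : pathClass R (Quiver.Path.nil : Quiver.Path s s) = idem R s :=
  rfl

@[simp] lemma pathClass_cons {s t u : V} (p : Quiver.Path s t) (a : t ⟶ u) :
    pathClass R (p.cons a) = arrowElem R a * pathClass R p := by
  simp only [pathClass, pathElem, map_mul]; rfl

lemma idem_mul_pathClass {s t : V} (p : Quiver.Path s t) :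
    idem R t * pathClass R p = pathClass R p := by
  cases p with
  | nil => exact idem_mul_self R _
  | cons p a => rw [pathClass_cons, ← mul_assoc, idem_mul_arrowElem]

lemma pathClass_mul_idem {s t : V} (p : Quiver.Path s t) :
    pathClass R p * idem R s = pathClass R p := by
  induction p with
  | nil => exact idem_mul_self R _
  | cons p a ih => rw [pathClass_cons, mul_assoc, ih]

lemma pathClass_comp {s t u : V} (p : Quiver.Path s t) (q : Quiver.Path t u) :
    pathClass R (p.comp q) = pathClass R q * pathClass R p := by
  induction q with
  | nil => simp [idem_mul_pathClass]
  | cons q a ih => simp [ih, mul_assoc]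

lemma pathClass_relation {s t : V} {r : Quiver.Path s t →₀ ℂ} (hr : r ∈ R.rel s t) :
    (r.sum fun p c => c • pathClass R p) = 0 := by
  have h : RingQuot.mkAlgHom ℂ (IdealRel R.rel) (combElem r) =
      RingQuot.mkAlgHom ℂ (IdealRel R.rel) 0 :=
    RingQuot.mkAlgHom_rel ℂ ⟨s, t, r, hr, rfl, rfl⟩
  simpa [combElem, Finsupp.sum, pathClass] using h

/-- The span of the classes of all paths of length at least `k`. -/
def longPaths (k : ℕ) : Submodule ℂ (Alg R) :=
  Submodule.span ℂ {x | ∃ (s t : V) (p : Quiver.Path s t), k ≤ p.length ∧ x = pathClass R p}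

lemma pathClass_mem_longPaths {k : ℕ} {s t : V} (p : Quiver.Path s t) (h : k ≤ p.length) :
    pathClass R p ∈ longPaths R k :=
  Submodule.subset_span ⟨s, t, p, h, rfl⟩

lemma idem_mem_longPaths (v : V) : idem R v ∈ longPaths R 0 := by
  rw [← pathClass_nil]
  exact pathClass_mem_longPaths R _ (Nat.zero_le _)

lemma mul_mem_longPaths {j k : ℕ} {x y : Alg R} (hx : x ∈ longPaths R j)
    (hy : y ∈ longPaths R k) : x * y ∈ longPaths R (j + k) := by
  have h : longPaths R j * longPaths R k ≤ longPaths R (j + k) := by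
    rw [longPaths, longPaths, Submodule.span_mul_span, Submodule.span_le]
    rintro _ ⟨_, ⟨s, t, p, hp, rfl⟩, _, ⟨u, v, q, hq, rfl⟩, rfl⟩
    simp only
    by_cases hv : s = v
    · subst hv
      rw [← pathClass_comp]
      exact pathClass_mem_longPaths R _ (by rw [Quiver.Path.length_comp]; omega)
    · rw [← pathClass_mul_idem, ← idem_mul_pathClass R q, mul_assoc, ← mul_assoc (idem R s),
        idem_mul_of_ne R hv]
      simp
  exact h (Submodule.mul_mem_mul hx hy)

lemma mem_longPaths_zero (x : Alg R) : x ∈ longPaths R 0 := by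
  obtain ⟨b, rfl⟩ := toAlg_surjective R x
  induction b using FreeAlgebra.induction with
  | grade0 c =>
    have h1 : (1 : Alg R) ∈ longPaths R 0 := by
      rw [← sum_idem R]
      exact Submodule.sum_mem _ fun v _ => idem_mem_longPaths R v
    rw [AlgHom.commutes, Algebra.algebraMap_eq_smul_one]
    exact Submodule.smul_mem _ c h1
  | grade1 g =>
    rcases g with v | ⟨s, t, a⟩
    · exact idem_mem_longPaths R v
    · have := pathClass_mem_longPaths (k := 0) R ((Quiver.Path.nil : Quiver.Path s s).cons a)
        (Nat.zero_le _)
      rwa [pathClass_cons, pathClass_nil, arrowElem_mul_idem] at this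
  | mul a b ha hb =>
    have h := mul_mem_longPaths R ha hb
    rwa [← map_mul, Nat.add_zero] at h
  | add a b ha hb => rw [map_add]; exact Submodule.add_mem _ ha hb

/-- Admissibility bounds the length of the paths which are nonzero in `A`. -/
lemma exists_longPaths_eq_bot : ∃ N, longPaths R N = ⊥ := by
  obtain ⟨N, hN⟩ := R.long_paths
  refine ⟨N, ?_⟩
  have h : ∀ (m : ℕ) {s t : V} (p : Quiver.Path s t), p.length = N + m → pathClass R p = 0 := by
    intro m
    induction m with
    | zero => exact fun p hp => hN _ _ p hp
    | succ m ih =>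
      intro s t p hp
      cases p with
      | nil => simp at hp
      | cons p a =>
        rw [pathClass_cons, ih p (by rw [Quiver.Path.length_cons] at hp; omega), mul_zero]
  rw [longPaths, Submodule.span_eq_bot]
  rintro _ ⟨s, t, p, hp, rfl⟩
  exact h (p.length - N) p (by omega)

/-- `A` is spanned by the finitely many paths of length less than `N`, where all paths of length `N`
vanish. -/
instance finiteDimensional_alg [∀ s t : V, Finite (s ⟶ t)] : Module.Finite ℂ (Alg R) := by
  have hfin : ∀ n, {x | ∃ (s t : V) (p : Quiver.Path s t), p.length = n ∧
      x = pathClass R p}.Finite := by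
    intro n
    induction n with
    | zero =>
      refine (Set.finite_range (idem R)).subset ?_
      rintro _ ⟨s, t, p, hp, rfl⟩
      cases p with
      | nil => exact ⟨s, rfl⟩
      | cons p a => simp at hp
    | succ n ih =>
      refine (Set.Finite.image2 (fun x y : Alg R => x * y)
        (Set.finite_range fun a : Σ s t : V, (s ⟶ t) => arrowElem R a.2.2) ih).subset ?_
      rintro _ ⟨s, t, p, hp, rfl⟩
      cases p with
      | nil => simp at hp
      | cons p a =>
        exact ⟨_, ⟨⟨_, _, a⟩, rfl⟩, _, ⟨_, _, p, by simpa using hp, rfl⟩,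
          (pathClass_cons R p a).symm⟩
  obtain ⟨N, hN⟩ := exists_longPaths_eq_bot R
  refine ⟨Submodule.fg_def.2 ⟨⋃ n ∈ Finset.range N, _, Set.Finite.biUnion (Finset.finite_toSet _)
      fun n _ => hfin n, ?_⟩⟩
  refine top_unique (le_trans (fun x _ => mem_longPaths_zero R x) (Submodule.span_le.2 ?_))
  rintro _ ⟨s, t, p, -, rfl⟩
  by_cases hp : N ≤ p.length
  · have := pathClass_mem_longPaths R p hp
    rw [hN, Submodule.mem_bot] at this
    rw [this]; exact Submodule.zero_mem _
  · exact Submodule.subset_span (Set.mem_biUnion (Finset.mem_coe.2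
      (Finset.mem_range.2 (not_le.1 hp))) ⟨s, t, p, rfl, rfl⟩)

end AlgebraStructure

/-! ### Augmentations and the lemma of Nakayama -/

section Augmentation

variable {V : Type} [Fintype V] [DecidableEq V] [Quiver.{0} V] (R : AdmissibleRelations V)

/-- The values of the augmentation at `v` on the generators. -/
def augGen (v : V) : Gen V → ℂ
  | .inl w => if w = v then 1 else 0
  | .inr _ => 0

/-- The augmentation at `v` on the path algebra. -/
def pathAug (v : V) : PathAlgebra V →ₐ[ℂ] ℂ :=
  RingQuot.liftAlgHom ℂ ⟨FreeAlgebra.lift ℂ (augGen v), by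
    intro y z h
    induction h with
    | idem w => by_cases h : w = v <;> simp [augGen, h]
    | orth u w h =>
      by_cases h1 : u = v
      · have : w ≠ v := fun h2 => h (h1.trans h2.symm)
        simp [augGen, this]
      · simp [augGen, h1]
    | one => simp [augGen]
    | target a => simp [augGen]
    | source a => simp [augGen]⟩

lemma pathAug_pathElem (v : V) {s t : V} (p : Quiver.Path s t) (hp : 1 ≤ p.length) :
    pathAug v (pathElem p) = 0 := by
  cases p with
  | nil => simp at hp
  | cons p a => simp [pathElem, pathAug, augGen]

/-- The augmentation `ε_v : A → ℂ` which sends `e_v` to `1` and all other idempotents and all arrows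
to `0`; it is the action of `A` on the simple module at `v`. -/
def aug (v : V) : Alg R →ₐ[ℂ] ℂ :=
  RingQuot.liftAlgHom ℂ ⟨pathAug v, by
    rintro y z ⟨s, t, r, hr, rfl, rfl⟩
    rw [combElem, Finsupp.sum, map_sum, map_zero]
    refine Finset.sum_eq_zero fun p hp => ?_
    rw [map_smul, pathAug_pathElem v p (by have := R.two_le_length s t r hr p hp; omega),
      smul_zero]⟩

lemma aug_pathClass (v : V) {s t : V} (p : Quiver.Path s t) (hp : 1 ≤ p.length) :
    aug R v (pathClass R p) = 0 := by
  simp [aug, pathClass, pathAug_pathElem v p hp]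

lemma aug_idem (v w : V) : aug R v (idem R w) = if w = v then 1 else 0 := by
  simp [aug, idem, toAlg, pathAug, augGen]

/-- `A` is the sum of the span of the paths of positive length and of the span of the `e_v`, and the
augmentations are the coordinates on the second summand. -/
lemma exists_eq_add_sum_aug (x : Alg R) :
    ∃ y ∈ longPaths R 1, x = y + ∑ v, aug R v x • idem R v := by
  have hx := mem_longPaths_zero R x
  induction hx using Submodule.span_induction with
  | mem x hx =>
    obtain ⟨s, t, p, -, rfl⟩ := hx
    by_cases hp : 1 ≤ p.length
    · exact ⟨_, pathClass_mem_longPaths R p hp, by simp [aug_pathClass R _ p hp]⟩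
    · cases p with
      | nil => exact ⟨0, Submodule.zero_mem _, by simp [aug_idem]⟩
      | cons p a => simp at hp
  | zero => exact ⟨0, Submodule.zero_mem _, by simp⟩
  | add x y _ _ hx hy =>
    obtain ⟨a, ha, hx⟩ := hx
    obtain ⟨b, hb, hy⟩ := hy
    refine ⟨a + b, Submodule.add_mem _ ha hb, ?_⟩
    simp only [map_add, add_smul, Finset.sum_add_distrib]
    nth_rewrite 1 [hx, hy]
    exact add_add_add_comm _ _ _ _
  | smul c x _ hx =>
    obtain ⟨a, ha, hx⟩ := hx
    refine ⟨c • a, Submodule.smul_mem _ c ha, ?_⟩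
    simp only [map_smul, smul_assoc, ← Finset.smul_sum]
    nth_rewrite 1 [hx]
    exact smul_add c _ _

/-- The radical of `A`: the elements with all augmentations zero. -/
def radIdeal : Ideal (Alg R) := ⨅ v, RingHom.ker (aug R v)

lemma mem_radIdeal {x : Alg R} : x ∈ radIdeal R ↔ ∀ v, aug R v x = 0 := by
  simp [radIdeal, RingHom.mem_ker]

/-- Nakayama's lemma for the nilpotent radical of `A`, without any finiteness condition on the
module. -/
lemma eq_bot_of_le_rad_smul {M : Type} [AddCommGroup M] [Module (Alg R) M]
    (N : Submodule (Alg R) M) (h : N ≤ radIdeal R • N) : N = ⊥ := by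
  obtain ⟨n, hn⟩ := exists_longPaths_eq_bot R
  -- elements of `N` are sums of multiples by paths of length at least `k`, for all `k`
  have h1 : ∀ k, ∀ x ∈ N, x ∈ AddSubgroup.closure
      {y | ∃ a ∈ longPaths R k, ∃ m ∈ N, y = a • m} := by
    intro k
    induction k with
    | zero =>
      refine fun x hx => AddSubgroup.subset_closure ⟨1, mem_longPaths_zero R 1, x, hx,
        (one_smul _ _).symm⟩
    | succ k ih =>
      intro x hx
      refine Submodule.smul_induction_on (h hx) (fun r hr m hm => ?_)
        fun _ _ => AddSubgroup.add_mem _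
      have hr1 : r ∈ longPaths R 1 := by
        obtain ⟨y, hy, h⟩ := exists_eq_add_sum_aug R r
        simp only [(mem_radIdeal R).1 hr, zero_smul, Finset.sum_const_zero, add_zero] at h
        exact h ▸ hy
      refine AddSubgroup.closure_induction (p := fun y _ => r • y ∈ AddSubgroup.closure
        {y | ∃ a ∈ longPaths R (k + 1), ∃ m ∈ N, y = a • m}) ?_ ?_ ?_ ?_ (ih m hm)
      · rintro _ ⟨a, ha, m, hm, rfl⟩
        refine AddSubgroup.subset_closure ⟨r * a, ?_, m, hm, (mul_smul _ _ _).symm⟩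
        rw [add_comm]; exact mul_mem_longPaths R hr1 ha
      · rw [smul_zero]; exact AddSubgroup.zero_mem _
      · intro y z _ _ hy hz
        rw [smul_add]; exact AddSubgroup.add_mem _ hy hz
      · intro y _ hy
        rw [smul_neg]; exact AddSubgroup.neg_mem _ hy
  rw [eq_bot_iff]
  intro x hx
  have := h1 n x hx
  rw [hn] at this
  have h2 : {y : M | ∃ a ∈ (⊥ : Submodule ℂ (Alg R)), ∃ m ∈ N, y = a • m} ⊆ {0} := by
    rintro _ ⟨a, ha, m, -, rfl⟩
    rw [(Submodule.mem_bot ℂ).1 ha]; simp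
  have h3 := AddSubgroup.closure_mono h2 this
  rwa [AddSubgroup.closure_singleton_zero] at h3

end Augmentation

/-! ### Dimension vectors of modules -/

section Dimensions

variable {V : Type} [Fintype V] [Quiver.{0} V] (R : AdmissibleRelations V)
variable (M : Type) [AddCommGroup M] [Module ℂ M] [Module (Alg R) M] [IsScalarTower ℂ (Alg R) M]
variable {M' : Type} [AddCommGroup M'] [Module ℂ M'] [Module (Alg R) M']
  [IsScalarTower ℂ (Alg R) M']
variable {M'' : Type} [AddCommGroup M''] [Module ℂ M''] [Module (Alg R) M'']
  [IsScalarTower ℂ (Alg R) M'']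

/-- The action of an element of `A` on a module, as a `ℂ`-linear map. -/
def lact (a : Alg R) : M →ₗ[ℂ] M := Algebra.lsmul ℂ ℂ M a

@[simp] lemma lact_apply (a : Alg R) (m : M) : lact R M a m = a • m := rfl

/-- The dimension of the space `e_w M`. -/
def dimAt (w : V) : ℕ := Module.finrank ℂ (LinearMap.range (lact R M (idem R w)))

variable {M}

lemma idem_smul_idem_smul (v : V) (m : M) : idem R v • idem R v • m = idem R v • m := by
  rw [← mul_smul, idem_mul_self]

lemma idem_smul_idem_smul_of_ne {v w : V} (h : v ≠ w) (m : M) :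
    idem R v • idem R w • m = 0 := by
  rw [← mul_smul, idem_mul_of_ne R h, zero_smul]

lemma sum_idem_smul (m : M) : ∑ v, idem R v • m = m := by
  rw [← Finset.sum_smul, sum_idem, one_smul]

variable {R} in
/-- The rank of a homomorphism on the spaces at the vertex `w`. -/
def rankAt (f : M →ₗ[Alg R] M') (w : V) : ℕ :=
  Module.finrank ℂ (LinearMap.range ((f.restrictScalars ℂ) ∘ₗ lact R M (idem R w)))

variable {R} in
/-- For an exact sequence `M → M' → M''`, the rank-nullity theorem on the parts at `w`. -/
lemma rankAt_add_rankAt [Module.Finite ℂ M'] (f : M →ₗ[Alg R] M') (g : M' →ₗ[Alg R] M'')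
    (h : Function.Exact f g) (w : V) : dimAt R M' w = rankAt f w + rankAt g w := by
  let q := (g.restrictScalars ℂ).domRestrict (LinearMap.range (lact R M' (idem R w)))
  have h1 := LinearMap.finrank_range_add_finrank_ker q
  have h2 : LinearMap.range q =
      LinearMap.range ((g.restrictScalars ℂ) ∘ₗ lact R M' (idem R w)) := by
    rw [LinearMap.range_comp]
    exact LinearMap.range_domRestrict _ _
  have h3 : (LinearMap.ker q).map (Submodule.subtype _) =
      LinearMap.range ((f.restrictScalars ℂ) ∘ₗ lact R M (idem R w)) := by
    ext y
    constructor
    · rintro ⟨⟨_, m, rfl⟩, hm, rfl⟩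
      have hm' : g (idem R w • m) = 0 := hm
      obtain ⟨n, hn⟩ := (h _).1 hm'
      refine ⟨n, ?_⟩
      change f (idem R w • n) = idem R w • m
      rw [map_smul, hn, idem_smul_idem_smul]
    · rintro ⟨n, rfl⟩
      have hn : f (idem R w • n) = idem R w • f n := map_smul _ _ _
      refine ⟨⟨f (idem R w • n), f n, hn.symm⟩, ?_, rfl⟩
      exact (h _).2 ⟨_, rfl⟩
  have h4 : Module.finrank ℂ (LinearMap.ker q) = rankAt f w := by
    rw [rankAt, ← h3]
    exact (Submodule.equivMapOfInjective _ (Submodule.injective_subtype _) _).finrank_eq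
  rw [dimAt, ← h1, h2, h4, add_comm]; rfl

variable {R} in
lemma rankAt_of_surjective (f : M →ₗ[Alg R] M') (h : Function.Surjective f) (w : V) :
    rankAt f w = dimAt R M' w := by
  have : LinearMap.range ((f.restrictScalars ℂ) ∘ₗ lact R M (idem R w)) =
      LinearMap.range (lact R M' (idem R w)) := by
    ext y
    constructor
    · rintro ⟨m, rfl⟩
      exact ⟨f m, (map_smul f _ _).symm⟩
    · rintro ⟨m, rfl⟩
      obtain ⟨m, rfl⟩ := h m
      exact ⟨m, map_smul f _ _⟩
  rw [rankAt, this, dimAt]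

variable {R} in
lemma rankAt_zero (w : V) : rankAt (0 : M →ₗ[Alg R] M') w = 0 := by
  have : LinearMap.range (((0 : M →ₗ[Alg R] M').restrictScalars ℂ) ∘ₗ lact R M (idem R w)) = ⊥ := by
    rw [LinearMap.range_eq_bot]; rfl
  rw [rankAt, this, finrank_bot]

variable {R} in
lemma rankAt_of_injective [Module.Finite ℂ M] (f : M →ₗ[Alg R] M') (h : Function.Injective f)
    (w : V) : rankAt f w = dimAt R M w := by
  have := rankAt_add_rankAt (0 : M →ₗ[Alg R] M) f (fun y => by
    constructor
    · intro hy
      exact ⟨0, (h (by simpa using hy)).symm⟩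
    · rintro ⟨_, rfl⟩; simp) w
  rw [rankAt_zero, zero_add] at this
  exact this.symm

variable {R} in
lemma dimAt_congr (f : M ≃ₗ[Alg R] M') (w : V) : dimAt R M w = dimAt R M' w := by
  refine ((f.restrictScalars ℂ).submoduleMap _).finrank_eq.trans ?_
  have : (LinearMap.range (lact R M (idem R w))).map ((f.restrictScalars ℂ : M →ₗ[ℂ] M')) =
      LinearMap.range (lact R M' (idem R w)) := by
    rw [← LinearMap.range_comp]
    exact (LinearMap.range_comp_of_range_eq_top (lact R M' (idem R w))
      (f := (f.restrictScalars ℂ : M →ₗ[ℂ] M')) (LinearEquiv.range _) ▸ congrArg LinearMap.range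
        (LinearMap.ext fun m => map_smul f _ _))
  rw [dimAt, ← this]

variable {R} in
lemma dimAt_exact [Module.Finite ℂ M] [Module.Finite ℂ M'] (f : M →ₗ[Alg R] M')
    (g : M' →ₗ[Alg R] M'') (hf : Function.Injective f) (hg : Function.Surjective g)
    (h : Function.Exact f g) (w : V) : dimAt R M' w = dimAt R M w + dimAt R M'' w := by
  rw [rankAt_add_rankAt f g h, rankAt_of_injective f hf, rankAt_of_surjective g hg]

lemma dimAt_prod [Module.Finite ℂ M] [Module.Finite ℂ M'] (w : V) :
    dimAt R (M × M') w = dimAt R M w + dimAt R M' w :=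
  dimAt_exact (LinearMap.inl (Alg R) M M') (LinearMap.snd (Alg R) M M') LinearMap.inl_injective
    LinearMap.snd_surjective Function.Exact.inl_snd w

lemma dimAt_pi {ι : Type} [Fintype ι] (N : ι → Type) [∀ i, AddCommGroup (N i)]
    [∀ i, Module ℂ (N i)] [∀ i, Module (Alg R) (N i)] [∀ i, IsScalarTower ℂ (Alg R) (N i)]
    [∀ i, Module.Finite ℂ (N i)] (w : V) :
    dimAt R (∀ i, N i) w = ∑ i, dimAt R (N i) w := by
  have h : LinearMap.range (lact R (∀ i, N i) (idem R w)) =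
      Submodule.pi Set.univ fun i => LinearMap.range (lact R (N i) (idem R w)) := by
    ext y
    constructor
    · rintro ⟨m, rfl⟩ i -
      exact ⟨m i, rfl⟩
    · intro hy
      choose m hm using fun i => hy i (Set.mem_univ i)
      exact ⟨m, funext hm⟩
  let e : (∀ i, LinearMap.range (lact R (N i) (idem R w))) ≃ₗ[ℂ]
      LinearMap.range (lact R (∀ i, N i) (idem R w)) :=
    { toFun := fun f => ⟨fun i => f i, h.ge fun i _ => (f i).2⟩
      map_add' := fun _ _ => rfl
      map_smul' := fun _ _ => rfl
      invFun := fun y i => ⟨y.1 i, (h.le y.2 : _) i trivial⟩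
      left_inv := fun _ => rfl
      right_inv := fun _ => rfl }
  rw [dimAt, ← e.finrank_eq, Module.finrank_pi_fintype]
  rfl

/-- The decomposition `M = ⊕_v e_v M`. -/
def vertexDecomposition : M ≃ₗ[ℂ] ∀ v, LinearMap.range (lact R M (idem R v)) where
  toFun m v := ⟨idem R v • m, m, rfl⟩
  map_add' m n := funext fun v => Subtype.ext (smul_add _ _ _)
  map_smul' c m := funext fun v => Subtype.ext (smul_comm _ _ _)
  invFun f := ∑ v, (f v : M)
  left_inv m := sum_idem_smul R m
  right_inv f := by
    classical
    refine funext fun v => Subtype.ext ?_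
    change idem R v • ∑ w, (f w : M) = f v
    rw [Finset.smul_sum, Finset.sum_eq_single v]
    · obtain ⟨m, hm⟩ := (f v).2
      rw [← hm]; exact idem_smul_idem_smul R v m
    · intro w _ hw
      obtain ⟨m, hm⟩ := (f w).2
      rw [← hm]; exact idem_smul_idem_smul_of_ne R hw.symm m
    · simp

end Dimensions

/-! ### Modules with adapted bases as points of module varieties -/

section Frames

variable {V : Type} [Fintype V] [DecidableEq V] [Quiver.{0} V] (R : AdmissibleRelations V)

/-- A `ℂ`-basis of an `A`-module which is adapted to the decomposition `M = ⊕_v e_v M`, the part at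
`v` being indexed by `Fin (d v)`. -/
structure Frame (M : Type) [AddCommGroup M] [Module ℂ M] [Module (Alg R) M] (d : V → ℕ) where
  basis : Module.Basis (Σ v, Fin (d v)) ℂ M
  idem_smul_basis : ∀ v k, idem R v • basis ⟨v, k⟩ = basis ⟨v, k⟩

variable {R}
variable {M : Type} [AddCommGroup M] [Module ℂ M] [Module (Alg R) M] [IsScalarTower ℂ (Alg R) M]
variable {M' : Type} [AddCommGroup M'] [Module ℂ M'] [Module (Alg R) M']
  [IsScalarTower ℂ (Alg R) M']
variable {M'' : Type} [AddCommGroup M''] [Module ℂ M''] [Module (Alg R) M'']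
  [IsScalarTower ℂ (Alg R) M'']
variable {d d' d'' : V → ℕ}

/-- A module with dimension vector `d` has an adapted basis. -/
lemma exists_frame [Module.Finite ℂ M] (h : ∀ w, dimAt R M w = d w) : Nonempty (Frame R M d) := by
  let b : ∀ v, Module.Basis (Fin (d v)) ℂ (LinearMap.range (lact R M (idem R v))) := fun v =>
    (Module.finBasis ℂ _).reindex (finCongr (h v))
  refine ⟨⟨(Pi.basis b).map (vertexDecomposition R).symm, fun v k => ?_⟩⟩
  have h1 : ((Pi.basis b).map (vertexDecomposition R).symm) ⟨v, k⟩ = (b v k : M) := by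
    change ∑ w, ((Pi.basis b ⟨v, k⟩ w : _) : M) = _
    rw [Finset.sum_eq_single v]
    · simp [Pi.basis_apply]
    · intro w _ hw
      simp [Pi.basis_apply, hw]
    · simp
  obtain ⟨m, hm⟩ := (b v k).2
  rw [h1, ← hm]
  exact idem_smul_idem_smul R v m

namespace Frame

variable (f : Frame R M d) (f' : Frame R M' d') (f'' : Frame R M'' d'')

lemma idem_smul_basis_of_ne {v w : V} (h : v ≠ w) (k : Fin (d w)) :
    idem R v • f.basis ⟨w, k⟩ = 0 := by
  rw [← f.idem_smul_basis, idem_smul_idem_smul_of_ne R h]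

lemma repr_idem_smul (v : V) (m : M) (w : V) (k : Fin (d w)) :
    f.basis.repr (idem R v • m) ⟨w, k⟩ = if w = v then f.basis.repr m ⟨w, k⟩ else 0 := by
  have h : (f.basis.coord ⟨w, k⟩) ∘ₗ lact R M (idem R v) =
      if w = v then f.basis.coord ⟨w, k⟩ else 0 := by
    refine f.basis.ext fun ⟨u, l⟩ => ?_
    by_cases hu : u = v
    · subst hu
      have : f.basis.coord ⟨w, k⟩ (f.basis ⟨u, l⟩) =
          if w = u then f.basis.coord ⟨w, k⟩ (f.basis ⟨u, l⟩) else 0 := by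
        split_ifs with hw
        · rfl
        · simp only [Module.Basis.coord_apply, Module.Basis.repr_self]
          rw [Finsupp.single_eq_of_ne]
          rintro ⟨⟩
          exact hw rfl
      rw [LinearMap.comp_apply, lact_apply, f.idem_smul_basis, this]
      split_ifs <;> rfl
    · rw [LinearMap.comp_apply, lact_apply, f.idem_smul_basis_of_ne (Ne.symm hu), map_zero]
      split_ifs with hw
      · subst hw
        simp only [Module.Basis.coord_apply, Module.Basis.repr_self]
        rw [Finsupp.single_eq_of_ne]
        rintro ⟨⟩
        exact hu rfl
      · rfl
  have := LinearMap.congr_fun h m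
  rw [LinearMap.comp_apply, lact_apply, Module.Basis.coord_apply] at this
  rw [this]
  split_ifs <;> rfl

lemma eq_sum_of_idem_smul {v : V} {m : M} (h : idem R v • m = m) :
    m = ∑ k, f.basis.repr m ⟨v, k⟩ • f.basis ⟨v, k⟩ := by
  conv_lhs => rw [← f.basis.sum_repr m, Fintype.sum_sigma]
  refine Finset.sum_eq_single v (fun w _ hw => Finset.sum_eq_zero fun k _ => ?_) (by simp)
  rw [← h, f.repr_idem_smul, if_neg hw, zero_smul]

/-- The matrix of a `ℂ`-linear map between framed modules, from the part at `s` to the part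
at `t`. -/
def mat (T : M →ₗ[ℂ] M') (s t : V) : Matrix (Fin (d' t)) (Fin (d s)) ℂ :=
  Matrix.of fun l k => f'.basis.repr (T (f.basis ⟨s, k⟩)) ⟨t, l⟩

/-- Matrices of parts are multiplicative when `T` maps the part at `s` to the part at `t`; in
general the composite involves the parts at all vertices. -/
lemma mat_comp (T' : M' →ₗ[ℂ] M'') (T : M →ₗ[ℂ] M') {s t : V} (u : V)
    (h : ∀ k, idem R t • T (f.basis ⟨s, k⟩) = T (f.basis ⟨s, k⟩)) :
    f.mat f'' (T' ∘ₗ T) s u = f'.mat f'' T' t u * f.mat f' T s t := by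
  ext l k
  simp only [mat, Matrix.of_apply, Matrix.mul_apply, LinearMap.comp_apply]
  conv_lhs => rw [f'.eq_sum_of_idem_smul (h k)]
  simp [map_sum, mul_comm]

lemma mat_id (s : V) : f.mat f LinearMap.id s s = 1 := by
  ext l k
  simp only [mat, Matrix.of_apply, LinearMap.id_apply, Module.Basis.repr_self]
  by_cases h : l = k
  · subst h; simp
  · rw [Matrix.one_apply_ne h, Finsupp.single_eq_of_ne]
    rintro ⟨⟩
    exact h rfl

lemma mat_arrowElem_comp {s t : V} (a : s ⟶ t) (u : V) (T : M →ₗ[ℂ] M') :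
    f.mat f' (T ∘ₗ lact R M (arrowElem R a)) s u =
      f.mat f' T t u * f.mat f (lact R M (arrowElem R a)) s t :=
  mat_comp _ _ _ _ _ _ fun k => by rw [lact_apply, ← mul_smul, idem_mul_arrowElem]

lemma pathMat_mat {s t : V} (p : Quiver.Path s t) :
    pathMat (fun s t a => f.mat f (lact R M (arrowElem R a)) s t : ArrowMaps d) p =
      f.mat f (lact R M (pathClass R p)) s t := by
  induction p with
  | nil =>
    rw [pathMat, ← f.mat_id]
    ext l k
    simp [mat, f.idem_smul_basis]
  | cons p a ih =>
    rw [pathMat, ih, ← f.mat_comp f f _ _ _ fun k => by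
      rw [lact_apply, ← mul_smul, idem_mul_pathClass], pathClass_cons]
    congr 1
    ext m
    simp [mul_smul]

/-- The point of the module variety given by a framed module. -/
def toRep : Rep R d :=
  ⟨fun s t a => f.mat f (lact R M (arrowElem R a)) s t, fun s t r hr => by
    ext l k
    have h := congrArg (fun a : Alg R => f.basis.repr (a • f.basis ⟨s, k⟩) ⟨t, l⟩)
      (pathClass_relation R hr)
    simp only [Finsupp.sum, Finset.sum_smul, map_sum, Finsupp.coe_finsetSum, Finset.sum_apply,
      zero_smul, map_zero, Finsupp.coe_zero, Pi.zero_apply, smul_assoc, map_smul,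
      Finsupp.coe_smul, Pi.smul_apply] at h
    simp only [Finsupp.sum, pathMat_mat, Matrix.sum_apply, Matrix.smul_apply, Matrix.zero_apply]
    exact h⟩

/-- The coordinates with respect to a frame, as an element of `ℂ^d`. -/
def coords : M ≃ₗ[ℂ] GradedSpace d :=
  f.basis.equivFun.trans (LinearEquiv.piCurry ℂ fun v (_ : Fin (d v)) => ℂ)

lemma coords_apply (m : M) (v : V) (k : Fin (d v)) : f.coords m v k = f.basis.repr m ⟨v, k⟩ := rfl

lemma coords_basis (v : V) (k : Fin (d v)) :
    f.coords (f.basis ⟨v, k⟩) = Pi.single v (Pi.single k 1) := by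
  refine funext fun w => funext fun l => ?_
  rw [coords_apply, Module.Basis.repr_self]
  by_cases hw : w = v
  · subst hw
    rw [Pi.single_eq_same]
    by_cases hl : l = k
    · subst hl; simp
    · rw [Finsupp.single_eq_of_ne, Pi.single_eq_of_ne hl]
      rintro ⟨⟩
      exact hl rfl
  · rw [Finsupp.single_eq_of_ne, Pi.single_eq_of_ne hw]
    · rfl
    · rintro ⟨⟩
      exact hw rfl

lemma coords_gen_smul (g : Gen V) (m : M) :
    f.coords (toAlg R (FreeAlgebra.ι ℂ g) • m) = genAct f.toRep.1 g (f.coords m) := by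
  rcases g with v | ⟨s, t, a⟩
  · refine funext fun w => funext fun l => ?_
    change f.basis.repr (idem R v • m) ⟨w, l⟩ =
      Pi.single (M := fun v => Fin (d v) → ℂ) v (Matrix.mulVec 1 (f.coords m v)) w l
    rw [f.repr_idem_smul, Matrix.one_mulVec]
    split_ifs with h
    · subst h; rw [Pi.single_eq_same]; rfl
    · rw [Pi.single_eq_of_ne h]; rfl
  · have h : f.coords.toLinearMap ∘ₗ lact R M (arrowElem R a) =
        (genAct f.toRep.1 (.inr ⟨s, t, a⟩)) ∘ₗ f.coords.toLinearMap := by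
      refine f.basis.ext fun ⟨u, k⟩ => ?_
      simp only [LinearMap.comp_apply, LinearEquiv.coe_coe, lact_apply]
      refine funext fun w => funext fun l => ?_
      rw [coords_basis]
      change f.basis.repr (arrowElem R a • f.basis ⟨u, k⟩) ⟨w, l⟩ =
        Pi.single (M := fun v => Fin (d v) → ℂ) t ((f.toRep.1 a).mulVec
          (Pi.single (M := fun v => Fin (d v) → ℂ) u (Pi.single k 1) s)) w l
      by_cases hu : s = u
      · subst hu
        rw [Pi.single_eq_same, Matrix.mulVec_single_one]
        by_cases hw : w = t
        · subst hw; rw [Pi.single_eq_same]; rfl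
        · rw [Pi.single_eq_of_ne hw, ← idem_mul_arrowElem, mul_smul, f.repr_idem_smul, if_neg hw]
          rfl
      · rw [Pi.single_eq_of_ne hu, Matrix.mulVec_zero, ← arrowElem_mul_idem, mul_smul,
          f.idem_smul_basis_of_ne hu, smul_zero, map_zero, Pi.single_zero]
        rfl
    exact LinearMap.congr_fun h m

lemma coords_smul (a : Alg R) (m : M) :
    f.coords (a • m) = act f.toRep a (f.coords m) := by
  obtain ⟨b, rfl⟩ := toAlg_surjective R a
  rw [act_toAlg]
  induction b using FreeAlgebra.induction generalizing m with
  | grade0 c =>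
    rw [AlgHom.commutes, AlgHom.commutes, algebraMap_smul, map_smul]
    rfl
  | grade1 g => rw [FreeAlgebra.lift_ι_apply, coords_gen_smul]
  | mul a b ha hb => rw [map_mul, map_mul, mul_smul, Module.End.mul_apply, ha, hb]
  | add a b ha hb => rw [map_add, map_add, add_smul, LinearMap.add_apply, map_add, ha, hb]

/-- The module given by the point `f.toRep` is isomorphic to the framed module. -/
def toRepEquiv : f.toRep.Mod ≃ₗ[Alg R] M :=
  LinearEquiv.symm
  { f.coords with
    toFun := fun m => f.coords m
    map_smul' := fun a m => f.coords_smul a m }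

lemma dimAt_eq (f : Frame R M d) (w : V) : dimAt R M w = d w := by
  have h : LinearMap.range (lact R M (idem R w)) =
      LinearMap.range (Fintype.linearCombination ℂ fun k => f.basis ⟨w, k⟩) := by
    ext m
    constructor
    · rintro ⟨m, rfl⟩
      rw [lact_apply, f.eq_sum_of_idem_smul (idem_smul_idem_smul R w m)]
      exact ⟨_, rfl⟩
    · rintro ⟨c, rfl⟩
      refine ⟨_, (?_ : idem R w • (Fintype.linearCombination ℂ fun k => f.basis ⟨w, k⟩) c = _)⟩
      simp only [Fintype.linearCombination_apply, Finset.smul_sum, smul_comm (idem R w) (c _),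
        f.idem_smul_basis]
  rw [dimAt, h, LinearMap.finrank_range_of_inj]
  · simp
  · rw [← linearIndependent_iff_injective_fintypeLinearCombination]
    exact f.basis.linearIndependent.comp _ fun k l h => by simpa using h

end Frame

/-- The standard frame of the module given by a point of the module variety. -/
def Rep.frame (x : Rep R d) : Frame R x.Mod d where
  basis := Pi.basis fun v => Pi.basisFun ℂ (Fin (d v))
  idem_smul_basis v k := by
    rw [smul_def, idem, act_toAlg, FreeAlgebra.lift_ι_apply]
    change Pi.single v (Matrix.mulVec (1 : Matrix (Fin (d v)) (Fin (d v)) ℂ)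
      ((Pi.basis fun v => Pi.basisFun ℂ (Fin (d v))) ⟨v, k⟩ v)) =
      (Pi.basis fun v => Pi.basisFun ℂ (Fin (d v))) ⟨v, k⟩
    rw [Pi.basis_apply, Pi.basisFun_apply]
    rw [Pi.single_eq_same, Matrix.one_mulVec]

lemma Rep.frame_coords (x : Rep R d) (m : x.Mod) : x.frame.coords m = m := by
  refine funext fun v => funext fun k => ?_
  exact Pi.basis_repr (fun v => Pi.basisFun ℂ (Fin (d v))) (m : GradedSpace d) ⟨v, k⟩

end Frames

/-! ### Complexes with adapted bases as points of varieties of complexes -/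

section FramedComplexes

variable {V : Type} [Fintype V] [DecidableEq V] [Quiver.{0} V] {R : AdmissibleRelations V}
variable {d : DimSeq V} {N : ℤ → Type} [∀ i, AddCommGroup (N i)] [∀ i, Module ℂ (N i)]
  [∀ i, Module (Alg R) (N i)] [∀ i, IsScalarTower ℂ (Alg R) (N i)]

/-- The point of `C^b(A, d)` given by a complex of framed modules. -/
def CPoint.ofFrames (f : ∀ i, Frame R (N i) (d i)) (D : ∀ i, N i →ₗ[Alg R] N (i + 1))
    (hD : ∀ i m, D (i + 1) (D i m) = 0) : CPoint R d where
  x i := (f i).toRep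
  δ i v := (f i).mat (f (i + 1)) ((D i).restrictScalars ℂ) v v
  comm i s t a := by
    change _ * (f i).mat (f i) _ s t = (f (i + 1)).mat (f (i + 1)) _ s t * _
    rw [← Frame.mat_arrowElem_comp, ← Frame.mat_comp]
    · congr 1
      ext m
      exact map_smul (D i) _ _
    · intro k
      exact ((D i).map_smul _ _).symm.trans (congrArg (D i) ((f i).idem_smul_basis s k))
  sq i v := by
    rw [← Frame.mat_comp]
    · ext l k
      simp [Frame.mat, hD]
    · intro k
      exact ((D i).map_smul _ _).symm.trans (congrArg (D i) ((f i).idem_smul_basis v k))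

/-- The coordinates form an isomorphism of complexes onto `CPoint.ofFrames`. -/
lemma CPoint.ofFrames_diff (f : ∀ i, Frame R (N i) (d i)) (D : ∀ i, N i →ₗ[Alg R] N (i + 1))
    (hD : ∀ i m, D (i + 1) (D i m) = 0) (i : ℤ) (m : N i) :
    (CPoint.ofFrames f D hD).diff i ((f i).toRepEquiv.symm m) =
      (f (i + 1)).toRepEquiv.symm (D i m) := by
  have h : (gradedMap fun v => (f i).mat (f (i + 1)) ((D i).restrictScalars ℂ) v v) ∘ₗ
      (f i).coords.toLinearMap =
        (f (i + 1)).coords.toLinearMap ∘ₗ (D i).restrictScalars ℂ := by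
    refine (f i).basis.ext fun ⟨u, k⟩ => ?_
    refine funext fun w => funext fun l => ?_
    simp only [LinearMap.comp_apply, LinearEquiv.coe_coe, Frame.coords_basis]
    change Matrix.mulVec ((f i).mat (f (i + 1)) ((D i).restrictScalars ℂ) w w)
      (Pi.single (M := fun v => Fin (d i v) → ℂ) u (Pi.single k 1) w) l =
        (f (i + 1)).basis.repr (D i ((f i).basis ⟨u, k⟩)) ⟨w, l⟩
    by_cases hw : w = u
    · subst hw
      rw [Pi.single_eq_same, Matrix.mulVec_single_one]
      rfl
    · rw [Pi.single_eq_of_ne hw, Matrix.mulVec_zero, ← (f i).idem_smul_basis, map_smul,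
        Frame.repr_idem_smul, if_neg hw]
      rfl
  exact LinearMap.congr_fun h m

end FramedComplexes

/-! ### Polynomial maps between varieties of complexes -/

section Polynomial

variable {V : Type} [Fintype V] [DecidableEq V] [Quiver.{0} V] {R : AdmissibleRelations V}
variable {d d' : DimSeq V}

/-- A function on `C^b(A, d)` which is the restriction of a polynomial. -/
def IsPoly (u : CPoint R d → ℂ) : Prop :=
  ∃ g : MvPolynomial (Coord d) ℂ, ∀ X, u X = MvPolynomial.eval X.coord g

lemma isPoly_const (c : ℂ) : IsPoly fun _ : CPoint R d => c := ⟨.C c, fun _ => by simp⟩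

lemma isPoly_coord (c : Coord d) : IsPoly fun X : CPoint R d => X.coord c :=
  ⟨.X c, fun _ => by simp⟩

lemma IsPoly.add {u v : CPoint R d → ℂ} (hu : IsPoly u) (hv : IsPoly v) :
    IsPoly fun X => u X + v X := by
  obtain ⟨g, hg⟩ := hu
  obtain ⟨h, hh⟩ := hv
  exact ⟨g + h, fun X => by simp [hg, hh]⟩

lemma IsPoly.mul {u v : CPoint R d → ℂ} (hu : IsPoly u) (hv : IsPoly v) :
    IsPoly fun X => u X * v X := by
  obtain ⟨g, hg⟩ := hu
  obtain ⟨h, hh⟩ := hv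
  exact ⟨g * h, fun X => by simp [hg, hh]⟩

/-- A map between varieties of complexes which is the restriction of a polynomial map. -/
def IsPolyMorphism (f : CPoint R d → CPoint R d') : Prop :=
  ∀ c : Coord d', IsPoly fun X => (f X).coord c

lemma IsPoly.comp {u : CPoint R d' → ℂ} (hu : IsPoly u) {f : CPoint R d → CPoint R d'}
    (hf : IsPolyMorphism f) : IsPoly fun X => u (f X) := by
  obtain ⟨g, hg⟩ := hu
  choose p hp using hf
  refine ⟨MvPolynomial.bind₁ p g, fun X => ?_⟩
  change u (f X) = _
  rw [hg, ← MvPolynomial.coe_aeval_eq_eval, ← MvPolynomial.coe_aeval_eq_eval]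
  change MvPolynomial.aeval _ g = MvPolynomial.aeval _ (MvPolynomial.bind₁ p g)
  rw [MvPolynomial.aeval_bind₁]
  congr 2
  funext c
  exact hp c X

lemma IsPolyMorphism.comp {d'' : DimSeq V} {g : CPoint R d' → CPoint R d''}
    (hg : IsPolyMorphism g) {f : CPoint R d → CPoint R d'} (hf : IsPolyMorphism f) :
    IsPolyMorphism fun X => g (f X) :=
  fun c => (hg c).comp hf

lemma isPolyMorphism_id : IsPolyMorphism fun X : CPoint R d => X := isPoly_coord

variable {E E' : Type} [AddCommGroup E] [Module ℂ E] [AddCommGroup E'] [Module ℂ E']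

/-- A map from `C^b(A, d)` to a vector space all whose coordinates are polynomial. -/
def IsPolyMap (u : CPoint R d → E) : Prop :=
  ∀ l : Module.Dual ℂ E, IsPoly fun X => l (u X)

lemma isPolyMap_const (e : E) : IsPolyMap fun _ : CPoint R d => e := fun l => isPoly_const (l e)

lemma IsPolyMap.add {u v : CPoint R d → E} (hu : IsPolyMap u) (hv : IsPolyMap v) :
    IsPolyMap fun X => u X + v X := fun l => by
  simpa only [map_add] using (hu l).add (hv l)

lemma IsPolyMap.smul {c : CPoint R d → ℂ} {u : CPoint R d → E} (hc : IsPoly c)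
    (hu : IsPolyMap u) : IsPolyMap fun X => c X • u X := fun l => by
  simpa only [map_smul, smul_eq_mul] using hc.mul (hu l)

lemma IsPolyMap.map {u : CPoint R d → E} (hu : IsPolyMap u) (T : E →ₗ[ℂ] E') :
    IsPolyMap fun X => T (u X) := fun l => hu (l ∘ₗ T)

lemma IsPolyMap.neg {u : CPoint R d → E} (hu : IsPolyMap u) : IsPolyMap fun X => -u X :=
  hu.map (-LinearMap.id)

lemma IsPolyMap.sub {u v : CPoint R d → E} (hu : IsPolyMap u) (hv : IsPolyMap v) :
    IsPolyMap fun X => u X - v X := by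
  simpa only [sub_eq_add_neg] using hu.add hv.neg

lemma IsPolyMap.sum {ι : Type} (s : Finset ι) {u : ι → CPoint R d → E}
    (hu : ∀ i, IsPolyMap (u i)) : IsPolyMap fun X => ∑ i ∈ s, u i X := by
  classical
  induction s using Finset.induction_on with
  | empty => simpa using isPolyMap_const (0 : E)
  | insert i s hi ih => simpa only [Finset.sum_insert hi] using (hu i).add ih

/-- A map to a finite product is polynomial if all its components are. -/
lemma IsPolyMap.pi {ι : Type} [Fintype ι] {F : ι → Type} [∀ i, AddCommGroup (F i)]
    [∀ i, Module ℂ (F i)] {u : CPoint R d → ∀ i, F i} (hu : ∀ i, IsPolyMap fun X => u X i) :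
    IsPolyMap u := by
  classical
  have h := IsPolyMap.sum Finset.univ fun i => (hu i).map (LinearMap.single ℂ F i)
  have h' : (fun X => ∑ i, LinearMap.single ℂ F i (u X i)) = u :=
    funext fun X => Finset.univ_sum_single (u X)
  rwa [h'] at h

lemma IsPolyMap.prodMk {u : CPoint R d → E} {v : CPoint R d → E'} (hu : IsPolyMap u)
    (hv : IsPolyMap v) : IsPolyMap fun X => (u X, v X) := by
  simpa using (hu.map (LinearMap.inl ℂ E E')).add (hv.map (LinearMap.inr ℂ E E'))

lemma isPoly_x (i : ℤ) {s t : V} (a : s ⟶ t) (l : Fin (d i t)) (k : Fin (d i s)) :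
    IsPoly fun X : CPoint R d => (X.x i).1 a l k :=
  isPoly_coord (.inl ⟨i, s, t, a, l, k⟩)

lemma isPoly_δ (i : ℤ) (v : V) (l : Fin (d (i + 1) v)) (k : Fin (d i v)) :
    IsPoly fun X : CPoint R d => X.δ i v l k :=
  isPoly_coord (.inr ⟨i, v, l, k⟩)

/-- The action of a fixed element of `A` on the terms of a complex depends polynomially on the
complex. -/
lemma IsPolyMap.act (i : ℤ) (a : Alg R) {u : CPoint R d → GradedSpace (d i)}
    (hu : IsPolyMap u) : IsPolyMap fun X => QuiverComplexes.act (X.x i) a (u X) := by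
  obtain ⟨b, rfl⟩ := toAlg_surjective R a
  simp only [act_toAlg]
  induction b using FreeAlgebra.induction generalizing u with
  | grade0 c =>
    simp only [AlgHom.commutes, Module.algebraMap_end_apply]
    exact hu.map (c • LinearMap.id)
  | grade1 g =>
    simp only [FreeAlgebra.lift_ι_apply]
    rcases g with v | ⟨s, t, a⟩
    · exact hu.map (block v v 1)
    · simp only [genAct, block_apply]
      refine IsPolyMap.map (T := LinearMap.single ℂ (fun v => Fin (d i v) → ℂ) t)
        (IsPolyMap.pi fun l => ?_)
      simp only [Matrix.mulVec, dotProduct]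
      exact IsPolyMap.sum _ fun k => IsPolyMap.smul (isPoly_x i a l k)
        (hu.map ((LinearMap.proj k : (Fin (d i s) → ℂ) →ₗ[ℂ] ℂ) ∘ₗ
          (LinearMap.proj s : GradedSpace (d i) →ₗ[ℂ] (Fin (d i s) → ℂ))))
  | mul a b ha hb =>
    simp only [map_mul, Module.End.mul_apply]
    exact ha (hb hu)
  | add a b ha hb =>
    simp only [map_add, LinearMap.add_apply]
    exact (ha hu).add (hb hu)

end Polynomial

/-! ### Projective modules and syzygies -/

section Projectives

variable {V : Type} [Fintype V] [DecidableEq V] [Quiver.{0} V] (R : AdmissibleRelations V)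

/-- The module `P_v`, as a type of its own rather than as a left ideal. -/
def ProjMod (v : V) : Type := indecProj R v

instance (v : V) : AddCommGroup (ProjMod R v) :=
  inferInstanceAs (AddCommGroup (Ideal.span {idem R v} : Ideal (Alg R)))

instance (v : V) : Module (Alg R) (ProjMod R v) :=
  inferInstanceAs (Module (Alg R) (Ideal.span {idem R v} : Ideal (Alg R)))

instance (v : V) : Module ℂ (ProjMod R v) := Module.compHom _ (algebraMap ℂ (Alg R))

instance (v : V) : IsScalarTower ℂ (Alg R) (ProjMod R v) :=
  ⟨fun c a x => by
    rw [Algebra.smul_def, mul_smul]; rfl⟩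

/-- The inclusion of `P_v = A e_v` into `A`. -/
def ProjMod.val (v : V) : ProjMod R v →ₗ[Alg R] Alg R :=
  Submodule.subtype (Ideal.span {idem R v} : Ideal (Alg R))

variable {R} in
lemma ProjMod.val_injective (v : V) : Function.Injective (ProjMod.val R v) :=
  Subtype.val_injective

/-- The generator `e_v` of `P_v`. -/
def projGen (v : V) : ProjMod R v := (⟨idem R v, Ideal.subset_span rfl⟩ : indecProj R v)

@[simp] lemma val_projGen (v : V) : ProjMod.val R v (projGen R v) = idem R v := rfl

variable {R} in
lemma val_mul_idem {v : V} (a : ProjMod R v) :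
    ProjMod.val R v a * idem R v = ProjMod.val R v a := by
  obtain ⟨a, ha⟩ := a
  obtain ⟨b, rfl⟩ := Ideal.mem_span_singleton'.1 ha
  change b * idem R v * idem R v = b * idem R v
  rw [mul_assoc, idem_mul_self]

variable {R} in
lemma val_smul_projGen {v : V} (a : ProjMod R v) : ProjMod.val R v a • projGen R v = a :=
  ProjMod.val_injective v (by rw [map_smul, val_projGen, smul_eq_mul, val_mul_idem])

lemma idem_smul_projGen (v : V) : idem R v • projGen R v = projGen R v :=
  val_smul_projGen (projGen R v)

lemma idem_smul_projGen_of_ne {v w : V} (h : v ≠ w) : idem R v • projGen R w = 0 :=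
  ProjMod.val_injective w (by
    rw [map_smul, val_projGen, smul_eq_mul, idem_mul_of_ne R h, map_zero])

/-- The augmentation `P_v → ℂ`, which is the projection of `P_v` onto its simple top. -/
def augProj (v : V) : ProjMod R v →ₗ[ℂ] ℂ :=
  (aug R v).toLinearMap ∘ₗ (ProjMod.val R v).restrictScalars ℂ

lemma augProj_apply {v : V} (a : ProjMod R v) : augProj R v a = aug R v (ProjMod.val R v a) := rfl

lemma augProj_smul {v : V} (b : Alg R) (a : ProjMod R v) :
    augProj R v (b • a) = aug R v b * augProj R v a := by
  rw [augProj_apply, map_smul, smul_eq_mul, map_mul]; rfl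

@[simp] lemma augProj_projGen (v : V) : augProj R v (projGen R v) = 1 := by
  rw [augProj_apply, val_projGen, aug_idem, if_pos rfl]

/-- The radical of `P_v`. -/
def radProj (v : V) : Submodule (Alg R) (ProjMod R v) where
  carrier := {a | augProj R v a = 0}
  add_mem' {a b} ha hb := by
    rw [Set.mem_ofPred_eq] at *
    rw [map_add, ha, hb, add_zero]
  zero_mem' := map_zero _
  smul_mem' b a ha := by
    rw [Set.mem_ofPred_eq] at *
    rw [augProj_smul, ha, mul_zero]

lemma mem_radProj {v : V} {a : ProjMod R v} : a ∈ radProj R v ↔ augProj R v a = 0 := Iff.rfl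

instance finiteDimensional_projMod [∀ s t : V, Finite (s ⟶ t)] (v : V) :
    Module.Finite ℂ (ProjMod R v) :=
  Module.Finite.of_injective ((ProjMod.val R v).restrictScalars ℂ)
    (ProjMod.val_injective v)

instance finiteDimensional_radProj [∀ s t : V, Finite (s ⟶ t)] (v : V) :
    Module.Finite ℂ (radProj R v) :=
  Module.Finite.of_injective ((radProj R v).subtype.restrictScalars ℂ) Subtype.val_injective

lemma dimAt_projMod (v w : V) : dimAt R (ProjMod R v) w = dimIndecProj R v w := by
  let j := (ProjMod.val R v).restrictScalars ℂ
  have h : (LinearMap.range (lact R (ProjMod R v) (idem R w))).map j =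
      LinearMap.range (LinearMap.mulLeftRight ℂ (idem R w, idem R v)) := by
    ext y
    constructor
    · rintro ⟨_, ⟨a, rfl⟩, rfl⟩
      refine ⟨ProjMod.val R v a, ?_⟩
      rw [LinearMap.mulLeftRight_apply, mul_assoc, val_mul_idem]
      exact (map_smul (ProjMod.val R v) _ _).symm
    · rintro ⟨a, rfl⟩
      refine ⟨_, ⟨a • projGen R v, rfl⟩, ?_⟩
      rw [LinearMap.mulLeftRight_apply, mul_assoc]
      change ProjMod.val R v (idem R w • a • projGen R v) = _
      rw [map_smul, map_smul]; rfl
  rw [dimAt, dimIndecProj, ← h]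
  exact (Submodule.equivMapOfInjective j (ProjMod.val_injective v) _).finrank_eq

/-- The top of `P_v` is one-dimensional and concentrated at `v`. -/
lemma dimAt_projMod_eq_add [∀ s t : V, Finite (s ⟶ t)] (v w : V) :
    dimAt R (ProjMod R v) w = dimAt R (radProj R v) w + if w = v then 1 else 0 := by
  let q := (augProj R v).domRestrict (LinearMap.range (lact R (ProjMod R v) (idem R w)))
  let j := (radProj R v).subtype.restrictScalars ℂ
  have h1 : Module.finrank ℂ _ + Module.finrank ℂ _ = Module.finrank ℂ _ :=
    LinearMap.finrank_range_add_finrank_ker q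
  have h2 : (LinearMap.ker q).map (Submodule.subtype _) =
      (LinearMap.range (lact R (radProj R v) (idem R w))).map j := by
    ext y
    constructor
    · rintro ⟨⟨_, a, rfl⟩, ha, rfl⟩
      have ha' : idem R w • a ∈ radProj R v := ha
      exact ⟨⟨_, ha'⟩, ⟨⟨_, ha'⟩, Subtype.ext (idem_smul_idem_smul R w a)⟩, rfl⟩
    · rintro ⟨_, ⟨a, rfl⟩, rfl⟩
      exact ⟨⟨_, a.1, rfl⟩, (idem R w • a).2, rfl⟩
  have h3 : Module.finrank ℂ (LinearMap.ker q) = dimAt R (radProj R v) w := by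
    rw [(Submodule.equivMapOfInjective _ (Submodule.injective_subtype _) _).finrank_eq, h2]
    exact (Submodule.equivMapOfInjective j Subtype.val_injective _).symm.finrank_eq
  have h4 : Module.finrank ℂ (LinearMap.range q) = if w = v then 1 else 0 := by
    split_ifs with h
    · subst h
      have : LinearMap.range q = ⊤ := by
        refine LinearMap.range_eq_top.2 fun c =>
          ⟨⟨c • projGen R w, c • projGen R w, ?_⟩, ?_⟩
        · rw [lact_apply, smul_comm, idem_smul_projGen]
        · change augProj R w (c • projGen R w) = c
          simp
      rw [this, finrank_top, Module.finrank_self]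
    · have : LinearMap.range q = ⊥ := by
        refine LinearMap.range_eq_bot.2 (LinearMap.ext ?_)
        rintro ⟨_, a, rfl⟩
        change augProj R v (idem R w • a) = 0
        rw [augProj_smul, aug_idem, if_neg h, zero_mul]
      rw [this, finrank_bot]
  rw [dimAt, ← h1, h3, h4, add_comm]

/-- The projective module `⊕_v P_v^{m v}`, as an iterated product. -/
abbrev FreeOn (m : V → ℕ) : Type := ∀ v : V, Fin (m v) → ProjMod R v

/-- The radical of `⊕_v P_v^{m v}`. -/
abbrev RadOn (m : V → ℕ) : Type := ∀ v : V, Fin (m v) → radProj R v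

/-- The dimension vector of `⊕_v P_v^{m v}`. -/
def freeDim (m : V → ℕ) (w : V) : ℕ := ∑ v : V, m v * dimIndecProj R v w

/-- The dimension vector of the radical of `⊕_v P_v^{m v}`. -/
def radDim (m : V → ℕ) (w : V) : ℕ := ∑ v : V, m v * dimAt R (radProj R v) w

lemma dimAt_freeOn [∀ s t : V, Finite (s ⟶ t)] (m : V → ℕ) (w : V) :
    dimAt R (FreeOn R m) w = freeDim R m w := by
  simp [FreeOn, dimAt_pi, freeDim, dimAt_projMod]

lemma dimAt_radOn [∀ s t : V, Finite (s ⟶ t)] (m : V → ℕ) (w : V) :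
    dimAt R (RadOn R m) w = radDim R m w := by
  simp [RadOn, dimAt_pi, radDim]

lemma freeDim_eq [∀ s t : V, Finite (s ⟶ t)] (m : V → ℕ) :
    freeDim R m = radDim R m + m := by
  funext w
  simp [freeDim, radDim, ← dimAt_projMod, dimAt_projMod_eq_add, mul_add,
    Finset.sum_add_distrib]

variable {R} {m m' m'' : V → ℕ}

/-- The inclusion of the radical of `⊕_v P_v^{m v}`. -/
def radIncl : RadOn R m →ₗ[Alg R] FreeOn R m where
  toFun z v k := (z v k).1
  map_add' _ _ := rfl
  map_smul' _ _ := rfl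

/-- The `ℂ`-linear projection of `⊕_v P_v^{m v}` onto its radical which kills the generators
`e_v`. -/
def radPart : FreeOn R m →ₗ[ℂ] RadOn R m where
  toFun f v k := ⟨f v k - augProj R v (f v k) • projGen R v, by simp [mem_radProj]⟩
  map_add' f g := funext fun v => funext fun k => Subtype.ext <| by
    change (f v k + g v k) - augProj R v (f v k + g v k) • projGen R v =
      (f v k - augProj R v (f v k) • projGen R v) + (g v k - augProj R v (g v k) • projGen R v)
    rw [map_add, add_smul]; abel
  map_smul' c f := funext fun v => funext fun k => Subtype.ext <| by
    change c • f v k - augProj R v (c • f v k) • projGen R v =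
      c • (f v k - augProj R v (f v k) • projGen R v)
    rw [map_smul, smul_sub, smul_eq_mul, mul_smul]

/-- The augmentation of `⊕_v P_v^{m v}`. -/
def augFree : FreeOn R m →ₗ[ℂ] GradedSpace m where
  toFun f v k := augProj R v (f v k)
  map_add' _ _ := funext fun _ => funext fun _ => map_add _ _ _
  map_smul' _ _ := funext fun v => funext fun _ => map_smul (augProj R v) _ _

/-- The `ℂ`-linear section `ℂ^m → ⊕_v P_v^{m v}` with image the span of the generators `e_v`. -/
def genMap : GradedSpace m →ₗ[ℂ] FreeOn R m where
  toFun c v k := c v k • projGen R v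
  map_add' _ _ := funext fun _ => funext fun _ => add_smul _ _ _
  map_smul' _ _ := funext fun _ => funext fun _ => mul_smul _ _ _

lemma radPart_radIncl (z : RadOn R m) : radPart (radIncl z) = z := by
  refine funext fun v => funext fun k => Subtype.ext ?_
  change (z v k).1 - augProj R v (z v k).1 • projGen R v = (z v k).1
  rw [(mem_radProj R).1 (z v k).2, zero_smul, sub_zero]

lemma radPart_genMap (c : GradedSpace m) : radPart (genMap c : FreeOn R m) = 0 := by
  refine funext fun v => funext fun k => Subtype.ext ?_
  change c v k • projGen R v - augProj R v (c v k • projGen R v) • projGen R v = 0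
  rw [map_smul, augProj_projGen, smul_eq_mul, mul_one, sub_self]

lemma radIncl_radPart (f : FreeOn R m) : radIncl (radPart f) = f - genMap (augFree f) :=
  funext fun _ => funext fun _ => rfl

lemma idem_smul_genMap (u : V) (c : GradedSpace m) :
    idem R u • (genMap c : FreeOn R m) = genMap (block u u 1 c) := by
  refine funext fun v => funext fun k => ?_
  change idem R u • c v k • projGen R v = block u u 1 c v k • projGen R v
  rw [smul_comm, block_apply, Matrix.one_mulVec]
  by_cases h : v = u
  · subst h; rw [idem_smul_projGen, Pi.single_eq_same]
  · rw [idem_smul_projGen_of_ne R (Ne.symm h), smul_zero, Pi.single_eq_of_ne h, Pi.zero_apply,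
      zero_smul]

/-- The homomorphism `⊕_v P_v^{m v} → M` which sends the generator `e_v` of the
`k`-th copy of `P_v` to `e_v x_{v,k}`. -/
def freeLift {M : Type} [AddCommGroup M] [Module (Alg R) M] (x : ∀ v, Fin (m v) → M) :
    FreeOn R m →ₗ[Alg R] M where
  toFun f := ∑ v, ∑ k, ProjMod.val R v (f v k) • x v k
  map_add' f g := by
    simp only [← Finset.sum_add_distrib]
    refine Finset.sum_congr rfl fun v _ => Finset.sum_congr rfl fun k _ => ?_
    rw [Pi.add_apply, Pi.add_apply, map_add, add_smul]
  map_smul' a f := by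
    simp only [Finset.smul_sum, RingHom.id_apply]
    refine Finset.sum_congr rfl fun v _ => Finset.sum_congr rfl fun k _ => ?_
    rw [Pi.smul_apply, Pi.smul_apply, map_smul, smul_eq_mul, mul_smul]

lemma freeLift_apply {M : Type} [AddCommGroup M] [Module (Alg R) M] (x : ∀ v, Fin (m v) → M)
    (f : FreeOn R m) :
    freeLift x f = ∑ v, ∑ k, ProjMod.val R v (f v k) • x v k := rfl

/-- The homomorphism `⊕_v P_v^{m v} → M(x)` which sends the generators to the standard basis. -/
def coverMap (x : Rep R m) : FreeOn R m →ₗ[Alg R] x.Mod :=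
  freeLift fun v k => x.frame.basis ⟨v, k⟩

lemma coverMap_apply (x : Rep R m) (f : FreeOn R m) :
    coverMap x f = ∑ v, ∑ k, ProjMod.val R v (f v k) • x.frame.basis ⟨v, k⟩ := rfl

lemma coverMap_genMap (x : Rep R m) (c : GradedSpace m) :
    coverMap x (genMap c) = (c : x.Mod) := by
  have h := x.frame.basis.sum_repr c
  rw [Fintype.sum_sigma] at h
  rw [coverMap_apply]
  refine Eq.trans (Finset.sum_congr rfl fun v _ => Finset.sum_congr rfl fun k _ => ?_) h
  have h1 : x.frame.basis.repr (c : x.Mod) ⟨v, k⟩ = c v k :=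
    congrFun (congrFun (x.frame_coords c) v) k
  rw [h1]
  change ProjMod.val R v (c v k • projGen R v) • x.frame.basis ⟨v, k⟩ = _
  rw [(ProjMod.val R v).map_smul_of_tower, val_projGen, smul_assoc, x.frame.idem_smul_basis]

lemma coverMap_surjective (x : Rep R m) : Function.Surjective (coverMap x) :=
  fun c => ⟨genMap (c : GradedSpace m), coverMap_genMap x c⟩

/-- The kernel of `⊕_v P_v^{m v} → M(x)`. -/
abbrev syzygy (x : Rep R m) : Submodule (Alg R) (FreeOn R m) := LinearMap.ker (coverMap x)

/-- The element of the syzygy of `M(x)` with a given radical part. -/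
def syzygyLift (x : Rep R m) (z : RadOn R m) : syzygy x :=
  ⟨radIncl z - genMap (coverMap x (radIncl z) : GradedSpace m), by
    rw [LinearMap.mem_ker, map_sub]
    exact sub_eq_zero.2 (coverMap_genMap x (coverMap x (radIncl z))).symm⟩

/-- Since the image of `⊕_v P_v^{m v} → M(x)` is already attained on the span of the generators, the
syzygy is identified with the radical of `⊕_v P_v^{m v}` as a vector space. -/
def syzygyEquiv (x : Rep R m) : syzygy x ≃ₗ[ℂ] RadOn R m where
  toFun y := radPart y.1
  map_add' _ _ := map_add _ _ _
  map_smul' _ _ := map_smul _ _ _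
  invFun := syzygyLift x
  left_inv y := by
    refine Subtype.ext ?_
    change radIncl (radPart y.1) - genMap (coverMap x (radIncl (radPart y.1)) : GradedSpace m) = y.1
    have h : coverMap x y.1 = 0 := y.2
    have h2 : (coverMap x (radIncl (radPart y.1)) : GradedSpace m) = -augFree y.1 := by
      rw [radIncl_radPart]
      refine (map_sub (coverMap x) _ _).trans ?_
      rw [h, coverMap_genMap]
      exact zero_sub (augFree y.1)
    rw [h2, radIncl_radPart, map_neg, sub_neg_eq_add, sub_add_cancel]
  right_inv z := by
    change radPart (radIncl z - genMap _) = z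
    rw [map_sub, radPart_radIncl, sub_eq_self]
    exact radPart_genMap _

lemma idem_smul_syzygyLift (x : Rep R m) (u : V) (z : RadOn R m) :
    idem R u • syzygyLift x z = syzygyLift x (idem R u • z) := by
  refine Subtype.ext ?_
  change idem R u • (radIncl z - genMap (coverMap x (radIncl z) : GradedSpace m)) =
    radIncl (idem R u • z) - genMap (coverMap x (radIncl (idem R u • z)) : GradedSpace m)
  have h : act x (idem R u) = block u u 1 := by
    rw [idem, act_toAlg, FreeAlgebra.lift_ι_apply]; rfl
  rw [smul_sub, map_smul, map_smul, smul_def, h]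
  exact congrArg _ (idem_smul_genMap u _)

/-- The homomorphism `⊕_v P_v^{m v} → ⊕_v P_v^{m' v}` given by scalar matrices. -/
def freeMap (δ : ∀ v, Matrix (Fin (m' v)) (Fin (m v)) ℂ) : FreeOn R m →ₗ[Alg R] FreeOn R m' where
  toFun f v l := ∑ k, δ v l k • f v k
  map_add' f g := funext fun v => funext fun l => by
    simp only [Pi.add_apply, smul_add, Finset.sum_add_distrib]
  map_smul' a f := funext fun v => funext fun l => by
    simp only [Pi.smul_apply, RingHom.id_apply, Finset.smul_sum, smul_comm a]

lemma freeMap_freeMap (δ' : ∀ v, Matrix (Fin (m'' v)) (Fin (m' v)) ℂ)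
    (δ : ∀ v, Matrix (Fin (m' v)) (Fin (m v)) ℂ) (f : FreeOn R m) :
    freeMap δ' (freeMap δ f) = freeMap (fun v => δ' v * δ v) f := by
  refine funext fun v => funext fun l => ?_
  change ∑ j, δ' v l j • ∑ k, δ v j k • f v k = ∑ k, (δ' v * δ v) l k • f v k
  simp only [Matrix.mul_apply, Finset.sum_smul, Finset.smul_sum, mul_smul]
  rw [Finset.sum_comm]

lemma coverMap_freeMap (x : Rep R m) (y : Rep R m') (δ : ∀ v, Matrix (Fin (m' v)) (Fin (m v)) ℂ)
    (h : ∀ {s t : V} (a : s ⟶ t), δ t * x.1 a = y.1 a * δ s) (f : FreeOn R m) :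
    coverMap y (freeMap δ f) = x.hom y δ h (coverMap x f) := by
  have hb : ∀ v k, x.hom y δ h (x.frame.basis ⟨v, k⟩) = ∑ l, δ v l k • y.frame.basis ⟨v, l⟩ := by
    intro v k
    have h1 : idem R v • x.hom y δ h (x.frame.basis ⟨v, k⟩) =
        x.hom y δ h (x.frame.basis ⟨v, k⟩) := by
      rw [← map_smul, x.frame.idem_smul_basis]
    rw [y.frame.eq_sum_of_idem_smul h1]
    refine Finset.sum_congr rfl fun l _ => ?_
    congr 1
    have h2 : x.frame.basis ⟨v, k⟩ = (Pi.single v (Pi.single k 1) : GradedSpace m) := by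
      rw [← x.frame.coords_basis, x.frame_coords]
    refine (congrFun (congrFun (y.frame_coords (x.hom y δ h (x.frame.basis ⟨v, k⟩))) v) l).trans ?_
    rw [h2]
    change Matrix.mulVec (δ v) ((Pi.single v (Pi.single k 1) : GradedSpace m) v) l = _
    rw [Pi.single_eq_same, Matrix.mulVec_single_one]; rfl
  rw [coverMap_apply, coverMap_apply, map_sum]
  refine Finset.sum_congr rfl fun v _ => ?_
  rw [map_sum]
  have h3 : ∀ l, ProjMod.val R v (freeMap δ f v l) • y.frame.basis ⟨v, l⟩ =
      ∑ k, ProjMod.val R v (f v k) • δ v l k • y.frame.basis ⟨v, l⟩ := by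
    intro l
    have h4 : ProjMod.val R v (freeMap δ f v l) = ∑ k, δ v l k • ProjMod.val R v (f v k) :=
      (map_sum (ProjMod.val R v) _ _).trans
        (Finset.sum_congr rfl fun k _ => (ProjMod.val R v).map_smul_of_tower _ _)
    rw [h4, Finset.sum_smul]
    exact Finset.sum_congr rfl fun k _ => by rw [smul_assoc, smul_comm]
  simp only [h3, map_smul, hb, Finset.smul_sum]
  exact Finset.sum_comm

end Projectives

/-! ### The cone of the inclusion of the syzygy -/

section Resolution

variable {V : Type} [Fintype V] [DecidableEq V] [Quiver.{0} V]
variable (R : AdmissibleRelations V)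

/-- The shift `d ↦ (i ↦ d (i + 1))` of a dimension vector sequence. -/
def shiftSeq (d : DimSeq V) : DimSeq V := Finsupp.equivMapDomain (Equiv.subRight 1) d

@[simp] lemma shiftSeq_apply (d : DimSeq V) (i : ℤ) : shiftSeq d i = d (i + 1) := rfl

lemma shiftSeq_add (d d' : DimSeq V) : shiftSeq (d + d') = shiftSeq d + shiftSeq d' := by
  ext; simp

/-- The dimension vector sequence of the radicals of the projective modules with multiplicities
`d`. -/
def radSeq (d : DimSeq V) : DimSeq V := d.mapRange (radDim R) (by ext; simp [radDim])

@[simp] lemma radSeq_apply (d : DimSeq V) (i : ℤ) : radSeq R d i = radDim R (d i) := rfl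

lemma projDim_apply (d : DimSeq V) (i : ℤ) : projDim R d i = freeDim R (d i) := rfl

lemma projDim_eq_add [∀ s t : V, Finite (s ⟶ t)] (d : DimSeq V) :
    projDim R d = radSeq R d + d := by
  ext i v
  rw [projDim_apply, freeDim_eq]; rfl

/-- The dimension vector sequence of the cone of `Ω X → F X`, for `X` in `C^b(A, d)`. -/
def coneSeq (d : DimSeq V) : DimSeq V := shiftSeq (radSeq R d) + projDim R d

variable {R} {d : DimSeq V} (X : CPoint R d)

/-- The map `Ω X^i → Ω X^{i+1}` induced by the differential of `X`. -/
def syzygyMap (i : ℤ) : syzygy (X.x i) →ₗ[Alg R] syzygy (X.x (i + 1)) :=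
  (freeMap (X.δ i)).restrict fun y hy => by
    rw [LinearMap.mem_ker] at hy ⊢
    rw [coverMap_freeMap (X.x i) (X.x (i + 1)) (X.δ i) (X.comm i), hy, map_zero]

/-- The term in degree `i` of the cone of `Ω X → F X`. -/
abbrev ConeTerm (i : ℤ) : Type := syzygy (X.x (i + 1)) × FreeOn R (d i)

/-- The differential `(y, z) ↦ (-d y, y + d z)` of the cone of `Ω X → F X`. -/
def coneDiff (i : ℤ) : ConeTerm X i →ₗ[Alg R] ConeTerm X (i + 1) :=
  ((-syzygyMap X (i + 1)) ∘ₗ LinearMap.fst _ _ _).prod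
    ((syzygy (X.x (i + 1))).subtype ∘ₗ LinearMap.fst _ _ _ +
      freeMap (X.δ i) ∘ₗ LinearMap.snd _ _ _)

lemma coneDiff_fst (i : ℤ) (m : ConeTerm X i) :
    (coneDiff X i m).1.1 = -freeMap (X.δ (i + 1)) m.1.1 := rfl

lemma coneDiff_snd (i : ℤ) (m : ConeTerm X i) :
    (coneDiff X i m).2 = m.1.1 + freeMap (X.δ i) m.2 := rfl

lemma freeMap_δ_freeMap_δ (i : ℤ) (f : FreeOn R (d i)) :
    freeMap (X.δ (i + 1)) (freeMap (X.δ i) f) = 0 := by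
  rw [freeMap_freeMap]
  refine funext fun v => funext fun l => ?_
  change ∑ k, (X.δ (i + 1) v * X.δ i v) l k • f v k = 0
  simp [X.sq]

lemma coneDiff_coneDiff (i : ℤ) (m : ConeTerm X i) : coneDiff X (i + 1) (coneDiff X i m) = 0 := by
  refine Prod.ext (Subtype.ext ?_) ?_
  · rw [coneDiff_fst, coneDiff_fst, map_neg, freeMap_δ_freeMap_δ]; simp
  · have h := (freeMap (R := R) (X.δ (i + 1))).map_add m.1.1 (freeMap (X.δ i) m.2)
    rw [freeMap_δ_freeMap_δ, add_zero] at h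
    change -freeMap (X.δ (i + 1)) m.1.1 +
      freeMap (X.δ (i + 1)) (m.1.1 + freeMap (X.δ i) m.2) = (0 : FreeOn R (d (i + 1 + 1)))
    rw [h, neg_add_cancel]

variable (R d) in
/-- A space which does not depend on `X` and serves as coordinates for the terms of the cone. -/
abbrev ConeModel (i : ℤ) : Type := RadOn R (d (i + 1)) × FreeOn R (d i)

/-- The identification of the terms of the cone with a space which does not depend on `X`. -/
def coneEquiv (i : ℤ) : ConeTerm X i ≃ₗ[ℂ] ConeModel R d i :=
  (syzygyEquiv (X.x (i + 1))).prodCongr (LinearEquiv.refl ℂ _)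

lemma coneEquiv_symm_apply (i : ℤ) (e : ConeModel R d i) :
    (coneEquiv X i).symm e = (syzygyLift (X.x (i + 1)) e.1, e.2) := rfl

variable [∀ s t : V, Finite (s ⟶ t)]

variable (R d) in
lemma dimAt_coneModel (i : ℤ) (w : V) : dimAt R (ConeModel R d i) w = coneSeq R d i w := by
  refine (dimAt_prod R w).trans ?_
  rw [dimAt_radOn, dimAt_freeOn]; rfl

variable (R d) in
/-- A frame of the model of the terms of the cone. -/
def coneModelFrame (i : ℤ) : Frame R (ConeModel R d i) (coneSeq R d i) :=
  (exists_frame (dimAt_coneModel R d i)).some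

/-- The frame of a term of the cone transported from the model. The identification with the model is
not a homomorphism of `A`-modules, but it commutes with the idempotents. -/
def coneFrame (i : ℤ) : Frame R (ConeTerm X i) (coneSeq R d i) where
  basis := (coneModelFrame R d i).basis.map (coneEquiv X i).symm
  idem_smul_basis v k := by
    rw [Module.Basis.map_apply, coneEquiv_symm_apply]
    have h := (coneModelFrame R d i).idem_smul_basis v k
    have h₁ := congrArg Prod.fst h
    have h₂ := congrArg Prod.snd h
    refine Prod.ext ?_ h₂
    change idem R v • syzygyLift _ _ = syzygyLift _ _
    rw [idem_smul_syzygyLift]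
    exact congrArg (syzygyLift _) h₁

/-- The complex `cone(Ω X → F X)`, where `F X → X` is the standard surjection from a complex of
projective modules and `Ω X` is its kernel. -/
def resolve : CPoint R (coneSeq R d) :=
  CPoint.ofFrames (coneFrame X) (coneDiff X) (coneDiff_coneDiff X)

/-- The terms of `resolve X` are those of the cone. -/
def resolveEquiv (i : ℤ) : ((resolve X).x i).Mod ≃ₗ[Alg R] ConeTerm X i :=
  (coneFrame X i).toRepEquiv

lemma resolveEquiv_diff (i : ℤ) (m : ((resolve X).x i).Mod) :
    resolveEquiv X (i + 1) ((resolve X).diff i m) = coneDiff X i (resolveEquiv X i m) := by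
  rw [← LinearEquiv.eq_symm_apply]
  have h := CPoint.ofFrames_diff (coneFrame X) (coneDiff X) (coneDiff_coneDiff X) i
    (resolveEquiv X i m)
  exact (congrArg ((resolve X).diff i) ((resolveEquiv X i).symm_apply_apply m).symm).trans h

end Resolution

/-! ### Polynomial dependence of the cone -/

section PolynomialResolution

variable {V : Type} [Fintype V] [DecidableEq V] [Quiver.{0} V]
variable {R : AdmissibleRelations V} {d : DimSeq V}

lemma isPolyMap_coverMap (i : ℤ) (f : FreeOn R (d i)) :
    IsPolyMap (E := GradedSpace (d i)) fun X : CPoint R d => coverMap (X.x i) f := by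
  have h : ∀ X : CPoint R d, (coverMap (X.x i) f : GradedSpace (d i)) =
      ∑ v, ∑ k, act (X.x i) (ProjMod.val R v (f v k)) (Pi.single v (Pi.single k 1)) := by
    intro X
    refine Finset.sum_congr rfl fun v _ => Finset.sum_congr rfl fun k _ => ?_
    rw [smul_def]
    refine congrArg _ ?_
    rw [← (X.x i).frame.coords_basis]
    exact ((X.x i).frame_coords _).symm
  have h' := IsPolyMap.sum Finset.univ fun v => IsPolyMap.sum Finset.univ fun k =>
    (isPolyMap_const (R := R) (d := d) (Pi.single v (Pi.single k 1) : GradedSpace (d i))).act i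
      (ProjMod.val R v (f v k))
  rwa [← funext h] at h'

lemma IsPolyMap.freeMap (i : ℤ) {u : CPoint R d → FreeOn R (d i)} (hu : IsPolyMap u) :
    IsPolyMap fun X => QuiverComplexes.freeMap (R := R) (X.δ i) (u X) := by
  refine IsPolyMap.pi fun v => IsPolyMap.pi fun l => ?_
  exact IsPolyMap.sum Finset.univ fun k => IsPolyMap.smul (isPoly_δ i v l k)
    (hu.map ((LinearMap.proj k : (Fin (d i v) → ProjMod R v) →ₗ[ℂ] ProjMod R v) ∘ₗ
      (LinearMap.proj v : FreeOn R (d i) →ₗ[ℂ] (Fin (d i v) → ProjMod R v))))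

lemma isPolyMap_syzygyLift (i : ℤ) (z : RadOn R (d i)) :
    IsPolyMap fun X : CPoint R d => (syzygyLift (X.x i) z).1 :=
  (isPolyMap_const _).sub ((isPolyMap_coverMap i (radIncl z)).map genMap)

variable [∀ s t : V, Finite (s ⟶ t)]

/-- In the coordinates given by the vector space isomorphism of the syzygy with the radical, the
complex `cone(Ω X → F X)` depends polynomially on `X`. -/
lemma isPolyMorphism_resolve : IsPolyMorphism fun X : CPoint R d => resolve X := by
  rintro (⟨i, s, t, a, l, k⟩ | ⟨i, v, l, k⟩)
  · let b := (coneModelFrame R d i).basis ⟨s, k⟩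
    have h : IsPolyMap (E := ConeModel R d i) fun X : CPoint R d =>
        (radPart (arrowElem R a • (syzygyLift (X.x (i + 1)) b.1).1), arrowElem R a • b.2) :=
      (((isPolyMap_syzygyLift (i + 1) b.1).map (lact R _ (arrowElem R a))).map radPart).prodMk
        (isPolyMap_const _)
    exact h ((coneModelFrame R d i).basis.coord ⟨t, l⟩)
  · let b := (coneModelFrame R d i).basis ⟨v, k⟩
    have h : IsPolyMap (E := ConeModel R d (i + 1)) fun X : CPoint R d =>
        (radPart (-freeMap (X.δ (i + 1)) (syzygyLift (X.x (i + 1)) b.1).1),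
          (syzygyLift (X.x (i + 1)) b.1).1 + freeMap (X.δ i) b.2) :=
      (((isPolyMap_syzygyLift (i + 1) b.1).freeMap (i + 1)).neg.map radPart).prodMk
        ((isPolyMap_syzygyLift (i + 1) b.1).add ((isPolyMap_const b.2).freeMap i))
    exact h ((coneModelFrame R d (i + 1)).basis.coord ⟨v, l⟩)

end PolynomialResolution

/-! ### Quasi-isomorphisms of complexes of modules -/

section QuasiIsomorphisms

variable {V : Type} [Fintype V] [Quiver.{0} V] {R : AdmissibleRelations V}

/-- Complexes of `A`-modules. -/
abbrev Cx (R : AdmissibleRelations V) : Type 1 := CochainComplex (ModuleCat.{0} (Alg R)) ℤ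

lemma exactAt_succ_iff (K : Cx R) (i : ℤ) : K.ExactAt (i + 1) ↔
    ∀ y : K.X (i + 1), K.d (i + 1) (i + 1 + 1) y = 0 → ∃ z : K.X i, K.d i (i + 1) z = y := by
  rw [K.exactAt_iff' i (i + 1) (i + 1 + 1) (by simp) (by simp), ShortComplex.moduleCat_exact_iff]
  rfl

lemma acyclic_iff_forall (K : Cx R) : K.Acyclic ↔ ∀ (i : ℤ) (y : K.X (i + 1)),
    K.d (i + 1) (i + 1 + 1) y = 0 → ∃ z : K.X i, K.d i (i + 1) z = y := by
  refine ⟨fun h i => (exactAt_succ_iff K i).1 (h _), fun h i => ?_⟩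
  obtain ⟨j, rfl⟩ : ∃ j : ℤ, i = j + 1 := ⟨i - 1, by ring⟩
  exact (exactAt_succ_iff K j).2 (h j)

/-- The kernel of a morphism of complexes of modules. -/
def kerCx {K L : Cx R} (f : K ⟶ L) : Cx R where
  X i := ModuleCat.of (Alg R) (LinearMap.ker (f.f i).hom)
  d i j := ModuleCat.ofHom ((K.d i j).hom.restrict fun y hy => by
    rw [LinearMap.mem_ker] at hy ⊢
    have h := LinearMap.congr_fun (congrArg ModuleCat.Hom.hom (f.comm i j)) y
    change (L.d i j).hom ((f.f i).hom y) = (f.f j).hom ((K.d i j).hom y) at h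
    rw [← h, hy, map_zero])
  shape i j h := by
    ext y
    change (K.d i j).hom y.1 = 0
    rw [K.shape i j h]; rfl
  d_comp_d' i j k _ _ := by
    ext y
    exact LinearMap.congr_fun (congrArg ModuleCat.Hom.hom (K.d_comp_d i j k)) y.1

/-- The inclusion of the kernel of a morphism of complexes. -/
def kerCxι {K L : Cx R} (f : K ⟶ L) : kerCx f ⟶ K where
  f _ := ModuleCat.ofHom (Submodule.subtype _)
  comm' _ _ _ := rfl

lemma kerCx_shortExact {K L : Cx R} (f : K ⟶ L) (hf : ∀ i, Function.Surjective (f.f i)) :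
    (ShortComplex.mk (kerCxι f) f (by ext _ y; exact y.2)).ShortExact := by
  refine HomologicalComplex.shortExact_of_degreewise_shortExact _ fun i => ?_
  refine { exact := ?_, mono_f := ?_, epi_g := ?_ }
  · rw [ShortComplex.moduleCat_exact_iff]
    intro y hy
    exact ⟨⟨y, hy⟩, rfl⟩
  · exact (ModuleCat.mono_iff_injective _).2 Subtype.val_injective
  · exact (ModuleCat.epi_iff_surjective _).2 (hf i)

/-- A degreewise surjective morphism of complexes with acyclic kernel is an isomorphism in the
derived category. -/
lemma isIso_Q_map_of_surjective {K L : Cx R} (f : K ⟶ L) (hf : ∀ i, Function.Surjective (f.f i))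
    (hk : ∀ (i : ℤ) (y : K.X (i + 1)), f.f (i + 1) y = 0 → K.d (i + 1) (i + 1 + 1) y = 0 →
      ∃ z : K.X i, f.f i z = 0 ∧ K.d i (i + 1) z = y) [HasDerivedCategory (ModuleCat.{0} (Alg R))] :
    IsIso (DerivedCategory.Q.map f) := by
  have hS := kerCx_shortExact f hf
  have h : (kerCx f).Acyclic := by
    rw [acyclic_iff_forall]
    intro i y hy
    obtain ⟨z, hz, hz'⟩ := hk i y.1 y.2 (congrArg Subtype.val hy)
    exact ⟨⟨z, hz⟩, Subtype.ext hz'⟩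
  rw [DerivedCategory.isIso_Q_map_iff_quasiIso]
  refine ⟨fun i => ?_⟩
  rw [quasiIsoAt_iff_isIso_homologyMap]
  have hz : ∀ j, IsZero ((kerCx f).homology j) := fun j =>
    ((kerCx f).exactAt_iff_isZero_homology j).1 (h j)
  have h1 : Mono (HomologicalComplex.homologyMap f i) :=
    (hS.homology_exact₂ i).mono_g ((hz i).eq_of_src _ _)
  have h2 : Epi (HomologicalComplex.homologyMap f i) :=
    (hS.homology_exact₃ i (i + 1) rfl).epi_f ((hz (i + 1)).eq_of_tgt _ _)
  exact isIso_of_mono_of_epi _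

lemma acyclic_double_id (S : ModuleCat.{0} (Alg R)) (n : ℤ) :
    (HomologicalComplex.double (𝟙 S)
      (show (ComplexShape.up ℤ).Rel n (n + 1) from rfl)).Acyclic := by
  have hd : IsIso ((HomologicalComplex.double (𝟙 S)
      (show (ComplexShape.up ℤ).Rel n (n + 1) from rfl)).d n (n + 1)) := by
    rw [HomologicalComplex.double_d _ _ (by simp)]
    infer_instance
  have hb : Function.Bijective ((HomologicalComplex.double (𝟙 S)
      (show (ComplexShape.up ℤ).Rel n (n + 1) from rfl)).d n (n + 1)) :=
    ConcreteCategory.bijective_of_isIso _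
  rw [acyclic_iff_forall]
  intro i y hy
  by_cases h : i = n
  · subst h
    exact hb.2 y
  · by_cases h' : i + 1 = n
    · subst h'
      exact ⟨0, (map_zero _).trans (hb.1 (hy.trans (map_zero _).symm)).symm⟩
    · have hs := ModuleCat.subsingleton_of_isZero (HomologicalComplex.isZero_double_X (𝟙 S)
        (show (ComplexShape.up ℤ).Rel n (n + 1) from rfl) (i + 1) h' (by simpa using h))
      exact ⟨0, Subsingleton.elim _ _⟩

lemma acyclic_biproduct {n : ℕ} (K : Fin n → Cx R) (h : ∀ k, (K k).Acyclic)
    [HasBiproduct K] : (⨁ K).Acyclic := by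
  intro i
  rw [HomologicalComplex.exactAt_iff_isZero_homology, IsZero.iff_id_eq_zero]
  have h1 : (𝟙 (⨁ K)) = ∑ k, biproduct.π K k ≫ biproduct.ι K k := biproduct.total.symm
  have h2 := congrArg (HomologicalComplex.homologyFunctor _ _ i).map h1
  rw [CategoryTheory.Functor.map_id, Functor.map_sum] at h2
  refine h2.trans (Finset.sum_eq_zero fun k _ => ?_)
  rw [Functor.map_comp]
  exact (((K k).exactAt_iff_isZero_homology i).1 (h k i)).eq_of_tgt
    ((HomologicalComplex.homologyFunctor _ _ i).map (biproduct.π K k)) 0 ▸ zero_comp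

end QuasiIsomorphisms

/-! ### Isomorphisms in the derived category -/

section PointComplexes

variable {V : Type} [Fintype V] [DecidableEq V] [Quiver.{0} V] {R : AdmissibleRelations V}
variable {d d' d'' : DimSeq V}

lemma IsSumOfSimpleDisks.acyclic {K : Cx R} (h : IsSumOfSimpleDisks K) : K.Acyclic := by
  obtain ⟨n, deg, S, -, ⟨e⟩⟩ := h
  exact fun i => (acyclic_biproduct _ (fun k => acyclic_double_id (S k) (deg k)) i).of_iso e.symm

lemma CPoint.cplx_d (X : CPoint R d) (i : ℤ) :
    X.cplx.d i (i + 1) = ModuleCat.ofHom (X.diff i) :=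
  CochainComplex.of_d (fun i => ModuleCat.of (Alg R) (X.x i).Mod)
    (fun i => ModuleCat.ofHom (X.diff i)) i

lemma CPoint.cplx_d_apply (X : CPoint R d) (i : ℤ) (m : (X.x i).Mod) :
    X.cplx.d i (i + 1) m = X.diff i m :=
  LinearMap.congr_fun (congrArg ModuleCat.Hom.hom (X.cplx_d i)) m

lemma CPoint.acyclic_iff (X : CPoint R d) : X.cplx.Acyclic ↔
    ∀ (i : ℤ) (y : (X.x (i + 1)).Mod), X.diff (i + 1) y = 0 → ∃ z, X.diff i z = y := by
  rw [acyclic_iff_forall]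
  refine forall_congr' fun i => forall_congr' fun y => ?_
  have h := X.cplx_d_apply (i + 1) y
  constructor
  · intro H hy
    obtain ⟨z, hz⟩ := H (h.trans hy)
    exact ⟨z, (X.cplx_d_apply i z).symm.trans hz⟩
  · intro H hy
    obtain ⟨z, hz⟩ := H (h.symm.trans hy)
    exact ⟨z, (X.cplx_d_apply i z).trans hz⟩

/-- The morphism of complexes given by homomorphisms between the terms. -/
def CPoint.homOf (X : CPoint R d) (Y : CPoint R d') (f : ∀ i, (X.x i).Mod →ₗ[Alg R] (Y.x i).Mod)
    (hf : ∀ i m, f (i + 1) (X.diff i m) = Y.diff i (f i m)) : X.cplx ⟶ Y.cplx :=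
  CochainComplex.ofHom (fun i => ModuleCat.ofHom (f i)) fun i => by
    rw [X.cplx_d, Y.cplx_d]
    ext m
    exact (hf i m).symm

lemma DIso.of_surjective {X : CPoint R d} {Y : CPoint R d'}
    (f : ∀ i, (X.x i).Mod →ₗ[Alg R] (Y.x i).Mod)
    (hf : ∀ i m, f (i + 1) (X.diff i m) = Y.diff i (f i m)) (hs : ∀ i, Function.Surjective (f i))
    (hk : ∀ (i : ℤ) (y : (X.x (i + 1)).Mod), f (i + 1) y = 0 → X.diff (i + 1) y = 0 →
      ∃ z, f i z = 0 ∧ X.diff i z = y) : DIso X Y := by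
  have := isIso_Q_map_of_surjective (X.homOf Y f hf) hs fun i y h1 h2 => by
    obtain ⟨z, hz, hz'⟩ := hk i y h1 ((X.cplx_d_apply (i + 1) y).symm.trans h2)
    exact ⟨z, hz, (X.cplx_d_apply i z).trans hz'⟩
  exact ⟨asIso (DerivedCategory.Q.map (X.homOf Y f hf))⟩

lemma DIso.refl (X : CPoint R d) : DIso X X := ⟨Iso.refl _⟩

lemma DIso.symm {X : CPoint R d} {Y : CPoint R d'} (h : DIso X Y) : DIso Y X := ⟨h.some.symm⟩

lemma DIso.trans {X : CPoint R d} {Y : CPoint R d'} {Z : CPoint R d''} (h : DIso X Y)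
    (h' : DIso Y Z) : DIso X Z := ⟨h.some.trans h'.some⟩

/-- The terms of a direct sum of complexes. -/
def CPoint.directSumEquiv (σ : Splitting d d' d'') (X : CPoint R d) (M : CPoint R d') (i : ℤ) :
    ((X.directSum σ M).x i).Mod ≃ₗ[Alg R] (X.x i).Mod × (M.x i).Mod :=
  (X.x i).directSumEquiv (σ i) (M.x i)

lemma CPoint.directSumEquiv_diff_fst (σ : Splitting d d' d'') (X : CPoint R d) (M : CPoint R d')
    (i : ℤ) (m : ((X.directSum σ M).x i).Mod) :
    (X.directSumEquiv σ M (i + 1) ((X.directSum σ M).diff i m)).1 =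
      X.diff i (X.directSumEquiv σ M i m).1 := by
  refine funext fun v => ?_
  change (projFst (σ (i + 1) v)).mulVec ((blockDiag _ _ (X.δ i v) (M.δ i v)).mulVec (m v)) =
    (X.δ i v).mulVec ((projFst (σ i v)).mulVec (m v))
  rw [Matrix.mulVec_mulVec, Matrix.mulVec_mulVec, projFst_mul]

lemma CPoint.directSumEquiv_diff_snd (σ : Splitting d d' d'') (X : CPoint R d) (M : CPoint R d')
    (i : ℤ) (m : ((X.directSum σ M).x i).Mod) :
    (X.directSumEquiv σ M (i + 1) ((X.directSum σ M).diff i m)).2 =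
      M.diff i (X.directSumEquiv σ M i m).2 := by
  refine funext fun v => ?_
  change (projSnd (σ (i + 1) v)).mulVec ((blockDiag _ _ (X.δ i v) (M.δ i v)).mulVec (m v)) =
    (M.δ i v).mulVec ((projSnd (σ i v)).mulVec (m v))
  rw [Matrix.mulVec_mulVec, Matrix.mulVec_mulVec, projSnd_mul]

/-- Adding an acyclic complex does not change the isomorphism class in the derived category. -/
lemma DIso.directSum (σ : Splitting d d' d'') (X : CPoint R d) {M : CPoint R d'}
    (hM : M.cplx.Acyclic) : DIso (X.directSum σ M) X := by
  rw [M.acyclic_iff] at hM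
  let e := X.directSumEquiv σ M
  have hfst := X.directSumEquiv_diff_fst σ M
  have hsnd := X.directSumEquiv_diff_snd σ M
  refine DIso.of_surjective (fun i => LinearMap.fst _ _ _ ∘ₗ (e i).toLinearMap) hfst
    (fun i => Prod.fst_surjective.comp (e i).surjective) fun i y h1 h2 => ?_
  have h3 : M.diff (i + 1) (e (i + 1) y).2 = 0 := by
    rw [← hsnd, h2]
    exact congrArg Prod.snd (map_zero (e (i + 1 + 1)))
  obtain ⟨z, hz⟩ := hM i _ h3
  refine ⟨(e i).symm (0, z), ?_, (e (i + 1)).injective (Prod.ext ?_ ?_)⟩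
  · exact congrArg Prod.fst ((e i).apply_symm_apply (0, z))
  · rw [hfst, LinearEquiv.apply_symm_apply]
    exact (map_zero (X.diff i)).trans h1.symm
  · rw [hsnd, LinearEquiv.apply_symm_apply]
    exact hz

variable [∀ s t : V, Finite (s ⟶ t)]

/-- The morphism `cone(Ω X → F X) → X` is a quasi-isomorphism: it is surjective and its kernel is
the cone of the identity of `Ω X`. -/
lemma DIso.resolve (X : CPoint R d) : DIso (resolve X) X := by
  let e := resolveEquiv X
  refine DIso.of_surjective
    (fun i => coverMap (X.x i) ∘ₗ LinearMap.snd _ _ _ ∘ₗ (e i).toLinearMap) (fun i m => ?_)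
    (fun i => (coverMap_surjective _).comp (Prod.snd_surjective.comp (e i).surjective))
    fun i y h1 h2 => ?_
  · change coverMap (X.x (i + 1)) (e (i + 1) ((QuiverComplexes.resolve X).diff i m)).2 =
      X.diff i (coverMap (X.x i) (e i m).2)
    rw [resolveEquiv_diff, coneDiff_snd]
    refine (map_add (coverMap (X.x (i + 1))) _ _).trans ?_
    have h3 : coverMap (X.x (i + 1)) (e i m).1.1 = 0 := (e i m).1.2
    rw [h3, zero_add]
    exact coverMap_freeMap (X.x i) (X.x (i + 1)) (X.δ i) (X.comm i) _
  · have h3 : coverMap (X.x (i + 1)) (e (i + 1) y).2 = 0 := h1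
    have h4 : coneDiff X (i + 1) (e (i + 1) y) = 0 := by
      rw [← resolveEquiv_diff, h2, map_zero]
    -- the contracting homotopy of the kernel is `(y, z) ↦ (z, 0)`
    refine ⟨(e i).symm (⟨(e (i + 1) y).2, h3⟩, 0), ?_, (e (i + 1)).injective ?_⟩
    · change coverMap (X.x i) (e i ((e i).symm _)).2 = 0
      rw [LinearEquiv.apply_symm_apply]
      exact map_zero _
    · have h5 := congrArg Prod.snd h4
      change (e (i + 1) y).1.1 + freeMap (X.δ (i + 1)) (e (i + 1) y).2 = 0 at h5
      rw [resolveEquiv_diff, LinearEquiv.apply_symm_apply]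
      refine Prod.ext (Subtype.ext ?_) ?_
      · rw [coneDiff_fst]
        exact (eq_neg_of_add_eq_zero_left h5).symm
      · rw [coneDiff_snd]
        exact (congrArg (_ + ·) (map_zero (freeMap (X.δ i)))).trans (add_zero _)

end PointComplexes

/-! ### Projective dimension of the terms of the iterated cones -/

section ProjectiveDimension

variable {V : Type} [Fintype V] [DecidableEq V] [Quiver.{0} V] {R : AdmissibleRelations V}

lemma shortExact_of_exact {M N K : Type} [AddCommGroup M] [Module (Alg R) M] [AddCommGroup N]
    [Module (Alg R) N] [AddCommGroup K] [Module (Alg R) K] (f : M →ₗ[Alg R] N) (g : N →ₗ[Alg R] K)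
    (hf : Function.Injective f) (hg : Function.Surjective g) (h : Function.Exact f g) :
    (ShortComplex.mk (ModuleCat.ofHom f) (ModuleCat.ofHom g)
      (by ext m; exact h.apply_apply_eq_zero m)).ShortExact where
  exact := (ShortComplex.moduleCat_exact_iff _).2 fun y hy => (h y).1 hy
  mono_f := (ModuleCat.mono_iff_injective _).2 hf
  epi_g := (ModuleCat.epi_iff_surjective _).2 hg

instance projective_projMod (v : V) : Module.Projective (Alg R) (ProjMod R v) :=
  Module.Projective.of_split (ProjMod.val R v)
    (LinearMap.toSpanSingleton (Alg R) (ProjMod R v) (projGen R v))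
    (LinearMap.ext fun a => val_smul_projGen a)

lemma projective_pi {ι : Type} [Finite ι] (M : ι → Type) [∀ i, AddCommGroup (M i)]
    [∀ i, Module (Alg R) (M i)] [∀ i, Module.Projective (Alg R) (M i)] :
    Module.Projective (Alg R) (∀ i, M i) := by
  classical
  have := Fintype.ofFinite ι
  exact Module.Projective.of_equiv' (DFinsupp.linearEquivFunOnFintype (R := Alg R) (M := M))

instance projective_freeOn (m : V → ℕ) : Module.Projective (Alg R) (FreeOn R m) := by
  have := fun v => projective_pi (R := R) fun _ : Fin (m v) => ProjMod R v
  exact projective_pi _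

lemma hasProjectiveDimensionLT_prod {M N : Type} [AddCommGroup M] [Module (Alg R) M]
    [AddCommGroup N] [Module (Alg R) N] {n : ℕ}
    (hM : HasProjectiveDimensionLT (ModuleCat.of (Alg R) M) n)
    (hN : HasProjectiveDimensionLT (ModuleCat.of (Alg R) N) n) :
    HasProjectiveDimensionLT (ModuleCat.of (Alg R) (M × N)) n :=
  (shortExact_of_exact (LinearMap.inl (Alg R) M N) (LinearMap.snd (Alg R) M N)
    LinearMap.inl_injective LinearMap.snd_surjective
    Function.Exact.inl_snd).hasProjectiveDimensionLT_X₂ n hM hN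

lemma hasProjectiveDimensionLT_freeOn (m : V → ℕ) (n : ℕ) :
    HasProjectiveDimensionLT (ModuleCat.of (Alg R) (FreeOn R m)) (n + 1) := by
  have := (IsProjective.iff_projective (R := Alg R) (FreeOn R m)).1 inferInstance
  infer_instance

lemma hasProjectiveDimensionLT_syzygy {m : V → ℕ} (x : Rep R m) {n : ℕ}
    (h : HasProjectiveDimensionLT (ModuleCat.of (Alg R) x.Mod) (n + 2)) :
    HasProjectiveDimensionLT (ModuleCat.of (Alg R) (syzygy x)) (n + 1) :=
  (shortExact_of_exact (syzygy x).subtype (coverMap x) Subtype.val_injective (coverMap_surjective x)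
    (LinearMap.exact_subtype_ker_map _)).hasProjectiveDimensionLT_X₁ (n + 1)
      (hasProjectiveDimensionLT_freeOn m n) h

variable [∀ s t : V, Finite (s ⟶ t)] {d : DimSeq V}

lemma hasProjectiveDimensionLT_resolve (X : CPoint R d) {n : ℕ}
    (h : ∀ i, HasProjectiveDimensionLT (ModuleCat.of (Alg R) (X.x i).Mod) (n + 2)) (i : ℤ) :
    HasProjectiveDimensionLT (ModuleCat.of (Alg R) ((resolve X).x i).Mod) (n + 1) := by
  have := hasProjectiveDimensionLT_prod (hasProjectiveDimensionLT_syzygy _ (h (i + 1)))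
    (hasProjectiveDimensionLT_freeOn (R := R) (d i) n)
  exact hasProjectiveDimensionLT_of_iso (resolveEquiv X i).symm.toModuleIso _

variable (R) in
/-- The dimension vector sequence of the `n`-fold iterate of `resolve`. -/
def iterSeq : ℕ → DimSeq V → DimSeq V
  | 0, d => d
  | n + 1, d => coneSeq R (iterSeq n d)

/-- The `n`-fold iterate of `resolve`. -/
def iterResolve : (n : ℕ) → CPoint R d → CPoint R (iterSeq R n d)
  | 0, X => X
  | n + 1, X => resolve (iterResolve n X)

lemma isPolyMorphism_iterResolve (n : ℕ) :
    IsPolyMorphism fun X : CPoint R d => iterResolve n X := by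
  induction n with
  | zero => exact isPolyMorphism_id
  | succ n ih => exact isPolyMorphism_resolve.comp ih

lemma DIso.iterResolve (n : ℕ) (X : CPoint R d) : DIso (iterResolve n X) X := by
  induction n with
  | zero => exact DIso.refl X
  | succ n ih => exact (DIso.resolve _).trans ih

/-- The terms of the `n`-fold iterate are projective if `n` is at least the global dimension. -/
lemma projective_iterResolve {n : ℕ} (h : ∀ M : ModuleCat.{0} (Alg R), HasProjectiveDimensionLT M n)
    (X : CPoint R d) (i : ℤ) : Module.Projective (Alg R) ((iterResolve n X).x i).Mod := by
  have key : ∀ k l : ℕ, k + l = n → ∀ i, HasProjectiveDimensionLT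
      (ModuleCat.of (Alg R) ((iterResolve k X).x i).Mod) (l + 1) := by
    intro k
    induction k with
    | zero =>
      intro l hl i
      have := h (ModuleCat.of (Alg R) (X.x i).Mod)
      exact hasProjectiveDimensionLT_of_ge _ n _ (by omega)
    | succ k ih =>
      intro l hl i
      exact hasProjectiveDimensionLT_resolve _ (fun i => ih (l + 1) (by omega) i) i
  have h1 := key n 0 (by omega) i
  rw [zero_add, ← projective_iff_hasProjectiveDimensionLT_one] at h1
  exact (IsProjective.iff_projective (R := Alg R) _).2 h1

end ProjectiveDimension

/-! ### The structure of projective modules -/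

section ProjectiveModules

variable {V : Type} [Fintype V] [DecidableEq V] [Quiver.{0} V] {R : AdmissibleRelations V}
variable {M : Type} [AddCommGroup M] [Module ℂ M] [Module (Alg R) M] [IsScalarTower ℂ (Alg R) M]
variable {m : V → ℕ}

lemma FreeOn.eq_sum (f : FreeOn R m) :
    f = ∑ v, ∑ k, ProjMod.val R v (f v k) •
      (Pi.single v (Pi.single k (projGen R v)) : FreeOn R m) := by
  conv_lhs => rw [← Finset.univ_sum_single f]
  refine Finset.sum_congr rfl fun v _ => ?_
  conv_lhs => rw [← Finset.univ_sum_single (f v)]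
  rw [← LinearMap.single_apply (Alg R), map_sum]
  refine Finset.sum_congr rfl fun k _ => ?_
  rw [LinearMap.single_apply, ← Pi.single_smul, ← Pi.single_smul, val_smul_projGen]

/-- An element of `⊕_v P_v^{m v}` with all augmentations zero lies in `rad A · ⊕_v P_v^{m v}`. -/
lemma mem_rad_smul_top {f : FreeOn R m} (h : ∀ v k, augProj R v (f v k) = 0) :
    f ∈ radIdeal R • (⊤ : Submodule (Alg R) (FreeOn R m)) := by
  rw [FreeOn.eq_sum f]
  refine Submodule.sum_mem _ fun v _ => Submodule.sum_mem _ fun k _ =>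
    Submodule.smul_mem_smul ((mem_radIdeal R).2 fun w => ?_) trivial
  rw [← val_mul_idem, map_mul, aug_idem]
  split_ifs with hw
  · subst hw
    rw [← augProj_apply, h, zero_mul]
  · rw [mul_zero]

/-- On an element at `v` which is killed by the radical, `A` acts through the augmentation at `v`.
-/
lemma smul_eq_aug_smul_of_rad {t : M} {v : V} (hrad : ∀ r ∈ radIdeal R, r • t = 0)
    (ht : idem R v • t = t) (a : Alg R) : a • t = aug R v a • t := by
  have h1 : (a - aug R v a • (1 : Alg R)) * idem R v ∈ radIdeal R := by
    refine (mem_radIdeal R).2 fun w => ?_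
    rw [map_mul, aug_idem]
    split_ifs with hw
    · subst hw; simp
    · rw [mul_zero]
  have h2 := hrad _ h1
  rw [mul_smul, ht, sub_smul, smul_assoc, one_smul, sub_eq_zero] at h2
  exact h2

/-- A finite dimensional projective module is a direct sum of modules `P_v`: a basis of its top
gives a projective cover. -/
theorem exists_equiv_freeOn [Module.Finite ℂ M] [Module.Projective (Alg R) M] :
    ∃ m : V → ℕ, Nonempty (M ≃ₗ[Alg R] FreeOn R m) := by
  let N : Submodule (Alg R) M := radIdeal R • ⊤
  have hN : ∀ r ∈ radIdeal R, ∀ t : M ⧸ N, r • t = 0 := by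
    intro r hr t
    obtain ⟨t, rfl⟩ := N.mkQ_surjective t
    rw [← map_smul]
    exact (Submodule.Quotient.mk_eq_zero N).2 (Submodule.smul_mem_smul hr trivial)
  obtain ⟨b⟩ := exists_frame (R := R) (M := M ⧸ N) (d := dimAt R (M ⧸ N)) fun _ => rfl
  choose x hx using fun v k => N.mkQ_surjective (b.basis ⟨v, k⟩)
  -- lift an adapted basis of the top to a homomorphism from a projective module
  let p : FreeOn R (dimAt R (M ⧸ N)) →ₗ[Alg R] M := freeLift x
  have hp : ∀ f, N.mkQ (p f) = ∑ v, ∑ k, augProj R v (f v k) • b.basis ⟨v, k⟩ := by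
    intro f
    change N.mkQ (freeLift x f) = _
    rw [freeLift_apply, map_sum]
    refine Finset.sum_congr rfl fun v _ => ?_
    rw [map_sum]
    refine Finset.sum_congr rfl fun k _ => ?_
    rw [map_smul, hx, smul_eq_aug_smul_of_rad (fun r hr => hN r hr _) (b.idem_smul_basis v k)]
    rfl
  have hsup : LinearMap.range p ⊔ N = ⊤ := by
    rw [eq_top_iff]
    intro y _
    let f : FreeOn R (dimAt R (M ⧸ N)) := fun v k => b.basis.repr (N.mkQ y) ⟨v, k⟩ • projGen R v
    have h1 : N.mkQ (p f) = N.mkQ y := by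
      rw [hp]
      conv_rhs => rw [← b.basis.sum_repr (N.mkQ y), Fintype.sum_sigma]
      refine Finset.sum_congr rfl fun v _ => Finset.sum_congr rfl fun k _ => ?_
      rw [map_smul, augProj_projGen, smul_eq_mul, mul_one]
    have h2 : y - p f ∈ N := by
      rw [← Submodule.Quotient.mk_eq_zero, ← Submodule.mkQ_apply, map_sub, h1, sub_self]
    rw [← add_sub_cancel (p f) y]
    exact Submodule.add_mem_sup ⟨f, rfl⟩ h2
  have hsurj : Function.Surjective p := by
    -- Nakayama applied to the cokernel
    rw [← LinearMap.range_eq_top]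
    have h := eq_bot_of_le_rad_smul R (⊤ : Submodule (Alg R) (M ⧸ LinearMap.range p)) <| by
      have h1 := congrArg (Submodule.map (LinearMap.range p).mkQ) hsup
      rw [Submodule.map_sup, Submodule.mkQ_map_self, bot_sup_eq, Submodule.map_smul'',
        Submodule.map_top, Submodule.range_mkQ] at h1
      exact h1.ge
    rw [eq_top_iff]
    intro y _
    have h2 : (LinearMap.range p).mkQ y ∈ (⊥ : Submodule (Alg R) (M ⧸ LinearMap.range p)) :=
      h ▸ trivial
    rw [Submodule.mem_bot] at h2
    exact (Submodule.Quotient.mk_eq_zero _).1 h2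
  obtain ⟨s, hs⟩ := LinearMap.exists_rightInverse_of_surjective p (LinearMap.range_eq_top.2 hsurj)
  have hs' : ∀ y, p (s y) = y := LinearMap.congr_fun hs
  have hker : LinearMap.ker p = ⊥ := by
    -- The kernel lies in the radical, and it is a direct summand since `M` is projective, so
    -- that it equals its own product with the radical.
    refine eq_bot_of_le_rad_smul R _ ?_
    let q : FreeOn R (dimAt R (M ⧸ N)) →ₗ[Alg R] FreeOn R (dimAt R (M ⧸ N)) :=
      LinearMap.id - s ∘ₗ p
    have hq : Submodule.map q ⊤ ≤ LinearMap.ker p := by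
      rintro _ ⟨f, -, rfl⟩
      change p (f - s (p f)) = 0
      rw [map_sub, hs', sub_self]
    intro f hf
    rw [LinearMap.mem_ker] at hf
    have h1 : f ∈ radIdeal R • (⊤ : Submodule (Alg R) (FreeOn R (dimAt R (M ⧸ N)))) := by
      refine mem_rad_smul_top fun v k => ?_
      have h2 := hp f
      rw [hf, map_zero, ← Fintype.sum_sigma' (f := fun v k =>
        augProj R v (f v k) • b.basis ⟨v, k⟩)] at h2
      exact Fintype.linearIndependent_iff.1 b.basis.linearIndependent
        (fun i => augProj R i.1 (f i.1 i.2)) h2.symm ⟨v, k⟩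
    have h2 : q f = f := by
      change f - s (p f) = f
      rw [hf, map_zero, sub_zero]
    have h3 : q f ∈ Submodule.map q (radIdeal R • ⊤) := ⟨f, h1, rfl⟩
    rw [Submodule.map_smul'', h2] at h3
    exact Submodule.smul_mono le_rfl hq h3
  exact ⟨_, ⟨(LinearEquiv.ofBijective p ⟨LinearMap.ker_eq_bot.1 hker, hsurj⟩).symm⟩⟩

end ProjectiveModules

/-! ### Alternating sums and the Cartan matrix -/

section AlternatingSums

variable {V : Type} [Fintype V] [DecidableEq V] [Quiver.{0} V] (R : AdmissibleRelations V)

/-- The alternating sum `∑ (-1)^i d_i` of a dimension vector sequence. -/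
def altSum : DimSeq V →+ (V → ℤ) :=
  Finsupp.liftAddHom fun i => AddMonoidHom.mk' (fun f v => (i.negOnePow : ℤ) * (f v : ℤ))
    fun f g => funext fun v => by simp [mul_add]

lemma altSum_single (i : ℤ) (f : V → ℕ) (v : V) :
    altSum (Finsupp.single i f) v = (i.negOnePow : ℤ) * (f v : ℤ) := by
  rw [altSum, Finsupp.liftAddHom_apply_single]; rfl

lemma shiftSeq_single (i : ℤ) (f : V → ℕ) :
    shiftSeq (Finsupp.single i f) = Finsupp.single (i - 1) f := by
  simp [shiftSeq]

lemma altSum_shiftSeq (d : DimSeq V) : altSum (shiftSeq d) = -altSum d := by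
  induction d using Finsupp.induction_linear with
  | zero =>
    have : shiftSeq (0 : DimSeq V) = 0 := by ext; simp
    simp [this]
  | add d d' h h' => rw [shiftSeq_add, map_add, map_add, h, h', neg_add]
  | single i f =>
    funext v
    rw [shiftSeq_single, Pi.neg_apply, altSum_single, altSum_single, Int.negOnePow_sub]
    simp

lemma altSum_coneSeq [∀ s t : V, Finite (s ⟶ t)] (d : DimSeq V) :
    altSum (coneSeq R d) = altSum d := by
  rw [coneSeq, projDim_eq_add, map_add, map_add, altSum_shiftSeq, neg_add_cancel_left]

lemma altSum_iterSeq [∀ s t : V, Finite (s ⟶ t)] (n : ℕ) (d : DimSeq V) :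
    altSum (iterSeq R n d) = altSum d := by
  induction n with
  | zero => rfl
  | succ n ih => rw [iterSeq, altSum_coneSeq, ih]

/-- The Cartan matrix of `A`, as an endomorphism of `ℤ^V`: it sends multiplicities `m` to the
dimension vector of `⊕_v P_v^{m v}`. -/
def cartan : (V → ℤ) →ₗ[ℤ] (V → ℤ) :=
  Matrix.toLin' (Matrix.of fun w v => (dimIndecProj R v w : ℤ))

lemma cartan_apply (m : V → ℤ) (w : V) : cartan R m w = ∑ v, m v * (dimIndecProj R v w : ℤ) := by
  simp [cartan, Matrix.mulVec, dotProduct, mul_comm]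

lemma cartan_natCast (m : V → ℕ) : cartan R (fun v => (m v : ℤ)) =
    fun v => (freeDim R m v : ℤ) := by
  funext w
  rw [cartan_apply]
  simp [freeDim]

lemma projDim_add (e e' : DimSeq V) : projDim R (e + e') = projDim R e + projDim R e' := by
  ext i w
  simp [projDim, add_mul, Finset.sum_add_distrib]

lemma altSum_projDim (e : DimSeq V) : altSum (projDim R e) = cartan R (altSum e) := by
  induction e using Finsupp.induction_linear with
  | zero =>
    have : projDim R (0 : DimSeq V) = 0 := by ext; simp [projDim]
    simp [this]
  | add d d' h h' => rw [projDim_add, map_add, map_add, map_add, h, h']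
  | single i f =>
    have h : projDim R (Finsupp.single i f) = Finsupp.single i (freeDim R f) := by
      rw [projDim, Finsupp.mapRange_single]; rfl
    have h1 : altSum (Finsupp.single i f) = (i.negOnePow : ℤ) • fun v => (f v : ℤ) := by
      funext v
      rw [altSum_single]; rfl
    funext v
    rw [h, h1, map_smul, cartan_natCast, altSum_single]; rfl

variable {R} [∀ s t : V, Finite (s ⟶ t)] {d : DimSeq V}

/-- A complex with projective terms has a projective dimension sequence. -/
lemma exists_projDim_eq (X : CPoint R d) (h : ∀ i, Module.Projective (Alg R) (X.x i).Mod) :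
    ∃ e : DimSeq V, projDim R e = d ∧ ∀ i, Nonempty ((X.x i).Mod ≃ₗ[Alg R] FreeOn R (e i)) := by
  choose m hm using fun i => exists_equiv_freeOn (R := R) (M := (X.x i).Mod)
  have h1 : ∀ i, freeDim R (m i) = d i := fun i => funext fun w => by
    rw [← dimAt_freeOn, ← dimAt_congr (hm i).some, (X.x i).frame.dimAt_eq]
  let e : DimSeq V := Finsupp.ofSupportFinite m <| d.support.finite_toSet.subset fun i hi => by
    rw [SetLike.mem_coe, Finsupp.mem_support_iff]
    intro h2
    refine hi ?_
    have h3 := freeDim_eq R (m i)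
    rw [h1, h2] at h3
    exact (add_eq_zero.1 h3.symm).2
  exact ⟨e, Finsupp.ext h1, hm⟩

/-- The Cartan matrix of an algebra of finite global dimension is invertible over `ℤ`: resolving the
simple modules shows that it is surjective. -/
lemma cartan_injective (hR : HasFiniteGlobalDimension R) : Function.Injective (cartan R) := by
  obtain ⟨n, hn⟩ := hR
  refine OrzechProperty.injective_of_surjective_endomorphism _ ?_
  rw [← LinearMap.range_eq_top, eq_top_iff, ← (Pi.basisFun ℤ V).span_eq, Submodule.span_le]
  rintro _ ⟨v, rfl⟩
  let d : DimSeq V := Finsupp.single 0 (Pi.single v 1)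
  obtain ⟨e, he, -⟩ := exists_projDim_eq (iterResolve n (CPoint.zero R d))
    (projective_iterResolve hn _)
  refine ⟨altSum e, ?_⟩
  rw [← altSum_projDim, he, altSum_iterSeq]
  funext w
  rw [altSum_single, Pi.basisFun_apply]
  simp [Pi.single_apply]

lemma freeDim_injective (hR : HasFiniteGlobalDimension R) : Function.Injective (freeDim R) := by
  intro m m' h
  have h1 := cartan_injective hR (a₁ := fun v => (m v : ℤ)) (a₂ := fun v => (m' v : ℤ)) (by
    rw [cartan_natCast, cartan_natCast, h])
  funext v
  exact_mod_cast congrFun h1 v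

/-- The complexes in `C^b(A, d)` have projective resolutions which depend polynomially on the
complex and all have the same projective dimension sequence. -/
theorem exists_projective_resolution (hR : HasFiniteGlobalDimension R) (d : DimSeq V) :
    ∃ (n : ℕ) (e : DimSeq V) (f : CPoint R d → PPoint R e), projDim R e = iterSeq R n d ∧
      IsPolyMorphism (fun X => (f X).toCPoint) ∧ ∀ X, DIso (f X).toCPoint X := by
  obtain ⟨n, hn⟩ := id hR
  obtain ⟨e, he, -⟩ := exists_projDim_eq (iterResolve n (CPoint.zero R d))
    (projective_iterResolve hn _)
  refine ⟨n, e, ?_⟩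
  have h1 : ∀ (X : CPoint R d) i, Nonempty (((iterResolve n X).x i).Mod ≃ₗ[Alg R]
      FreeOn R (e i)) := by
    intro X i
    obtain ⟨e', he', h⟩ := exists_projDim_eq (iterResolve n X) (projective_iterResolve hn X)
    have h2 : freeDim R (e' i) = freeDim R (e i) := by
      rw [← projDim_apply, ← projDim_apply, he, he']
    -- a projective module is determined by its dimension vector
    rw [← freeDim_injective hR h2]
    exact h i
  have h2 := isPolyMorphism_iterResolve (R := R) (d := d) n
  have h3 := DIso.iterResolve (R := R) (d := d) n
  generalize iterResolve (R := R) (d := d) n = g at *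
  generalize iterSeq R n d = D at *
  subst he
  exact ⟨fun X => ⟨g X, h1 X⟩, rfl, h2, h3⟩

end AlternatingSums

/-! ### Classes in the Grothendieck group -/

section GrothendieckGroup

open ZeroObject

variable {V : Type} [Fintype V] [DecidableEq V] [Quiver.{0} V] {R : AdmissibleRelations V}

/-- The class in `K₀(D^b(A))` of an object of `D^b(A)`. -/
def objCls {X : D R} (h : IsBounded R X) : K₀ R :=
  QuotientAddGroup.mk (FreeAbelianGroup.of ⟨X, h⟩)

lemma objCls_triangle {T : Triangle (D R)} (hT : T ∈ distTriang (D R)) (h₁ : IsBounded R T.obj₁)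
    (h₂ : IsBounded R T.obj₂) (h₃ : IsBounded R T.obj₃) :
    objCls h₂ = objCls h₁ + objCls h₃ := by
  have h : FreeAbelianGroup.of (⟨T.obj₂, h₂⟩ : {X : D R // IsBounded R X}) -
      FreeAbelianGroup.of ⟨T.obj₁, h₁⟩ - FreeAbelianGroup.of ⟨T.obj₃, h₃⟩ ∈
        triangleRelations R :=
    AddSubgroup.subset_closure ⟨T, hT, h₁, h₂, h₃, rfl⟩
  have h' := (QuotientAddGroup.eq_zero_iff _).2 h
  rw [sub_sub] at h'
  exact sub_eq_zero.1 h'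

lemma isBounded_of_iso {X Y : D R} (e : X ≅ Y) (h : IsBounded R X) : IsBounded R Y := by
  obtain ⟨K, h1, h2, ⟨f⟩⟩ := h
  exact ⟨K, h1, h2, ⟨e.symm.trans f⟩⟩

lemma isBounded_zero : IsBounded R 0 := by
  have h : ∀ i, Subsingleton ((0 : Cx R).X i) := fun i => ModuleCat.subsingleton_of_isZero
    ((HomologicalComplex.eval (ModuleCat.{0} (Alg R)) (ComplexShape.up ℤ) i).map_isZero
      (isZero_zero _))
  exact ⟨0, fun i => Module.Finite.of_surjective (0 : Alg R →ₗ[Alg R] (0 : Cx R).X i)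
    fun y => ⟨0, (h i).elim _ _⟩, ⟨0, 0, fun i _ => h i⟩,
    ⟨(isZero_zero _).iso (DerivedCategory.Q.map_isZero (isZero_zero _))⟩⟩

lemma objCls_zero : objCls (isBounded_zero (R := R)) = 0 := by
  have h := objCls_triangle (contractible_distinguished (0 : D R)) isBounded_zero isBounded_zero
    isBounded_zero
  exact left_eq_add.1 h

lemma objCls_of_iso {X Y : D R} (e : X ≅ Y) (hX : IsBounded R X) (hY : IsBounded R Y) :
    objCls hX = objCls hY := by
  have hT : Triangle.mk e.hom (0 : Y ⟶ 0) (0 : 0 ⟶ X⟦(1 : ℤ)⟧) ∈ distTriang (D R) := by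
    refine isomorphic_distinguished _ (contractible_distinguished X) _
      (Triangle.isoMk _ _ (Iso.refl _) e.symm (Iso.refl _) ?_ ?_ ?_)
    · exact e.hom_inv_id.trans (Category.id_comp _).symm
    · exact (isZero_zero _).eq_of_tgt _ _
    · exact (isZero_zero _).eq_of_src _ _
  have h := objCls_triangle hT hX hY isBounded_zero
  exact ((h.trans (congrArg (objCls hX + ·) objCls_zero)).trans (add_zero _)).symm

lemma objCls_shift {X : D R} (hX : IsBounded R X) (hX' : IsBounded R (X⟦(1 : ℤ)⟧)) :
    objCls hX' = -objCls hX := by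
  have h := objCls_triangle (contractible_distinguished₂ X) hX isBounded_zero hX'
  exact (neg_eq_of_add_eq_zero_right (h.symm.trans objCls_zero)).symm

variable {d d' d'' : DimSeq V}

lemma CPoint.cls_directSum (σ : Splitting d d' d'') (X : CPoint R d) (Y : CPoint R d') :
    (X.directSum σ Y).cls = X.cls + Y.cls := by
  let e := X.directSumEquiv σ Y
  let f' : ∀ i, (X.x i).Mod →ₗ[Alg R] ((X.directSum σ Y).x i).Mod := fun i =>
    (e i).symm.toLinearMap ∘ₗ LinearMap.inl (Alg R) _ _
  let g' : ∀ i, ((X.directSum σ Y).x i).Mod →ₗ[Alg R] (Y.x i).Mod := fun i =>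
    LinearMap.snd (Alg R) _ _ ∘ₗ (e i).toLinearMap
  let f : X.cplx ⟶ (X.directSum σ Y).cplx :=
    X.homOf _ f' fun i m => by
      refine (e (i + 1)).injective (Prod.ext ?_ ?_)
      · rw [X.directSumEquiv_diff_fst]
        change ((e (i + 1)) ((e (i + 1)).symm (X.diff i m, 0))).1 =
          X.diff i ((e i) ((e i).symm (m, 0))).1
        rw [LinearEquiv.apply_symm_apply, LinearEquiv.apply_symm_apply]
      · rw [X.directSumEquiv_diff_snd]
        change ((e (i + 1)) ((e (i + 1)).symm (X.diff i m, 0))).2 =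
          Y.diff i ((e i) ((e i).symm (m, 0))).2
        rw [LinearEquiv.apply_symm_apply, LinearEquiv.apply_symm_apply]
        exact (map_zero _).symm
  let g : (X.directSum σ Y).cplx ⟶ Y.cplx :=
    (X.directSum σ Y).homOf _ g' (X.directSumEquiv_diff_snd σ Y)
  have hex : ∀ i, Function.Exact (f' i) (g' i) := by
    intro i m
    constructor
    · intro h
      refine ⟨(e i m).1, (e i).injective ?_⟩
      change e i ((e i).symm ((e i m).1, 0)) = _
      rw [LinearEquiv.apply_symm_apply]
      exact Prod.ext rfl h.symm
    · rintro ⟨m, rfl⟩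
      change ((e i) ((e i).symm (m, 0))).2 = 0
      rw [LinearEquiv.apply_symm_apply]
  have hw : f ≫ g = 0 := by
    ext i m
    exact (hex i).apply_apply_eq_zero m
  have hS : (ShortComplex.mk f g hw).ShortExact :=
    HomologicalComplex.shortExact_of_degreewise_shortExact _ fun i =>
      shortExact_of_exact (f' i) (g' i) ((e i).symm.injective.comp LinearMap.inl_injective)
        (Prod.snd_surjective.comp (e i).surjective) (hex i)
  exact objCls_triangle (DerivedCategory.triangleOfSES_distinguished hS) X.isBounded
    (X.directSum σ Y).isBounded Y.isBounded

lemma CPoint.zero_directSum (σ : Splitting d d' d'') :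
    (CPoint.zero R d).directSum σ (CPoint.zero R d') = CPoint.zero R d'' := by
  refine CPoint.ext ?_ ?_
  · funext i
    refine Subtype.ext ?_
    funext s t a
    exact blockDiag_zero _ _
  · funext i v
    exact blockDiag_zero _ _

lemma dimCls_add (d d' : DimSeq V) : dimCls R (d + d') = dimCls R d + dimCls R d' := by
  have σ : Splitting d d' (d + d') := fun i v => finSumFinEquiv
  rw [dimCls, ← CPoint.zero_directSum σ, CPoint.cls_directSum]; rfl

lemma CPoint.zero_diff (d : DimSeq V) (i : ℤ) : (CPoint.zero R d).diff i = 0 := by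
  refine LinearMap.ext fun m => funext fun v => ?_
  exact Matrix.zero_mulVec (m v)

lemma CPoint.zero_cplx_d (d : DimSeq V) (i j : ℤ) : (CPoint.zero R d).cplx.d i j = 0 := by
  by_cases h : i + 1 = j
  · subst h
    rw [CPoint.cplx_d, CPoint.zero_diff]; rfl
  · exact (CPoint.zero R d).cplx.shape i j h

/-- The zero point for the shifted sequence is the shift of the zero point. -/
lemma dimCls_shiftSeq (d : DimSeq V) : dimCls R (shiftSeq d) = -dimCls R d := by
  let e : (CPoint.zero R (shiftSeq d)).cplx ≅ (CPoint.zero R d).cplx⟦(1 : ℤ)⟧ :=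
    HomologicalComplex.Hom.isoOfComponents (fun i => Iso.refl _) fun i j _ => by
      rw [CPoint.zero_cplx_d, CochainComplex.shiftFunctor_obj_d', CPoint.zero_cplx_d]
      simp only [smul_zero, Iso.refl_hom]
      exact comp_zero.trans zero_comp.symm
  let e' := DerivedCategory.Q.mapIso e ≪≫ (DerivedCategory.Q.commShiftIso (1 : ℤ)).app _
  have hb := isBounded_of_iso e' (CPoint.isBounded _)
  exact (objCls_of_iso e' (CPoint.isBounded _) hb).trans (objCls_shift _ _)

variable [∀ s t : V, Finite (s ⟶ t)]

/-- The cone of `Ω X → F X` has the class of `X`. -/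
lemma dimCls_coneSeq (d : DimSeq V) : dimCls R (coneSeq R d) = dimCls R d := by
  rw [coneSeq, projDim_eq_add, dimCls_add, dimCls_add, dimCls_shiftSeq, neg_add_cancel_left]

lemma dimCls_iterSeq (n : ℕ) (d : DimSeq V) : dimCls R (iterSeq R n d) = dimCls R d := by
  induction n with
  | zero => rfl
  | succ n ih => rw [iterSeq, dimCls_coneSeq, ih]

end GrothendieckGroup

/-! ### The Euler characteristic -/

section EulerCharacteristic

variable {V : Type} [Fintype V] [DecidableEq V] [Quiver.{0} V] {R : AdmissibleRelations V}

/-- The complex vector space underlying an `A`-module.  Objects of `ModuleCat (Alg R)` carry no such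
structure, so this is used as a local instance. -/
abbrev complexModule (M : Type) [AddCommGroup M] [Module (Alg R) M] : Module ℂ M :=
  Module.compHom M (algebraMap ℂ (Alg R))

lemma complexModule_isScalarTower (M : Type) [AddCommGroup M] [Module (Alg R) M] :
    @IsScalarTower ℂ (Alg R) M _ _ (complexModule (R := R) M).toSMul := by
  let := complexModule (R := R) M
  exact ⟨fun c a x => by rw [Algebra.smul_def, mul_smul]; rfl⟩

/-- The dimension of the part at `v` of an object of the category of `A`-modules. -/
def objDim (M : ModuleCat.{0} (Alg R)) (v : V) : ℕ :=
  letI := complexModule (R := R) M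
  haveI := complexModule_isScalarTower (R := R) M
  dimAt R M v

/-- The rank at `v` of a morphism of `A`-modules. -/
def homRank {M N : ModuleCat.{0} (Alg R)} (f : M ⟶ N) (v : V) : ℕ :=
  letI := complexModule (R := R) M
  haveI := complexModule_isScalarTower (R := R) M
  letI := complexModule (R := R) N
  haveI := complexModule_isScalarTower (R := R) N
  rankAt f.hom v

lemma objDim_of (M : Type) [AddCommGroup M] [Module ℂ M] [Module (Alg R) M]
    [IsScalarTower ℂ (Alg R) M] (v : V) : objDim (ModuleCat.of (Alg R) M) v = dimAt R M v := by
  refine @dimAt_congr V _ _ R M _ (complexModule M) _ (complexModule_isScalarTower M) M _ _ _ _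
    (LinearEquiv.refl (Alg R) M) v

lemma objDim_of_iso {M N : ModuleCat.{0} (Alg R)} (e : M ≅ N) (v : V) :
    objDim M v = objDim N v := by
  let := complexModule (R := R) M
  have := complexModule_isScalarTower (R := R) M
  let := complexModule (R := R) N
  have := complexModule_isScalarTower (R := R) N
  exact dimAt_congr e.toLinearEquiv v

lemma objDim_eq_zero {M : ModuleCat.{0} (Alg R)} (h : Subsingleton M) (v : V) :
    objDim M v = 0 := by
  let := complexModule (R := R) M
  exact Module.finrank_zero_of_subsingleton

variable [∀ s t : V, Finite (s ⟶ t)]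

lemma objDim_eq_add {S : ShortComplex (ModuleCat.{0} (Alg R))} (hS : S.Exact)
    (h : Module.Finite (Alg R) S.X₂) (v : V) :
    objDim S.X₂ v = homRank S.f v + homRank S.g v := by
  let := complexModule (R := R) S.X₁
  have := complexModule_isScalarTower (R := R) S.X₁
  let := complexModule (R := R) S.X₂
  have := complexModule_isScalarTower (R := R) S.X₂
  let := complexModule (R := R) S.X₃
  have := complexModule_isScalarTower (R := R) S.X₃
  have : Module.Finite ℂ (Alg R) := finiteDimensional_alg R
  have : Module.Finite ℂ S.X₂ := Module.Finite.trans (Alg R) _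
  exact rankAt_add_rankAt S.f.hom S.g.hom
    ((ShortComplex.ShortExact.moduleCat_exact_iff_function_exact S).1 hS) v

lemma finite_of_mono {M N : ModuleCat.{0} (Alg R)} (f : M ⟶ N) [Mono f]
    (h : Module.Finite (Alg R) N) : Module.Finite (Alg R) M := by
  let := complexModule (R := R) M
  have := complexModule_isScalarTower (R := R) M
  let := complexModule (R := R) N
  have := complexModule_isScalarTower (R := R) N
  have : Module.Finite ℂ (Alg R) := finiteDimensional_alg R
  have : Module.Finite ℂ N := Module.Finite.trans (Alg R) _
  have : Module.Finite ℂ M := Module.Finite.of_injective (f.hom.restrictScalars ℂ)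
    ((ModuleCat.mono_iff_injective f).1 inferInstance)
  exact Module.Finite.of_restrictScalars_finite ℂ (Alg R) M

lemma finite_of_epi {M N : ModuleCat.{0} (Alg R)} (f : M ⟶ N) [Epi f]
    (h : Module.Finite (Alg R) M) : Module.Finite (Alg R) N :=
  Module.Finite.of_surjective f.hom ((ModuleCat.epi_iff_surjective f).1 inferInstance)

/-- The cohomology of an object of the derived category. -/
abbrev cohom (X : D R) (i : ℤ) : ModuleCat.{0} (Alg R) :=
  (DerivedCategory.homologyFunctor _ i).obj X

lemma finite_cohom {X : D R} (h : IsBounded R X) (i : ℤ) : Module.Finite (Alg R) (cohom X i) := by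
  obtain ⟨K, hK, -, ⟨e⟩⟩ := h
  let e' : cohom X i ≅ K.homology i := (DerivedCategory.homologyFunctor _ i).mapIso e ≪≫
    (DerivedCategory.homologyFunctorFactors _ i).app K
  exact finite_of_mono e'.hom (finite_of_epi (K.homologyπ i) (finite_of_mono (K.iCycles i) (hK i)))

lemma finite_support_cohom {X : D R} (h : IsBounded R X) :
    {i | ¬ Subsingleton (cohom X i)}.Finite := by
  obtain ⟨K, -, ⟨a, b, hab⟩, ⟨e⟩⟩ := h
  refine (Set.finite_Icc a b).subset fun i hi => ?_
  by_contra hi'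
  refine hi (ModuleCat.subsingleton_of_isZero ?_)
  have h1 := hab i (by rw [Set.mem_Icc] at hi'; omega)
  let e' : cohom X i ≅ K.homology i := (DerivedCategory.homologyFunctor _ i).mapIso e ≪≫
    (DerivedCategory.homologyFunctorFactors _ i).app K
  exact ((K.exactAt_iff_isZero_homology i).1
    (HomologicalComplex.ExactAt.of_isZero (ModuleCat.isZero_of_subsingleton _))).of_iso e'

/-- The Euler characteristic at `v` of an object of the derived category.  The sum is finite for the
objects of `D^b(A)`. -/
def euler (X : D R) (v : V) : ℤ := ∑ᶠ i : ℤ, (i.negOnePow : ℤ) * (objDim (cohom X i) v : ℤ)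

/-- The Euler characteristic is additive on distinguished triangles, by the long exact sequence. -/
lemma euler_triangle {T : Triangle (D R)} (hT : T ∈ distTriang (D R)) (h₁ : IsBounded R T.obj₁)
    (h₂ : IsBounded R T.obj₂) (h₃ : IsBounded R T.obj₃) (v : V) :
    euler T.obj₂ v = euler T.obj₁ v + euler T.obj₃ v := by
  -- the ranks of the three kinds of maps in the long exact sequence of cohomology
  let a : ℤ → ℕ := fun i => homRank ((DerivedCategory.homologyFunctor _ i).map T.mor₁) v
  let b : ℤ → ℕ := fun i => homRank ((DerivedCategory.homologyFunctor _ i).map T.mor₂) v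
  let c : ℤ → ℕ := fun i => homRank (DerivedCategory.HomologySequence.δ T i (i + 1) rfl) v
  have e₂ : ∀ i, objDim (cohom T.obj₂ i) v = a i + b i := fun i =>
    objDim_eq_add (DerivedCategory.HomologySequence.exact₂ T hT i) (finite_cohom h₂ i) v
  have e₃ : ∀ i, objDim (cohom T.obj₃ i) v = b i + c i := fun i =>
    objDim_eq_add (DerivedCategory.HomologySequence.exact₃ T hT i (i + 1) rfl)
      (finite_cohom h₃ i) v
  have e₁ : ∀ i, objDim (cohom T.obj₁ (i + 1)) v = c i + a (i + 1) := fun i =>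
    objDim_eq_add (DerivedCategory.HomologySequence.exact₁ T hT i (i + 1) rfl)
      (finite_cohom h₁ (i + 1)) v
  have fin : ∀ {X : D R}, IsBounded R X → {i | objDim (cohom X i) v ≠ 0}.Finite := fun h =>
    (finite_support_cohom h).subset fun i hi hi' => hi (objDim_eq_zero hi' v)
  have fin_of : ∀ u : ℤ → ℕ, {i | u i ≠ 0}.Finite →
      (Function.support fun i : ℤ => (i.negOnePow : ℤ) * (u i : ℤ)).Finite := fun u hu =>
    hu.subset fun i hi h => hi (by simp [h])
  have fa : {i | a i ≠ 0}.Finite := (fin h₂).subset fun i (hi : a i ≠ 0) => by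
    change objDim (cohom T.obj₂ i) v ≠ 0
    rw [e₂]; omega
  have fb : {i | b i ≠ 0}.Finite := (fin h₂).subset fun i (hi : b i ≠ 0) => by
    change objDim (cohom T.obj₂ i) v ≠ 0
    rw [e₂]; omega
  have fc : {i | c i ≠ 0}.Finite := (fin h₃).subset fun i (hi : c i ≠ 0) => by
    change objDim (cohom T.obj₃ i) v ≠ 0
    rw [e₃]; omega
  let s : (ℤ → ℕ) → ℤ := fun u => ∑ᶠ i : ℤ, (i.negOnePow : ℤ) * (u i : ℤ)
  have s_add : ∀ u w : ℤ → ℕ, {i | u i ≠ 0}.Finite → {i | w i ≠ 0}.Finite →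
      s (fun i => u i + w i) = s u + s w := by
    intro u w hu hw
    simp only [s]
    rw [← finsum_add_distrib (fin_of u hu) (fin_of w hw)]
    exact finsum_congr fun i => by push_cast; ring
  have s_shift : ∀ u : ℤ → ℕ, s (fun i => u (i + 1)) = -s u := by
    intro u
    simp only [s]
    rw [← finsum_comp_equiv (f := fun i : ℤ => (i.negOnePow : ℤ) * (u i : ℤ))
      (Equiv.addRight (1 : ℤ)), ← finsum_neg_distrib]
    refine finsum_congr fun i => ?_
    simp [Int.negOnePow_succ]
  have s₂ : euler T.obj₂ v = s a + s b := by
    rw [← s_add a b fa fb]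
    exact finsum_congr fun i => by rw [e₂]
  have s₃ : euler T.obj₃ v = s b + s c := by
    rw [← s_add b c fb fc]
    exact finsum_congr fun i => by rw [e₃]
  have s₁ : -euler T.obj₁ v = s c - s a := by
    have h : euler T.obj₁ v = s fun i => objDim (cohom T.obj₁ i) v := rfl
    rw [h, ← s_shift, sub_eq_add_neg, ← s_shift a, ← s_add c _ fc]
    · exact congrArg s (funext e₁)
    · exact fa.preimage (Set.injOn_of_injective (add_left_injective (1 : ℤ)))
  rw [s₂, s₃]
  linarith

/-- The Euler characteristic as a homomorphism on `K₀(D^b(A))`. -/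
def eulerHom : K₀ R →+ (V → ℤ) :=
  QuotientAddGroup.lift _ (FreeAbelianGroup.lift fun X => euler X.1) <| by
    rw [triangleRelations, AddSubgroup.closure_le]
    rintro _ ⟨T, hT, h₁, h₂, h₃, rfl⟩
    rw [SetLike.mem_coe, AddMonoidHom.mem_ker, map_sub, map_sub, FreeAbelianGroup.lift_apply_of,
      FreeAbelianGroup.lift_apply_of, FreeAbelianGroup.lift_apply_of]
    funext v
    change euler T.obj₂ v - euler T.obj₁ v - euler T.obj₃ v = 0
    rw [euler_triangle hT h₁ h₂ h₃]; ring

lemma altSum_eq_finsum (d : DimSeq V) (v : V) :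
    altSum d v = ∑ᶠ i : ℤ, (i.negOnePow : ℤ) * (d i v : ℤ) := by
  have fin : ∀ d : DimSeq V,
      (Function.support fun i : ℤ => (i.negOnePow : ℤ) * (d i v : ℤ)).Finite := fun d =>
    d.support.finite_toSet.subset fun i hi => by
      rw [SetLike.mem_coe, Finsupp.mem_support_iff]
      intro h
      exact hi (by simp [h])
  induction d using Finsupp.induction_linear with
  | zero => simp
  | add d d' h h' =>
    rw [map_add, Pi.add_apply, h, h', ← finsum_add_distrib (fin d) (fin d')]
    exact finsum_congr fun i => by simp [mul_add]
  | single i f =>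
    rw [altSum_single, finsum_eq_single _ i]
    · simp
    · intro j hj
      simp [Finsupp.single_eq_of_ne hj]

/-- The class of a sequence determines its alternating sum, which is its Euler characteristic: the
cohomology of the zero point is the point itself. -/
lemma eulerHom_dimCls (d : DimSeq V) : eulerHom (dimCls R d) = altSum d := by
  have h1 : eulerHom (dimCls R d) = euler (DerivedCategory.Q.obj (CPoint.zero R d).cplx) :=
    FreeAbelianGroup.lift_apply_of _ _
  funext v
  have h2 : ∀ i, objDim (cohom (DerivedCategory.Q.obj (CPoint.zero R d).cplx) i) v = d i v := by
    intro i
    let K := (CPoint.zero R d).cplx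
    have i1 := K.isIso_iCycles i _ rfl (CPoint.zero_cplx_d d _ _)
    have i2 := K.isIso_homologyπ _ i rfl (CPoint.zero_cplx_d d _ _)
    let e : cohom (DerivedCategory.Q.obj K) i ≅ K.X i :=
      (DerivedCategory.homologyFunctorFactors _ i).app K ≪≫ (asIso (K.homologyπ i)).symm ≪≫
        asIso (K.iCycles i)
    rw [objDim_of_iso e]
    exact (objDim_of _ v).trans (((CPoint.zero R d).x i).frame.dimAt_eq v)
  rw [h1, euler, finsum_congr fun i => by rw [h2]]
  exact (altSum_eq_finsum d v).symm

end EulerCharacteristic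

/-! ### Biproducts over disjoint unions -/

section Biproducts

variable {𝒞 : Type*} [Category 𝒞] [Preadditive 𝒞] [HasFiniteBiproducts 𝒞]
  [HasBinaryBiproducts 𝒞] {I J : Type} [Fintype I] [Fintype J]

/-- A direct sum of two finite direct sums is a direct sum over the disjoint union. -/
def biproductSumIso (E : I ⊕ J → 𝒞) :
    (⨁ fun i => E (.inl i)) ⊞ (⨁ fun j => E (.inr j)) ≅ ⨁ E where
  hom := biprod.desc (biproduct.desc fun i => biproduct.ι E (.inl i))
    (biproduct.desc fun j => biproduct.ι E (.inr j))
  inv := biproduct.desc fun k => match k with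
    | .inl i => biproduct.ι (fun i => E (.inl i)) i ≫ biprod.inl
    | .inr j => biproduct.ι (fun j => E (.inr j)) j ≫ biprod.inr
  hom_inv_id := by
    refine biprod.hom_ext' _ _ (biproduct.hom_ext' _ _ fun i => ?_)
      (biproduct.hom_ext' _ _ fun j => ?_) <;> simp
  inv_hom_id := by
    refine biproduct.hom_ext' _ _ fun k => ?_
    rcases k with i | j <;> simp

end Biproducts

/-! ### Direct sums of simple disks -/

section Disks

variable {V : Type} [Fintype V] [DecidableEq V] [Quiver.{0} V] {R : AdmissibleRelations V}
variable {d d' d'' : DimSeq V}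

/-- The direct sum of two complexes is their biproduct. -/
lemma CPoint.directSum_iso (σ : Splitting d d' d'') (X : CPoint R d) (Y : CPoint R d') :
    Nonempty ((X.directSum σ Y).cplx ≅ X.cplx ⊞ Y.cplx) := by
  let e := X.directSumEquiv σ Y
  let f₁ : (X.directSum σ Y).cplx ⟶ X.cplx :=
    (X.directSum σ Y).homOf _ (fun i => LinearMap.fst (Alg R) _ _ ∘ₗ (e i).toLinearMap)
      (X.directSumEquiv_diff_fst σ Y)
  let f₂ : (X.directSum σ Y).cplx ⟶ Y.cplx :=
    (X.directSum σ Y).homOf _ (fun i => LinearMap.snd (Alg R) _ _ ∘ₗ (e i).toLinearMap)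
      (X.directSumEquiv_diff_snd σ Y)
  let f := biprod.lift f₁ f₂
  have hb : ∀ i, IsIso (f.f i) := by
    intro i
    have h₁ : ∀ y, (biprod.fst : X.cplx ⊞ Y.cplx ⟶ _).f i (f.f i y) = (e i y).1 := fun y =>
      LinearMap.congr_fun (congrArg (fun g => ModuleCat.Hom.hom (HomologicalComplex.Hom.f g i))
        (biprod.lift_fst f₁ f₂)) y
    have h₂ : ∀ y, (biprod.snd : X.cplx ⊞ Y.cplx ⟶ _).f i (f.f i y) = (e i y).2 := fun y =>
      LinearMap.congr_fun (congrArg (fun g => ModuleCat.Hom.hom (HomologicalComplex.Hom.f g i))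
        (biprod.lift_snd f₁ f₂)) y
    have h₃ : ∀ w : (X.cplx ⊞ Y.cplx).X i,
        (biprod.inl : _ ⟶ X.cplx ⊞ Y.cplx).f i ((biprod.fst : X.cplx ⊞ Y.cplx ⟶ _).f i w) +
          (biprod.inr : _ ⟶ X.cplx ⊞ Y.cplx).f i ((biprod.snd : X.cplx ⊞ Y.cplx ⟶ _).f i w) =
            w := fun w =>
      LinearMap.congr_fun (congrArg (fun g => ModuleCat.Hom.hom (HomologicalComplex.Hom.f g i))
        (biprod.total (X := X.cplx) (Y := Y.cplx))) w
    refine (ConcreteCategory.isIso_iff_bijective _).2 ⟨fun y y' h => ?_, fun w => ?_⟩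
    · refine (e i).injective (Prod.ext ?_ ?_)
      · rw [← h₁, ← h₁, h]
      · rw [← h₂, ← h₂, h]
    · let a : (X.x i).Mod := (biprod.fst : X.cplx ⊞ Y.cplx ⟶ _).f i w
      let b : (Y.x i).Mod := (biprod.snd : X.cplx ⊞ Y.cplx ⟶ _).f i w
      let y : ((X.directSum σ Y).x i).Mod := (e i).symm (a, b)
      have hy : e i y = (a, b) := (e i).apply_symm_apply (a, b)
      have hy₁ := (h₁ y).trans (congrArg Prod.fst hy)
      have hy₂ := (h₂ y).trans (congrArg Prod.snd hy)
      exact ⟨y, (h₃ _).symm.trans ((congrArg₂ (fun p q =>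
        (biprod.inl : _ ⟶ X.cplx ⊞ Y.cplx).f i p + (biprod.inr : _ ⟶ X.cplx ⊞ Y.cplx).f i q)
        hy₁ hy₂).trans (h₃ w))⟩
  have := HomologicalComplex.Hom.isIso_of_components f
  exact ⟨asIso f⟩

lemma IsSumOfSimpleDisks.of_iso {K L : Cx R} (h : IsSumOfSimpleDisks K) (e : L ≅ K) :
    IsSumOfSimpleDisks L := by
  obtain ⟨n, deg, S, hS, ⟨f⟩⟩ := h
  exact ⟨n, deg, S, hS, ⟨e ≪≫ f⟩⟩

lemma IsSumOfSimpleDisks.biprod {K L : Cx R} (hK : IsSumOfSimpleDisks K)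
    (hL : IsSumOfSimpleDisks L) : IsSumOfSimpleDisks (K ⊞ L) := by
  obtain ⟨n, deg, S, hS, ⟨e⟩⟩ := hK
  obtain ⟨m, deg', S', hS', ⟨e'⟩⟩ := hL
  let E : Fin n ⊕ Fin m → Cx R := fun k =>
    HomologicalComplex.double (𝟙 (Sum.elim S S' k : ModuleCat.{0} (Alg R)))
      (show (ComplexShape.up ℤ).Rel (Sum.elim deg deg' k) (Sum.elim deg deg' k + 1) from rfl)
  refine ⟨n + m, fun k => Sum.elim deg deg' (finSumFinEquiv.symm k),
    fun k => Sum.elim S S' (finSumFinEquiv.symm k), fun k => ?_, ⟨?_⟩⟩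
  · have h : ∀ j, IsSimpleModule (Alg R) (Sum.elim S S' j : ModuleCat.{0} (Alg R)) := by
      rintro (i | j)
      · exact hS i
      · exact hS' j
    exact h _
  · refine biprod.mapIso e e' ≪≫ biproductSumIso E ≪≫
      biproduct.whiskerEquiv (g := fun k => E (finSumFinEquiv.symm k)) finSumFinEquiv fun k =>
        eqToIso ?_
    rw [Equiv.symm_apply_apply]

lemma IsSumOfSimpleDisks.directSum (σ : Splitting d d' d'') {X : CPoint R d} {Y : CPoint R d'}
    (hX : IsSumOfSimpleDisks X.cplx) (hY : IsSumOfSimpleDisks Y.cplx) :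
    IsSumOfSimpleDisks (X.directSum σ Y).cplx :=
  (hX.biprod hY).of_iso (X.directSum_iso σ Y).some

lemma CPoint.subsingleton_of_eq_zero (X : CPoint R d) {i : ℤ} (h : d i = 0) :
    Subsingleton (X.x i).Mod := by
  have : ∀ v, IsEmpty (Fin (d i v)) := fun v => by rw [h]; exact Fin.isEmpty
  exact inferInstanceAs (Subsingleton (∀ v : V, Fin (d i v) → ℂ))

lemma isSumOfSimpleDisks_of_eq_zero (X : CPoint R d) (h : d = 0) :
    IsSumOfSimpleDisks X.cplx := by
  have hz : IsZero X.cplx := by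
    rw [IsZero.iff_id_eq_zero]
    ext i m
    exact (X.subsingleton_of_eq_zero (i := i) (by rw [h]; rfl)).elim _ _
  refine ⟨0, Fin.elim0, Fin.elim0, fun k => k.elim0, ⟨hz.iso ?_⟩⟩
  rw [IsZero.iff_id_eq_zero]
  exact biproduct.hom_ext _ _ fun k => k.elim0

/-- An acyclic complex in two consecutive degrees whose terms have dimension one is a simple disk.
The degrees are written `n + 1` and `n + 1 + 1` to match `CPoint.acyclic_iff`. -/
lemma isSumOfSimpleDisks_of_acyclic (X : CPoint R d) (hX : X.cplx.Acyclic) (n : ℤ)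
    (h₀ : ∀ i, i ≠ n + 1 → i ≠ n + 1 + 1 → d i = 0) (h₁ : ∑ v, d (n + 1) v = 1) :
    IsSumOfSimpleDisks X.cplx := by
  rw [X.acyclic_iff] at hX
  have hb : Function.Bijective (X.diff (n + 1)) := by
    constructor
    · rw [injective_iff_map_eq_zero]
      intro y hy
      obtain ⟨z, rfl⟩ := hX n y hy
      rw [(X.subsingleton_of_eq_zero (h₀ n (by omega) (by omega))).elim z 0, map_zero]
    · intro y
      exact hX (n + 1) y ((X.subsingleton_of_eq_zero (h₀ _ (by omega) (by omega))).elim _ _)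
  have hd : IsIso (X.cplx.d (n + 1) (n + 1 + 1)) := by
    rw [X.cplx_d]
    exact (ConcreteCategory.isIso_iff_bijective _).2 hb
  have hs : IsSimpleModule (Alg R) (X.x (n + 1)).Mod := by
    have hf : Module.finrank ℂ (X.x (n + 1)).Mod = 1 := by
      change Module.finrank ℂ (GradedSpace (d (n + 1))) = 1
      rw [Module.finrank_pi_fintype]
      simpa using h₁
    have hs' := isSimpleModule_iff_finrank_eq_one.2 hf
    have : Nontrivial (X.x (n + 1)).Mod := Module.nontrivial_of_finrank_pos (R := ℂ) (by omega)
    refine (isSimpleModule_iff ..).2 { eq_bot_or_eq_top := fun N => ?_ }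
    rcases eq_bot_or_eq_top (N.restrictScalars ℂ) with h | h
    · exact .inl ((Submodule.restrictScalars_eq_bot_iff ..).1 h)
    · exact .inr ((Submodule.restrictScalars_eq_top_iff ..).1 h)
  let S := X.cplx.X (n + 1)
  let f : HomologicalComplex.double (𝟙 S)
      (show (ComplexShape.up ℤ).Rel (n + 1) (n + 1 + 1) from rfl) ⟶ X.cplx :=
    HomologicalComplex.mkHomFromDouble _ (by omega) (𝟙 S) (X.cplx.d (n + 1) (n + 1 + 1)) rfl
      fun k _ => X.cplx.d_comp_d _ _ _
  have hf : ∀ i, IsIso (f.f i) := by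
    intro i
    by_cases h : i = n + 1
    · subst h
      rw [HomologicalComplex.mkHomFromDouble_f₀]
      infer_instance
    · by_cases h' : i = n + 1 + 1
      · subst h'
        rw [HomologicalComplex.mkHomFromDouble_f₁]
        infer_instance
      · have z₁ := HomologicalComplex.isZero_double_X (𝟙 S)
          (show (ComplexShape.up ℤ).Rel (n + 1) (n + 1 + 1) from rfl) i h h'
        have := X.subsingleton_of_eq_zero (h₀ i h h')
        have z₂ : IsZero (X.cplx.X i) := ModuleCat.isZero_of_subsingleton
          (ModuleCat.of (Alg R) (X.x i).Mod)
        exact ⟨0, z₁.eq_of_src _ _, z₂.eq_of_src _ _⟩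
  have := HomologicalComplex.Hom.isIso_of_components f
  exact ⟨1, fun _ => n + 1, fun _ => S, fun _ => hs,
    ⟨(asIso f).symm ≪≫ (biproductUniqueIso fun _ : Fin 1 =>
      HomologicalComplex.double (𝟙 S)
        (show (ComplexShape.up ℤ).Rel (n + 1) (n + 1 + 1) from rfl)).symm⟩⟩

end Disks

/-! ### Sequences up to addition of disks -/

section StableEquality

variable {V : Type} [Fintype V] [DecidableEq V] [Quiver.{0} V]

/-- The dimension vector sequence of a direct sum of complexes `B = B` with `B` of dimension vector
`b i` placed in the degrees `i - 1` and `i`. -/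
def diskSeq (b : DimSeq V) : DimSeq V := b + shiftSeq b

lemma diskSeq_apply (b : DimSeq V) (i : ℤ) : diskSeq b i = b i + b (i + 1) := rfl

lemma diskSeq_add (b b' : DimSeq V) : diskSeq (b + b') = diskSeq b + diskSeq b' := by
  rw [diskSeq, diskSeq, diskSeq, shiftSeq_add, add_add_add_comm]

lemma diskSeq_single (i : ℤ) (f : V → ℕ) :
    diskSeq (Finsupp.single i f) = Finsupp.single i f + Finsupp.single (i - 1) f := by
  rw [diskSeq, shiftSeq_single]

/-- Two sequences are stably equal if they agree after adding disks. -/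
def StablyEq (d d' : DimSeq V) : Prop := ∃ b b', d + diskSeq b = d' + diskSeq b'

lemma StablyEq.refl (d : DimSeq V) : StablyEq d d := ⟨0, 0, rfl⟩

lemma StablyEq.symm {d d' : DimSeq V} (h : StablyEq d d') : StablyEq d' d := by
  obtain ⟨b, b', h⟩ := h
  exact ⟨b', b, h.symm⟩

lemma StablyEq.trans {d d' d'' : DimSeq V} (h : StablyEq d d') (h' : StablyEq d' d'') :
    StablyEq d d'' := by
  obtain ⟨a, a', h⟩ := h
  obtain ⟨b, b', h'⟩ := h'
  refine ⟨a + b, a' + b', ?_⟩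
  rw [diskSeq_add, diskSeq_add, ← add_assoc, h, add_right_comm, h', add_right_comm, add_assoc]

lemma StablyEq.add {d d' e e' : DimSeq V} (h : StablyEq d d') (h' : StablyEq e e') :
    StablyEq (d + e) (d' + e') := by
  obtain ⟨a, a', h⟩ := h
  obtain ⟨b, b', h'⟩ := h'
  refine ⟨a + b, a' + b', ?_⟩
  rw [diskSeq_add, diskSeq_add, add_add_add_comm, h, h', add_add_add_comm]

/-- Two disks move a vector by two degrees. -/
lemma stablyEq_single_add_two (i : ℤ) (f : V → ℕ) :
    StablyEq (Finsupp.single (i + 2) f) (Finsupp.single i f) := by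
  refine ⟨Finsupp.single (i + 1) f, Finsupp.single (i + 2) f, ?_⟩
  rw [diskSeq_single, diskSeq_single, show i + 1 - 1 = i by ring, show i + 2 - 1 = i + 1 by ring]
  abel

lemma stablyEq_single_add_two_mul (i k : ℤ) (f : V → ℕ) :
    StablyEq (Finsupp.single (i + 2 * k) f) (Finsupp.single i f) := by
  induction k using Int.induction_on with
  | zero => rw [mul_zero, add_zero]; exact .refl _
  | succ k ih =>
    rw [show i + 2 * ((k : ℤ) + 1) = i + 2 * k + 2 by ring]
    exact (stablyEq_single_add_two _ f).trans ih
  | pred k ih =>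
    refine StablyEq.trans (StablyEq.symm ?_) ih
    rw [show i + 2 * (-(k : ℤ)) = i + 2 * (-(k : ℤ) - 1) + 2 by ring]
    exact stablyEq_single_add_two _ f

/-- Every sequence is stably equal to one concentrated in the degrees `0` and `1`. -/
lemma exists_stablyEq (d : DimSeq V) :
    ∃ p q : V → ℕ, StablyEq d (Finsupp.single 0 p + Finsupp.single 1 q) := by
  induction d using Finsupp.induction_linear with
  | zero => exact ⟨0, 0, by simpa using StablyEq.refl 0⟩
  | add d d' h h' =>
    obtain ⟨p, q, h⟩ := h
    obtain ⟨p', q', h'⟩ := h'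
    refine ⟨p + p', q + q', ?_⟩
    rw [Finsupp.single_add, Finsupp.single_add, add_add_add_comm]
    exact h.add h'
  | single i f =>
    rcases Int.even_or_odd' i with ⟨k, rfl | rfl⟩
    · refine ⟨f, 0, ?_⟩
      rw [Finsupp.single_zero, add_zero]
      simpa using stablyEq_single_add_two_mul 0 k f
    · refine ⟨0, f, ?_⟩
      rw [Finsupp.single_zero, zero_add, add_comm (2 * k)]
      exact stablyEq_single_add_two_mul 1 k f

lemma altSum_diskSeq (b : DimSeq V) : altSum (diskSeq b) = 0 := by
  rw [diskSeq, map_add, altSum_shiftSeq, add_neg_cancel]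

lemma StablyEq.altSum_eq {d d' : DimSeq V} (h : StablyEq d d') : altSum d = altSum d' := by
  obtain ⟨b, b', h⟩ := h
  simpa [altSum_diskSeq] using congrArg altSum h

/-- Two sequences with the same alternating sum agree after adding disks. -/
lemma stablyEq_of_altSum_eq {d d' : DimSeq V} (h : altSum d = altSum d') : StablyEq d d' := by
  obtain ⟨p, q, hd⟩ := exists_stablyEq d
  obtain ⟨p', q', hd'⟩ := exists_stablyEq d'
  refine hd.trans (StablyEq.trans ?_ hd'.symm)
  rw [hd.altSum_eq, hd'.altSum_eq] at h
  have hpq : p + q' = p' + q := by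
    funext v
    have hv := congrFun h v
    simp only [map_add, Pi.add_apply, altSum_single, Int.negOnePow_zero, Int.negOnePow_one,
      Units.val_one, Units.val_neg] at hv
    simp only [Pi.add_apply]
    omega
  refine ⟨Finsupp.single 1 q', Finsupp.single 1 q, ?_⟩
  rw [diskSeq_single, diskSeq_single, sub_self]
  calc _ = Finsupp.single (0 : ℤ) (p + q') + Finsupp.single 1 (q + q') := by
        rw [Finsupp.single_add, Finsupp.single_add]; abel
    _ = _ := by
        rw [hpq, Finsupp.single_add, Finsupp.single_add]; abel

end StableEquality

/-! ### Complexes of disks -/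

section DiskPoints

variable {V : Type} [Fintype V] [DecidableEq V] [Quiver.{0} V] {R : AdmissibleRelations V}

/-- The complex with terms `B i × B (i + 1)` and differential `(y, z) ↦ (z, 0)` is acyclic. -/
lemma exists_acyclic_diskSeq (B : ℤ → Type) [∀ i, AddCommGroup (B i)] [∀ i, Module ℂ (B i)]
    [∀ i, Module (Alg R) (B i)] [∀ i, IsScalarTower ℂ (Alg R) (B i)]
    [∀ i, Module.Finite ℂ (B i)] (b : DimSeq V) (hB : ∀ i w, dimAt R (B i) w = b i w) :
    ∃ X : CPoint R (diskSeq b), X.cplx.Acyclic ∧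
      ∀ i, Nonempty ((X.x i).Mod ≃ₗ[Alg R] B i × B (i + 1)) := by
  have hf : ∀ i, Nonempty (Frame R (B i × B (i + 1)) (diskSeq b i)) := fun i =>
    exists_frame fun w => by rw [dimAt_prod, hB, hB]; rfl
  let f := fun i => (hf i).some
  let D : ∀ i, B i × B (i + 1) →ₗ[Alg R] B (i + 1) × B (i + 1 + 1) := fun i =>
    LinearMap.inl _ _ _ ∘ₗ LinearMap.snd _ _ _
  let X := CPoint.ofFrames f D fun i m => rfl
  refine ⟨X, X.acyclic_iff.2 fun i y hy => ?_, fun i => ⟨(f i).toRepEquiv⟩⟩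
  obtain ⟨m, rfl⟩ := (f (i + 1)).toRepEquiv.symm.surjective y
  have h₁ := (CPoint.ofFrames_diff f D (fun i m => rfl) (i + 1) m).symm.trans hy
  have h₂ : D (i + 1) m = 0 := (f (i + 1 + 1)).toRepEquiv.symm.injective
    (h₁.trans (map_zero _).symm)
  have h₃ : m.2 = 0 := congrArg Prod.fst h₂
  refine ⟨(f i).toRepEquiv.symm (0, m.1), ?_⟩
  refine (CPoint.ofFrames_diff f D (fun i m => rfl) i (0, m.1)).trans (congrArg _ ?_)
  exact Prod.ext rfl h₃.symm

/-- The identification of the standard bases given by juxtaposition. -/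
def Splitting.ofEq {d d' d'' : DimSeq V} (h : d + d' = d'') : Splitting d d' d'' := fun i v =>
  finSumFinEquiv.trans (finCongr (by rw [← h]; rfl))

lemma Rep.dimAt_eq {d : V → ℕ} (x : Rep R d) (w : V) : dimAt R x.Mod w = d w := x.frame.dimAt_eq w

variable (R) in
/-- Every `diskSeq b` is the dimension vector sequence of a direct sum of simple disks. -/
lemma exists_isSumOfSimpleDisks_diskSeq (b : DimSeq V) :
    ∃ X : CPoint R (diskSeq b), IsSumOfSimpleDisks X.cplx := by
  have add : ∀ b b' : DimSeq V, (∃ X : CPoint R (diskSeq b), IsSumOfSimpleDisks X.cplx) →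
      (∃ X : CPoint R (diskSeq b'), IsSumOfSimpleDisks X.cplx) →
      ∃ X : CPoint R (diskSeq (b + b')), IsSumOfSimpleDisks X.cplx := by
    rintro b b' ⟨X, hX⟩ ⟨Y, hY⟩
    exact ⟨X.directSum (Splitting.ofEq (diskSeq_add b b').symm) Y, hX.directSum _ hY⟩
  have zero : ∃ X : CPoint R (diskSeq 0), IsSumOfSimpleDisks X.cplx :=
    ⟨CPoint.zero R _, isSumOfSimpleDisks_of_eq_zero _ rfl⟩
  induction b using Finsupp.induction_linear with
  | zero => exact zero
  | add b b' h h' => exact add b b' h h'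
  | single i f =>
    have one : ∀ v : V, ∃ X : CPoint R (diskSeq (Finsupp.single i (Pi.single v 1))),
        IsSumOfSimpleDisks X.cplx := by
      intro v
      obtain ⟨n, rfl⟩ : ∃ n, i = n + 1 + 1 := ⟨i - 2, by ring⟩
      set b : DimSeq V := Finsupp.single (n + 1 + 1) (Pi.single v 1) with hb
      obtain ⟨X, hX, -⟩ := exists_acyclic_diskSeq (R := R)
        (fun j => ((CPoint.zero R b).x j).Mod) b fun j w => Rep.dimAt_eq _ w
      refine ⟨X, isSumOfSimpleDisks_of_acyclic X hX n (fun j h₀ h₁ => ?_) ?_⟩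
      · rw [diskSeq_apply, hb, Finsupp.single_eq_of_ne h₁, Finsupp.single_eq_of_ne (by omega),
          add_zero]
      · rw [diskSeq_apply, hb, Finsupp.single_eq_of_ne (by omega), Finsupp.single_eq_same, zero_add]
        simp
    have mul : ∀ (v : V) (k : ℕ), ∃ X : CPoint R (diskSeq (Finsupp.single i (k • Pi.single v 1))),
        IsSumOfSimpleDisks X.cplx := by
      intro v k
      induction k with
      | zero => rw [zero_smul, Finsupp.single_zero]; exact zero
      | succ k ih => rw [succ_nsmul, Finsupp.single_add]; exact add _ _ ih (one v)
    have sum : ∀ s : Finset V,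
        ∃ X : CPoint R (diskSeq (Finsupp.single i (∑ v ∈ s, f v • Pi.single v 1))),
          IsSumOfSimpleDisks X.cplx := by
      intro s
      induction s using Finset.induction_on with
      | empty => rw [Finset.sum_empty, Finsupp.single_zero]; exact zero
      | insert v s hv ih =>
        rw [Finset.sum_insert hv, Finsupp.single_add]; exact add _ _ (mul v _) ih
    have hf : ∑ v, f v • Pi.single v 1 = f := by
      funext w
      simp [Finset.sum_apply, Pi.single_apply]
    rw [← hf]
    exact sum _

lemma projDim_shiftSeq (e : DimSeq V) : projDim R (shiftSeq e) = shiftSeq (projDim R e) :=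
  Finsupp.ext fun _ => rfl

lemma projDim_diskSeq (e : DimSeq V) : projDim R (diskSeq e) = diskSeq (projDim R e) := by
  rw [diskSeq, projDim_add, projDim_shiftSeq, diskSeq]

variable [∀ s t : V, Finite (s ⟶ t)]

variable (R) in
/-- Every `diskSeq b` is the projective dimension sequence of an acyclic complex. -/
lemma exists_acyclic_pPoint_diskSeq (b : DimSeq V) :
    ∃ X : PPoint R (diskSeq b), X.toCPoint.cplx.Acyclic := by
  obtain ⟨X, hX, hB⟩ := exists_acyclic_diskSeq (R := R) (fun i => FreeOn R (b i)) (projDim R b)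
    fun i w => dimAt_freeOn R (b i) w
  have h : ∃ X : CPoint R (projDim R (diskSeq b)), X.cplx.Acyclic ∧
      ∀ i, Nonempty ((X.x i).Mod ≃ₗ[Alg R] FreeOn R (b i) × FreeOn R (b (i + 1))) := by
    rw [projDim_diskSeq]
    exact ⟨X, hX, hB⟩
  obtain ⟨Y, hY, hB⟩ := h
  exact ⟨⟨Y, fun i => ⟨(hB i).some.trans
    (powEquiv (Alg R) (fun v => ProjMod R v) fun v => finSumFinEquiv).symm⟩⟩, hY⟩

end DiskPoints

/-! ### Directedness of the index sets -/

section Directedness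

variable {V : Type} [Fintype V] [DecidableEq V] [Quiver.{0} V] {R : AdmissibleRelations V}
variable {κ : K₀ R}

lemma dimCls_diskSeq (b : DimSeq V) : dimCls R (diskSeq b) = 0 := by
  rw [diskSeq, dimCls_add, dimCls_shiftSeq, add_neg_cancel]

lemma DimFiber.LE.refl (d : DimFiber κ) : d.LE d :=
  ⟨le_rfl, CPoint.zero R _, isSumOfSimpleDisks_of_eq_zero _ (tsub_self _)⟩

lemma DimFiber.LE.trans {d₁ d₂ d₃ : DimFiber κ} (h : d₁.LE d₂) (h' : d₂.LE d₃) : d₁.LE d₃ := by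
  obtain ⟨h, M, hM⟩ := h
  obtain ⟨h', N, hN⟩ := h'
  refine ⟨h.trans h', M.directSum (Splitting.ofEq ?_) N, hM.directSum _ hN⟩
  rw [add_comm]
  exact tsub_add_tsub_cancel h' h

lemma DimFiber.LE.of_eq_add {d₁ d₂ : DimFiber κ} {b : DimSeq V} (h : d₂.1 = d₁.1 + diskSeq b) :
    d₁.LE d₂ := by
  have h' : d₂.1 - d₁.1 = diskSeq b := by rw [h, add_tsub_cancel_left]
  refine ⟨h ▸ le_self_add, ?_⟩
  rw [h']
  exact exists_isSumOfSimpleDisks_diskSeq R b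

/-- The order on the fibre `dim⁻¹(κ)` is directed: sequences of the same class have the same
alternating sum, and so they agree after adding simple disks. -/
lemma DimFiber.exists_le [∀ s t : V, Finite (s ⟶ t)] (d₁ d₂ : DimFiber κ) :
    ∃ d₃ : DimFiber κ, d₁.LE d₃ ∧ d₂.LE d₃ := by
  obtain ⟨b, b', h⟩ := stablyEq_of_altSum_eq (d := d₁.1) (d' := d₂.1) <| by
    rw [← eulerHom_dimCls (R := R), ← eulerHom_dimCls (R := R), d₁.2, d₂.2]
  exact ⟨⟨d₁.1 + diskSeq b, by rw [dimCls_add, dimCls_diskSeq, add_zero, d₁.2]⟩, .of_eq_add rfl,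
    .of_eq_add h⟩

variable [∀ s t : V, Finite (s ⟶ t)]

lemma ProjFiber.LE.of_eq_add {e₁ e₂ : ProjFiber κ} {b : DimSeq V} (h : e₂.1 = e₁.1 + diskSeq b) :
    e₁.LE e₂ := by
  have h' : e₂.1 - e₁.1 = diskSeq b := by rw [h, add_tsub_cancel_left]
  refine ⟨h ▸ le_self_add, ?_⟩
  rw [h']
  exact exists_acyclic_pPoint_diskSeq R b

/-- Since the Cartan matrix is injective, the class of `d(e)` determines the alternating sum of the
projective dimension sequence `e` itself. -/
lemma ProjFiber.altSum_eq (hR : HasFiniteGlobalDimension R) (e₁ e₂ : ProjFiber κ) :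
    altSum e₁.1 = altSum e₂.1 := by
  refine cartan_injective hR ?_
  rw [← altSum_projDim, ← altSum_projDim, ← eulerHom_dimCls (R := R), ← eulerHom_dimCls (R := R),
    e₁.2, e₂.2]

/-- Finitely many projective dimension sequences in a fibre have a common upper bound. -/
lemma ProjFiber.exists_le (hR : HasFiniteGlobalDimension R) {ι : Type} (s : Finset ι)
    (e : ι → ProjFiber κ) (e₀ : ProjFiber κ) : ∃ e' : ProjFiber κ, ∀ i ∈ s, (e i).LE e' := by
  choose b b' h using fun i => stablyEq_of_altSum_eq (ProjFiber.altSum_eq hR e₀ (e i))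
  refine ⟨⟨e₀.1 + diskSeq (∑ i ∈ s, b i), by
    rw [projDim_add, projDim_diskSeq, dimCls_add, dimCls_diskSeq, add_zero, e₀.2]⟩, fun i hi => ?_⟩
  classical
  refine .of_eq_add (b := b' i + ∑ j ∈ s.erase i, b j) ?_
  rw [diskSeq_add, ← add_assoc, ← h, add_assoc, ← diskSeq_add, Finset.add_sum_erase s b hi]

end Directedness

/-! ### Direct sums and the Zariski topology -/

section Zariski

variable {V : Type} [Fintype V] [DecidableEq V] [Quiver.{0} V] {R : AdmissibleRelations V}
variable {d d' d'' : DimSeq V}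

lemma IsPoly.isOpen_ne_zero {u : CPoint R d → ℂ} (hu : IsPoly u) : IsOpen {X | u X ≠ 0} := by
  obtain ⟨g, hg⟩ := hu
  simp only [hg]
  exact .basic _ ⟨g, rfl⟩

lemma IsPoly.isClosed_eq {u v : CPoint R d → ℂ} (hu : IsPoly u) (hv : IsPoly v) :
    IsClosed {X | u X = v X} := by
  have h := (hu.add ((isPoly_const (-1)).mul hv)).isOpen_ne_zero
  refine ⟨?_⟩
  convert h using 1
  ext X
  simp [← sub_eq_add_neg, sub_eq_zero]

lemma IsPolyMorphism.continuous {f : CPoint R d → CPoint R d'} (hf : IsPolyMorphism f) :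
    Continuous f := by
  refine continuous_generateFrom_iff.2 ?_
  rintro _ ⟨h, rfl⟩
  exact (IsPoly.comp ⟨h, fun _ => rfl⟩ hf).isOpen_ne_zero

lemma isPoly_blockDiag {a b c a' b' c' : ℕ} (σ : Fin a ⊕ Fin b ≃ Fin c)
    (τ : Fin a' ⊕ Fin b' ≃ Fin c') {A : CPoint R d → Matrix (Fin a) (Fin a') ℂ}
    (B : Matrix (Fin b) (Fin b') ℂ) (hA : ∀ i j, IsPoly fun X => A X i j) (k : Fin c)
    (l : Fin c') : IsPoly fun X => blockDiag σ τ (A X) B k l := by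
  obtain ⟨k, rfl⟩ := σ.surjective k
  obtain ⟨l, rfl⟩ := τ.surjective l
  rcases k with k | k <;> rcases l with l | l <;> simp [blockDiag, hA, isPoly_const]

lemma isPolyMorphism_directSum (σ : Splitting d d' d'') (M : CPoint R d') :
    IsPolyMorphism fun X => X.directSum σ M := by
  rintro (⟨i, s, t, a, k⟩ | ⟨i, v, k⟩)
  · exact isPoly_blockDiag (σ i t) (σ i s) ((M.x i).1 a) (isPoly_x i a) k.1 k.2
  · exact isPoly_blockDiag (σ (i + 1) v) (σ i v) (M.δ i v) (isPoly_δ i v) k.1 k.2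

/-- The upper left block of a matrix. -/
def upperLeft {a b c a' b' c' : ℕ} (σ : Fin a ⊕ Fin b ≃ Fin c) (τ : Fin a' ⊕ Fin b' ≃ Fin c')
    (A : Matrix (Fin c) (Fin c') ℂ) : Matrix (Fin a) (Fin a') ℂ :=
  A.submatrix (fun k => σ (.inl k)) fun l => τ (.inl l)

lemma upperLeft_blockDiag {a b c a' b' c' : ℕ} (σ : Fin a ⊕ Fin b ≃ Fin c)
    (τ : Fin a' ⊕ Fin b' ≃ Fin c') (A : Matrix (Fin a) (Fin a') ℂ)
    (B : Matrix (Fin b) (Fin b') ℂ) : upperLeft σ τ (blockDiag σ τ A B) = A := by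
  ext k l
  simp [upperLeft, blockDiag]

/-- The coordinate of a direct sum which carries a given coordinate of the first summand. -/
def Splitting.coordInl (σ : Splitting d d' d'') : Coord d → Coord d''
  | .inl ⟨i, s, t, a, k⟩ => .inl ⟨i, s, t, a, σ i t (.inl k.1), σ i s (.inl k.2)⟩
  | .inr ⟨i, v, k⟩ => .inr ⟨i, v, σ (i + 1) v (.inl k.1), σ i v (.inl k.2)⟩

lemma CPoint.directSum_coord (σ : Splitting d d' d'') (X : CPoint R d) (M : CPoint R d')
    (c : Coord d) : (X.directSum σ M).coord (σ.coordInl c) = X.coord c := by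
  rcases c with ⟨i, s, t, a, k⟩ | ⟨i, v, k⟩
  · exact congrFun (congrFun (upperLeft_blockDiag (σ i t) (σ i s) ((X.x i).1 a) ((M.x i).1 a)) k.1)
      k.2
  · exact congrFun (congrFun (upperLeft_blockDiag (σ (i + 1) v) (σ i v) (X.δ i v) (M.δ i v)) k.1)
      k.2

lemma CPoint.ext_coord {X Y : CPoint R d} (h : ∀ c, X.coord c = Y.coord c) : X = Y := by
  refine CPoint.ext (funext fun i => Subtype.ext ?_) (funext fun i => funext fun v => ?_)
  · funext s t a
    ext k l
    exact h (.inl ⟨i, s, t, a, k, l⟩)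
  · ext k l
    exact h (.inr ⟨i, v, k, l⟩)

lemma CPoint.directSum_injective (σ : Splitting d d' d'') (M : CPoint R d') :
    Function.Injective fun X : CPoint R d => X.directSum σ M := fun X Y h =>
  CPoint.ext_coord fun c => by
    rw [← X.directSum_coord σ M, ← Y.directSum_coord σ M]
    exact congrArg (fun Z : CPoint R d'' => Z.coord (σ.coordInl c)) h

/-- The points `X ⊕ M` with `M` fixed are those whose matrices are block diagonal with second
block that of `M`. -/
lemma CPoint.mem_range_directSum_iff (σ : Splitting d d' d'') (M : CPoint R d')
    (W : CPoint R d'') : W ∈ Set.range (fun X : CPoint R d => X.directSum σ M) ↔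
      (∀ (i : ℤ) (s t : V) (a : s ⟶ t), blockDiag (σ i t) (σ i s)
        (upperLeft (σ i t) (σ i s) ((W.x i).1 a)) ((M.x i).1 a) = (W.x i).1 a) ∧
      ∀ (i : ℤ) (v : V), blockDiag (σ (i + 1) v) (σ i v)
        (upperLeft (σ (i + 1) v) (σ i v) (W.δ i v)) (M.δ i v) = W.δ i v := by
  constructor
  · rintro ⟨X, rfl⟩
    refine ⟨fun i s t a => ?_, fun i v => ?_⟩
    · exact congrArg (fun A => blockDiag (σ i t) (σ i s) A ((M.x i).1 a))
        (upperLeft_blockDiag _ _ _ _)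
    · exact congrArg (fun A => blockDiag (σ (i + 1) v) (σ i v) A (M.δ i v))
        (upperLeft_blockDiag _ _ _ _)
  · rintro ⟨hx, hδ⟩
    refine ⟨⟨fun i => ⟨fun s t a => upperLeft (σ i t) (σ i s) ((W.x i).1 a), fun s t r hr => ?_⟩,
      fun i v => upperLeft (σ (i + 1) v) (σ i v) (W.δ i v), fun i s t a => ?_, fun i v => ?_⟩, ?_⟩
    · have hW : (W.x i).1 = fun s t a => blockDiag (σ i t) (σ i s)
          (upperLeft (σ i t) (σ i s) ((W.x i).1 a)) ((M.x i).1 a) := by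
        funext s t a
        exact (hx i s t a).symm
      have h := (W.x i).2 s t r hr
      rw [hW] at h
      simp only [Finsupp.sum, pathMat_blockDiag, blockDiag_sum] at h
      rw [Finsupp.sum, ← upperLeft_blockDiag (σ i t) (σ i s) (∑ p ∈ r.support, _) _, h]
      rfl
    · have h := ((congrArg₂ (· * ·) (hδ i t) (hx i s t a)).trans (W.comm i a)).trans
        (congrArg₂ (· * ·) (hx (i + 1) s t a) (hδ i s)).symm
      simp only [blockDiag_mul] at h
      have h' := congrArg (upperLeft (σ (i + 1) t) (σ i s)) h
      rwa [upperLeft_blockDiag, upperLeft_blockDiag] at h'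
    · have h := W.sq i v
      rw [← hδ, ← hδ i, blockDiag_mul] at h
      have h' := congrArg (upperLeft (σ (i + 1 + 1) v) (σ i v)) h
      rw [upperLeft_blockDiag] at h'
      exact h'
    · refine CPoint.ext (funext fun i => Subtype.ext ?_) (funext fun i => funext fun v => hδ i v)
      funext s t a
      exact hx i s t a

lemma CPoint.isClosed_range_directSum (σ : Splitting d d' d'') (M : CPoint R d') :
    IsClosed (Set.range fun X : CPoint R d => X.directSum σ M) := by
  have h : (Set.range fun X : CPoint R d => X.directSum σ M) =
      (⋂ (i : ℤ) (s : V) (t : V) (a : s ⟶ t) (k : _) (l : _), {W : CPoint R d'' |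
        blockDiag (σ i t) (σ i s) (upperLeft (σ i t) (σ i s) ((W.x i).1 a)) ((M.x i).1 a) k l =
          (W.x i).1 a k l}) ∩
      ⋂ (i : ℤ) (v : V) (k : _) (l : _), {W : CPoint R d'' |
        blockDiag (σ (i + 1) v) (σ i v)
        (upperLeft (σ (i + 1) v) (σ i v) (W.δ i v)) (M.δ i v) k l = W.δ i v k l} := by
    ext W
    rw [CPoint.mem_range_directSum_iff]
    simp only [Set.mem_inter_iff, Set.mem_iInter, Set.mem_ofPred_eq, ← Matrix.ext_iff]
  rw [h]
  refine IsClosed.inter ?_ ?_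
  · refine isClosed_iInter fun i => isClosed_iInter fun s => isClosed_iInter fun t =>
      isClosed_iInter fun a => isClosed_iInter fun k => isClosed_iInter fun l => ?_
    exact (isPoly_blockDiag (σ i t) (σ i s) ((M.x i).1 a) (fun _ _ => isPoly_x i a _ _)
      k l).isClosed_eq (isPoly_x i a k l)
  · refine isClosed_iInter fun i => isClosed_iInter fun v =>
      isClosed_iInter fun k => isClosed_iInter fun l => ?_
    exact (isPoly_blockDiag (σ (i + 1) v) (σ i v) (M.δ i v) (fun _ _ => isPoly_δ i v _ _)
      k l).isClosed_eq (isPoly_δ i v k l)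

lemma IsLocallyClosed.isConstructibleSet {T : Type} [TopologicalSpace T] {S : Set T}
    (h : IsLocallyClosed S) : IsConstructibleSet S :=
  ⟨{S}, Set.finite_singleton S, by rintro _ rfl; exact h, (Set.sUnion_singleton S).symm⟩

/-- A map which is polynomial on a subset is a morphism of varieties there. -/
lemma isMorphismOn_of_eval {O : Set (CPoint R d)} {f : CPoint R d → CPoint R d'}
    (h : ∀ c, ∃ g : MvPolynomial (Coord d) ℂ, ∀ X ∈ O,
      (f X).coord c = MvPolynomial.eval X.coord g) :
    IsMorphismOn O f := by
  intro X _ c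
  obtain ⟨g, hg⟩ := h c
  exact ⟨g, 1, by simp, fun Y hY _ => by rw [hg Y hY]; simp⟩

end Zariski

/-! ### Equality in the direct limits -/

section Limit

variable {V : Type} [Fintype V] [DecidableEq V] [Quiver.{0} V] {R : AdmissibleRelations V}
variable {κ : K₀ R}

lemma ProjectiveSystem.incl_map (P : ProjectiveSystem κ) {e e' : ProjFiber κ} (h : e.LE e')
    (X : PPoint R e.1) : P.incl e' (P.map h X) = P.incl e X :=
  (Quot.sound ⟨h, rfl⟩ : P.incl e X = P.incl e' (P.map h X)).symm

lemma ProjectiveSystem.dIso_map (P : ProjectiveSystem κ) {e e' : ProjFiber κ} (h : e.LE e')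
    (X : PPoint R e.1) : DIso (P.map h X).toCPoint X.toCPoint :=
  DIso.directSum (P.split h) X.toCPoint (P.summand_acyclic h)

lemma ProjectiveSystem.isPolyMorphism_map (P : ProjectiveSystem κ) {e e' : ProjFiber κ}
    (h : e.LE e') {d : DimSeq V} {f : CPoint R d → PPoint R e.1}
    (hf : IsPolyMorphism fun X => (f X).toCPoint) :
    IsPolyMorphism fun X => (P.map h (f X)).toCPoint :=
  (isPolyMorphism_directSum (P.split h) (P.summand h).toCPoint).comp hf

namespace ComplexSystem

variable (C : ComplexSystem κ)

lemma incl_map {d d' : DimFiber κ} (h : d.LE d') (X : CPoint R d.1) :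
    C.incl d' (C.map h X) = C.incl d X :=
  (Quot.sound ⟨h, rfl⟩ : C.incl d X = C.incl d' (C.map h X)).symm

lemma dIso_map {d d' : DimFiber κ} (h : d.LE d') (X : CPoint R d.1) : DIso (C.map h X) X :=
  DIso.directSum (C.split h) X (C.summand_disks h).acyclic

lemma map_injective {d d' : DimFiber κ} (h : d.LE d') : Function.Injective (C.map h) :=
  CPoint.directSum_injective (C.split h) (C.summand h)

variable [∀ s t : V, Finite (s ⟶ t)]

/-- Two points are equal in the limit if and only if they become equal at some stage. -/
lemma exists_map_eq_of_incl_eq {d d' : DimFiber κ} {X : CPoint R d.1} {X' : CPoint R d'.1}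
    (h : C.incl d X = C.incl d' X') :
    ∃ (m : DimFiber κ) (hm : d.LE m) (hm' : d'.LE m), C.map hm X = C.map hm' X' := by
  suffices ∀ p q : Σ d : DimFiber κ, CPoint R d.1,
      Relation.EqvGen (fun p q => ∃ h : p.1.LE q.1, C.map h p.2 = q.2) p q →
      ∃ (m : DimFiber κ) (hm : p.1.LE m) (hm' : q.1.LE m), C.map hm p.2 = C.map hm' q.2 from
    this ⟨d, X⟩ ⟨d', X'⟩ (Quot.eqvGen_exact h)
  intro p q hpq
  induction hpq with
  | rel p q hpq =>
    obtain ⟨h, hpq⟩ := hpq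
    exact ⟨q.1, h, .refl _, hpq.trans (C.map_self _ _).symm⟩
  | refl p => exact ⟨p.1, .refl _, .refl _, rfl⟩
  | symm p q _ ih =>
    obtain ⟨m, h, h', ih⟩ := ih
    exact ⟨m, h', h, ih.symm⟩
  | trans p q r _ _ ih₁ ih₂ =>
    obtain ⟨m, hp, hq, ih₁⟩ := ih₁
    obtain ⟨m', hq', hr, ih₂⟩ := ih₂
    obtain ⟨n, hm, hm'⟩ := DimFiber.exists_le m m'
    refine ⟨n, hp.trans hm, hr.trans hm', ?_⟩
    calc C.map (hp.trans hm) p.2 = C.map hm (C.map hp p.2) := (C.map_map hp hm _ _).symm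
      _ = C.map hm (C.map hq q.2) := by rw [ih₁]
      _ = C.map (hq.trans hm) q.2 := C.map_map hq hm _ _
      _ = C.map hm' (C.map hq' q.2) := (C.map_map hq' hm' _ _).symm
      _ = C.map hm' (C.map hr r.2) := by rw [ih₂]
      _ = C.map (hr.trans hm') r.2 := C.map_map hr hm' _ _

lemma incl_injective (d : DimFiber κ) : Function.Injective (C.incl d) := fun X X' h => by
  obtain ⟨m, hm, hm', h⟩ := C.exists_map_eq_of_incl_eq h
  exact C.map_injective hm h

lemma map_eq_map_iff {d d' m : DimFiber κ} (h : d.LE m) (h' : d'.LE m) (X : CPoint R d.1)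
    (X' : CPoint R d'.1) : C.map h X = C.map h' X' ↔ C.incl d X = C.incl d' X' := by
  rw [← C.incl_map h, ← C.incl_map h', (C.incl_injective m).eq_iff]

lemma dIso_of_incl_eq {d d' : DimFiber κ} {X : CPoint R d.1} {X' : CPoint R d'.1}
    (h : C.incl d X = C.incl d' X') : DIso X X' := by
  obtain ⟨m, hm, hm', h⟩ := C.exists_map_eq_of_incl_eq h
  have h₁ := C.dIso_map hm X
  rw [h] at h₁
  exact h₁.symm.trans (C.dIso_map hm' X')

/-- The intersection of `C^b(A, d)` and `C^b(A, d')` in the limit is closed in `C^b(A, d)`. -/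
lemma isClosed_mem_range_incl (d d' : DimFiber κ) :
    IsClosed {X : CPoint R d.1 | C.incl d X ∈ Set.range (C.incl d')} := by
  obtain ⟨m, hm, hm'⟩ := DimFiber.exists_le d d'
  have h : {X : CPoint R d.1 | C.incl d X ∈ Set.range (C.incl d')} =
      C.map hm ⁻¹' Set.range (C.map hm') := by
    ext X
    exact exists_congr fun Y => (C.map_eq_map_iff hm' hm Y X).symm
  rw [h]
  exact (CPoint.isClosed_range_directSum _ _).preimage (isPolyMorphism_directSum _ _).continuous

/-- The coordinates of a point of `C^b(A, d')` are polynomial functions of any point of `C^b(A, d)`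
which has the same image in the limit. -/
lemma exists_coord_eq_eval (d d' : DimFiber κ) (c : Coord d'.1) :
    ∃ g : MvPolynomial (Coord d.1) ℂ, ∀ (X : CPoint R d.1) (Y : CPoint R d'.1),
      C.incl d' Y = C.incl d X → Y.coord c = MvPolynomial.eval X.coord g := by
  obtain ⟨m, hm, hm'⟩ := DimFiber.exists_le d d'
  obtain ⟨g, hg⟩ := isPolyMorphism_directSum (C.split hm) (C.summand hm)
    ((C.split hm').coordInl c)
  refine ⟨g, fun X Y h => ?_⟩
  rw [← Y.directSum_coord (C.split hm') (C.summand hm') c, ← hg]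
  exact congrArg (fun Z : CPoint R m.1 => Z.coord ((C.split hm').coordInl c))
    ((C.map_eq_map_iff hm' hm Y X).2 h)

lemma exists_eval_eq_eval (d d' : DimFiber κ) (q : MvPolynomial (Coord d'.1) ℂ) :
    ∃ g : MvPolynomial (Coord d.1) ℂ, ∀ (X : CPoint R d.1) (Y : CPoint R d'.1),
      C.incl d' Y = C.incl d X → MvPolynomial.eval Y.coord q = MvPolynomial.eval X.coord g := by
  choose p hp using C.exists_coord_eq_eval d d'
  refine ⟨MvPolynomial.bind₁ p q, fun X Y h => ?_⟩
  rw [MvPolynomial.eval, MvPolynomial.eval, MvPolynomial.eval₂Hom_bind₁]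
  congr 2
  funext c
  exact hp c X Y h

end ComplexSystem

end Limit

/-! ### Constructible resolutions on the direct limit -/

section ConstructibleResolution

variable {V : Type} [Fintype V] [DecidableEq V] [Quiver.{0} V] [∀ s t : V, Finite (s ⟶ t)]
  {R : AdmissibleRelations V} {κ : K₀ R}

/-- The map is defined by numbering the varieties `C^b(A, d)` of the fibre: a point of the limit is
represented in the first variety in which it occurs, and resolved there. -/
lemma exists_constructible_resolution (hR : HasFiniteGlobalDimension R) (C : ComplexSystem κ)
    (P : ProjectiveSystem κ) : ∃ φ : C.Lim → P.Lim, ∀ d : DimFiber κ,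
      ∃ (e : ProjFiber κ) (f : CPoint R d.1 → PPoint R e.1),
        IsConstructibleMap (fun X => (f X).toCPoint) ∧
          (∀ X, φ (C.incl d X) = P.incl e (f X)) ∧ ∀ X, DIso (f X).toCPoint X := by
  classical
  obtain ⟨c, hc⟩ := Countable.exists_injective_nat (DimFiber κ)
  have res : ∀ d : DimFiber κ, ∃ (e : ProjFiber κ) (f : CPoint R d.1 → PPoint R e.1),
      IsPolyMorphism (fun X => (f X).toCPoint) ∧ ∀ X, DIso (f X).toCPoint X := fun d => by
    obtain ⟨n, e, f, he, hf, hf'⟩ := exists_projective_resolution hR d.1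
    exact ⟨⟨e, by rw [he, dimCls_iterSeq, d.2]⟩, f, hf, hf'⟩
  choose E g hg hg' using res
  have first : ∀ p : C.Lim, ∃ (q : DimFiber κ) (Y : CPoint R q.1), C.incl q Y = p ∧
      ∀ d, p ∈ Set.range (C.incl d) → c q ≤ c d := fun p => by
    have hne : ({d | p ∈ Set.range (C.incl d)} : Set (DimFiber κ)).Nonempty := by
      obtain ⟨⟨d, X⟩, rfl⟩ := Quot.exists_rep p
      exact ⟨d, X, rfl⟩
    obtain ⟨Y, hY⟩ := Function.argminOn_mem c _ hne
    exact ⟨_, Y, hY, fun d hd => Function.argminOn_le c _ hd⟩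
  choose q rep hrep hmin using first
  refine ⟨fun p => P.incl (E (q p)) (g (q p) (rep p)), fun d => ?_⟩
  have hle : ∀ X, c (q (C.incl d X)) ≤ c d := fun X => hmin _ d ⟨X, rfl⟩
  have hfin : {d' | c d' ≤ c d}.Finite := (Set.finite_Iic (c d)).preimage hc.injOn
  obtain ⟨e, he⟩ := ProjFiber.exists_le hR hfin.toFinset E (E d)
  replace he : ∀ d', c d' ≤ c d → (E d').LE e := fun d' h => he d' (hfin.mem_toFinset.2 h)
  -- finitely many varieties occur for points of `C^b(A, d)`, so their resolutions have a common
  -- target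
  let F : ∀ d' : DimFiber κ, c d' ≤ c d → CPoint R d'.1 → PPoint R e.1 := fun d' h Y =>
    P.map (he d' h) (g d' Y)
  have hF : ∀ d' h, IsPolyMorphism fun Y => (F d' h Y).toCPoint := fun d' h =>
    P.isPolyMorphism_map _ (hg d')
  refine ⟨e, fun X => F (q (C.incl d X)) (hle X) (rep (C.incl d X)), ?_,
    fun X => (P.incl_map _ _).symm,
    fun X => ((P.dIso_map _ _).trans (hg' _ _)).trans (C.dIso_of_incl_eq (hrep _))⟩
  -- the points which also occur in the variety with number `k`; they form a closed subset
  let Z : ℕ → Set (CPoint R d.1) := fun k =>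
    {X | ∃ d', c d' = k ∧ C.incl d X ∈ Set.range (C.incl d')}
  have hZ : ∀ k, IsClosed (Z k) := fun k => by
    by_cases h : ∃ d', c d' = k
    · obtain ⟨d', rfl⟩ := h
      convert C.isClosed_mem_range_incl d d' using 1
      ext X
      constructor
      · rintro ⟨d'', h, hX⟩
        rwa [hc h] at hX
      · exact fun hX => ⟨d', rfl, hX⟩
    · have hk : Z k = ∅ := Set.eq_empty_of_forall_notMem fun X hX => h (hX.imp fun _ => And.left)
      rw [hk]
      exact isClosed_empty
  have hO : ∀ k, {X | c (q (C.incl d X)) = k} = Z k ∩ ⋂ j : Fin k, (Z j)ᶜ := fun k => by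
    ext X
    simp only [Set.mem_inter_iff, Set.mem_iInter, Set.mem_compl_iff, Set.mem_ofPred_eq]
    constructor
    · rintro rfl
      refine ⟨⟨_, rfl, _, hrep _⟩, fun j => ?_⟩
      rintro ⟨d', h, hd'⟩
      exact absurd (hmin _ d' hd') (by omega)
    · rintro ⟨⟨d', rfl, hd'⟩, h⟩
      refine le_antisymm (hmin _ _ hd') (le_of_not_gt fun hlt => ?_)
      exact h ⟨_, hlt⟩ ⟨_, rfl, _, hrep _⟩
  refine ⟨c d + 1, fun k => {X | c (q (C.incl d X)) = k}, fun k => ?_, fun k l hkl => ?_, ?_,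
    fun k => ?_⟩
  · change IsConstructibleSet {X | c (q (C.incl d X)) = k}
    rw [hO]
    exact ((hZ k).isLocallyClosed.inter
      (isOpen_iInter_of_finite fun j : Fin k =>
        (hZ j).isOpen_compl).isLocallyClosed).isConstructibleSet
  · refine Set.disjoint_left.2 fun X hk hl => hkl (Fin.ext ?_)
    exact hk.symm.trans hl
  · exact Set.eq_univ_of_forall fun X =>
      Set.mem_iUnion.2 ⟨⟨c (q (C.incl d X)), Nat.lt_succ_of_le (hle X)⟩, rfl⟩
  · by_cases hk : ∃ X, c (q (C.incl d X)) = k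
    · -- On this piece the first variety is constant, and the representative in it is a polynomial
      -- function of the point.
      obtain ⟨X₀, hX₀⟩ := hk
      refine isMorphismOn_of_eval fun a => ?_
      obtain ⟨u, hu⟩ := hF (q (C.incl d X₀)) (hle X₀) a
      obtain ⟨w, hw⟩ := C.exists_eval_eq_eval d (q (C.incl d X₀)) u
      refine ⟨w, fun X hX => ?_⟩
      have key : ∀ (d' : DimFiber κ) (h : c d' ≤ c d) (Y : CPoint R d'.1),
          d' = q (C.incl d X₀) → C.incl d' Y = C.incl d X →
          (F d' h Y).toCPoint.coord a = MvPolynomial.eval X.coord w := by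
        rintro d' h Y rfl hY
        exact (hu Y).trans (hw X Y hY)
      exact key _ (hle X) _ (hc (Eq.trans hX hX₀.symm)) (hrep _)
    · exact fun X hX => absurd ⟨X, hX⟩ hk

end ConstructibleResolution

end QuiverComplexes

open QuiverComplexes
theorem theoremA (V : Type) [Fintype V] [DecidableEq V] [Quiver.{0} V]
    [∀ s t : V, Finite (s ⟶ t)] (R : AdmissibleRelations V) (hR : HasFiniteGlobalDimension R)
    (κ : K₀ R) (C : ComplexSystem κ) (P : ProjectiveSystem κ) :
    ∃ φ' : C.Lim → P.Lim,
      (∀ d : DimFiber κ, ∃ (e : ProjFiber κ) (f : CPoint R d.1 → PPoint R e.1),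
        IsConstructibleMap (fun X => (f X).toCPoint) ∧
          ∀ X, φ' (C.incl d X) = P.incl e (f X)) ∧
      ∃ (Φ : P.Quotient → C.Quotient) (Φ' : C.Quotient → P.Quotient),
        (∀ (e : ProjFiber κ) (X : PPoint R e.1),
          Φ (P.toQuotient (P.incl e X)) = C.toQuotient (C.incl e.toDimFiber X.toCPoint)) ∧
        (∀ p : C.Lim, Φ' (C.toQuotient p) = P.toQuotient (φ' p)) ∧
        Function.LeftInverse Φ' Φ ∧ Function.RightInverse Φ' Φ := by
  obtain ⟨φ', hφ⟩ := exists_constructible_resolution hR C P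
  have hφ' : ∀ (d : DimFiber κ) (X : CPoint R d.1), ∃ (e : ProjFiber κ) (Y : PPoint R e.1),
      φ' (C.incl d X) = P.incl e Y ∧ DIso Y.toCPoint X := fun d X => by
    obtain ⟨e, f, -, h, h'⟩ := hφ d
    exact ⟨e, f X, h X, h' X⟩
  refine ⟨φ', fun d => (hφ d).imp fun e h => h.imp fun f h => ⟨h.1, h.2.1⟩, ?_⟩
  let Ψ : P.Lim → C.Quotient := Quot.lift
    (fun p => C.toQuotient (C.incl p.1.toDimFiber p.2.toCPoint)) <| by
      rintro ⟨e, X⟩ ⟨e', Y⟩ ⟨h, hXY⟩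
      have hY : DIso X.toCPoint Y.toCPoint := by
        change P.map h X = Y at hXY
        rw [← hXY]
        exact (P.dIso_map h X).symm
      exact Quot.sound ⟨_, _, _, _, rfl, rfl, hY⟩
  let Φ : P.Quotient → C.Quotient := Quot.lift Ψ <| by
    rintro _ _ ⟨e, e', X, Y, rfl, rfl, h⟩
    exact Quot.sound ⟨_, _, _, _, rfl, rfl, h⟩
  let Φ' : C.Quotient → P.Quotient := Quot.lift (fun p => P.toQuotient (φ' p)) <| by
    rintro _ _ ⟨d, d', X, Y, rfl, rfl, h⟩
    obtain ⟨e, X', hX, hX'⟩ := hφ' d X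
    obtain ⟨e', Y', hY, hY'⟩ := hφ' d' Y
    exact Quot.sound ⟨e, e', X', Y', hX.symm, hY.symm, (hX'.trans h).trans hY'.symm⟩
  refine ⟨Φ, Φ', fun _ _ => rfl, fun _ => rfl, fun x => ?_, fun x => ?_⟩
  · obtain ⟨⟨⟨e, X⟩⟩⟩ := x
    obtain ⟨e', Y, h, hY⟩ := hφ' e.toDimFiber X.toCPoint
    exact Quot.sound ⟨e', e, Y, X, h.symm, rfl, hY⟩
  · obtain ⟨⟨⟨d, X⟩⟩⟩ := x
    obtain ⟨e, Y, h, hY⟩ := hφ' d X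
    have h' : Φ (Φ' (C.toQuotient (C.incl d X))) =
        C.toQuotient (C.incl e.toDimFiber Y.toCPoint) := congrArg Ψ h
    exact h'.trans (Quot.sound ⟨e.toDimFiber, d, Y.toCPoint, X, rfl, rfl, hY⟩)
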